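/- Let $n \ge 1$ and let $H^n_{\mathbb H}$ be the $n$-th quaternionic Heisenberg group, i.e. the simply connected Lie group whose Lie algebra has the basis $h_1,\dots,h_n,i_1,\dots,i_n,j_1,\dots,j_n,k_1,\dots,k_n,I,J,K$ with $[k_m,j_m]=I=[i_m,h_m]$, $[i_m,k_m]=J=[j_m,h_m]$, $[j_m,i_m]=K=[k_m,h_m]$ for $1\le m\le n$ and all other brackets of basis elements, apart from those forced by antisymmetry, equal to zero. Equip $H^n_{\mathbb H}$ with any left-invariant Riemannian metric. A Lipschitz $m$-chain is a finite formal sum $a=\sum_j z_j\alpha_j$ with $z_j\in\mathbb Z$ and $\alpha_j:\Delta^m\to H^n_{\mathbb H}$ Lipschitz; its boundary is the usual alternating sum over the faces, and its mass is $\sum_j |z_j|\int_{\Delta^m}J_{\alpha_j}\,d\lambda$, where $J_{\alpha_j}$ is the Jacobian of $\alpha_j$ and $\lambda$ is Lebesgue measure. For $l>0$ let $$F^{n+1}_{H^n_{\mathbb H}}(l)=\sup_a\ \inf_b\ \operatorname{mass}(b)\in[0,\infty],$$ where $a$ runs over the Lipschitz $n$-cycles with $\operatorname{mass}(a)\le l$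 and $b$ over the Lipschitz $(n+1)$-chains with $\partial b=a$. Then $$F^{n+1}_{H^n_{\mathbb H}}(l)\succcurlyeq l^{\frac{n+2}{n}},$$ i.e. there is a constant $C>0$ such that $l^{\frac{n+2}{n}}\le C\,F^{n+1}_{H^n_{\mathbb H}}(Cl)+Cl+C$ for all $l>0$. -/

import Mathlib

open scoped Manifold ContDiff ENNReal NNReal Bundle

/-! ### Lipschitz chains and filling volume functions of a Riemannian manifold -/

namespace Filling

/-- The `m`-simplex `Δ^m` (a Euclidean simplex in `ℝ^m`), with vertices `0, e_0, …, e_{m-1}`. -/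
def simplex (m : ℕ) : Set (EuclideanSpace ℝ (Fin m)) :=
  {x | (∀ i, 0 ≤ x i) ∧ ∑ i, x i ≤ 1}

theorem zero_mem_simplex (m : ℕ) : (0 : EuclideanSpace ℝ (Fin m)) ∈ simplex m := by
  simp [simplex]

/-- Barycentric coordinates of a point of `ℝ^m` with respect to the vertices
`0, e_0, …, e_{m-1}` of `Δ^m`. -/
def bary {m : ℕ} (x : EuclideanSpace ℝ (Fin m)) : Fin (m + 1) → ℝ :=
  Fin.cons (1 - ∑ i, x i) (fun i => x i)

/-- The parametrization of the `i`-th face of `Δ^{m+1}` by `Δ^m`: the affine map which sends the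
vertices of `Δ^m`, in order, to the vertices of `Δ^{m+1}` other than the `i`-th one. -/
noncomputable def faceFun {m : ℕ} (i : Fin (m + 2)) (x : EuclideanSpace ℝ (Fin m)) :
    EuclideanSpace ℝ (Fin (m + 1)) :=
  WithLp.toLp 2 fun j => (i.insertNth (0 : ℝ) (bary x) : Fin (m + 2) → ℝ) j.succ

theorem bary_nonneg {m : ℕ} {x : EuclideanSpace ℝ (Fin m)} (hx : x ∈ simplex m)
    (j : Fin (m + 1)) : 0 ≤ bary x j := by
  refine Fin.cases ?_ (fun j => ?_) j
  · simpa [bary] using hx.2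
  · simpa [bary] using hx.1 j

theorem bary_sum {m : ℕ} (x : EuclideanSpace ℝ (Fin m)) : ∑ j, bary x j = 1 := by
  simp [bary, Fin.sum_univ_succ]

theorem faceFun_mem {m : ℕ} (i : Fin (m + 2)) {x : EuclideanSpace ℝ (Fin m)}
    (hx : x ∈ simplex m) : faceFun i x ∈ simplex (m + 1) := by
  have h0 : ∀ j, 0 ≤ (i.insertNth (0 : ℝ) (bary x) : Fin (m + 2) → ℝ) j := by
    intro j
    refine Fin.succAboveCases i ?_ (fun j => ?_) j
    · simp
    · simpa using bary_nonneg hx j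
  have h1 : ∑ j, (i.insertNth (0 : ℝ) (bary x) : Fin (m + 2) → ℝ) j = 1 := by
    rw [Fin.sum_univ_succAbove _ i]
    simp [bary_sum]
  refine ⟨fun j => h0 j.succ, ?_⟩
  rw [Fin.sum_univ_succ] at h1
  have := h0 0
  simp only [faceFun]
  linarith

theorem faceFun_lipschitz {m : ℕ} (i : Fin (m + 2)) :
    ∃ K : ℝ≥0, LipschitzWith K (faceFun (m := m) i) := by
  let L : EuclideanSpace ℝ (Fin m) →ₗ[ℝ] EuclideanSpace ℝ (Fin (m + 1)) :=
    { toFun := fun x => WithLp.toLp 2 fun j =>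
        (i.insertNth (0 : ℝ) (Fin.cons (-∑ i, x i) (fun i => x i) : Fin (m + 1) → ℝ) :
          Fin (m + 2) → ℝ) j.succ
      map_add' := by
        intro x y
        ext j
        simp only [PiLp.add_apply]
        refine Fin.succAboveCases i ?_ (fun k => ?_) j.succ
        · simp
        · refine Fin.cases ?_ (fun k => ?_) k
          · simp [Finset.sum_add_distrib]; ring
          · simp
      map_smul' := by
        intro c x
        ext j
        simp only [PiLp.smul_apply]
        refine Fin.succAboveCases i ?_ (fun k => ?_) j.succ
        · simp
        · refine Fin.cases ?_ (fun k => ?_) k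
          · simp [Finset.mul_sum]
          · simp }
  have hL : ∀ x, faceFun i x = L x + faceFun i 0 := by
    intro x
    ext j
    simp only [PiLp.add_apply, faceFun, L, LinearMap.coe_mk, AddHom.coe_mk]
    refine Fin.succAboveCases i ?_ (fun k => ?_) j.succ
    · simp
    · refine Fin.cases ?_ (fun k => ?_) k
      · simp [bary]; ring
      · simp [bary]
  refine ⟨‖LinearMap.toContinuousLinearMap L‖₊, fun x y => ?_⟩
  rw [hL x, hL y, edist_add_right]
  exact (LinearMap.toContinuousLinearMap L).lipschitz x y

/-- The `i`-th face map `Δ^m → Δ^{m+1}`. -/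
noncomputable def face {m : ℕ} (i : Fin (m + 2)) (x : simplex m) : simplex (m + 1) :=
  ⟨faceFun i x, faceFun_mem i x.2⟩

section Manifold

variable {E : Type*} [NormedAddCommGroup E] [NormedSpace ℝ E]
  {H : Type*} [TopologicalSpace H] {I : ModelWithCorners ℝ E H}
  {M : Type*} [TopologicalSpace M] [ChartedSpace H M] [IsManifold I ∞ M]

/-- The Riemannian distance of the metric `g`: the infimum of the `g`-lengths of `C^1` paths. -/
noncomputable def riemDist
    (g : Bundle.ContMDiffRiemannianMetric I ∞ E (fun x : M => TangentSpace I x)) (x y : M) : ℝ≥0∞ :=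
  letI : Bundle.RiemannianBundle (fun x : M => TangentSpace I x) := ⟨g.toRiemannianMetric⟩
  Manifold.riemannianEDist I x y

/-- Lipschitz maps `Δ^m → M`, for the Euclidean metric on `Δ^m` and the Riemannian distance. -/
def LipSimplex (g : Bundle.ContMDiffRiemannianMetric I ∞ E (fun x : M => TangentSpace I x))
    (m : ℕ) : Type _ :=
  {α : simplex m → M // ∃ K : ℝ≥0, ∀ x y, riemDist g (α x) (α y) ≤ K * edist x y}

/-- Lipschitz `m`-chains: finite formal sums of Lipschitz simplices with integer coefficients. -/
abbrev Chain (g : Bundle.ContMDiffRiemannianMetric I ∞ E (fun x : M => TangentSpace I x))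
    (m : ℕ) : Type _ :=
  LipSimplex g m →₀ ℤ

/-- The restriction of a Lipschitz simplex to its `i`-th face. -/
noncomputable def LipSimplex.face
    {g : Bundle.ContMDiffRiemannianMetric I ∞ E (fun x : M => TangentSpace I x)}
    {m : ℕ} (α : LipSimplex g (m + 1)) (i : Fin (m + 2)) : LipSimplex g m :=
  ⟨fun x => α.1 (Filling.face i x), by
    obtain ⟨K, hK⟩ := α.2
    obtain ⟨L, hL⟩ := faceFun_lipschitz (m := m) i
    refine ⟨K * L, fun x y => (hK _ _).trans ?_⟩
    rw [ENNReal.coe_mul, mul_assoc]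
    gcongr
    exact hL x.1 y.1⟩

/-- The boundary homomorphism from `m`-chains to `(m-1)`-chains,
`∂α = ∑ i, (-1)^i • α|Δ_i` on simplices (and zero for `m = 0`). -/
noncomputable def boundary
    (g : Bundle.ContMDiffRiemannianMetric I ∞ E (fun x : M => TangentSpace I x)) :
    (m : ℕ) → Chain g m →+ Chain g (m - 1)
  | 0 => 0
  | m + 1 => Finsupp.liftAddHom fun α : LipSimplex g (m + 1) =>
      (zmultiplesHom (Chain g m))
        (∑ i : Fin (m + 2), Finsupp.single (α.face i) ((-1 : ℤ) ^ (i : ℕ)))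

open Classical in
/-- Extension of a map on `Δ^m` to `ℝ^m`; the values outside of `Δ^m` are never used. -/
noncomputable def extend {m : ℕ} (α : simplex m → M) (x : EuclideanSpace ℝ (Fin m)) : M :=
  if h : x ∈ simplex m then α ⟨x, h⟩ else α ⟨0, zero_mem_simplex m⟩

/-- The Jacobian `J_α(x) = √ det (g(∂_i α, ∂_j α))_{ij}` of `α : Δ^m → M` with respect to `g`. -/
noncomputable def jacobian
    (g : Bundle.ContMDiffRiemannianMetric I ∞ E (fun x : M => TangentSpace I x))
    {m : ℕ} (α : simplex m → M) (x : EuclideanSpace ℝ (Fin m)) : ℝ :=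
  let D : Fin m → TangentSpace I (extend α x) := fun i =>
    mfderivWithin 𝓘(ℝ, EuclideanSpace ℝ (Fin m)) I (extend α) (simplex m) x
      (EuclideanSpace.single i (1 : ℝ) : EuclideanSpace ℝ (Fin m))
  Real.sqrt (Matrix.det (Matrix.of fun i j => g.inner (extend α x) (D i) (D j)))

/-- The volume `∫_{Δ^m} J_α dλ` of a Lipschitz simplex, `λ` being the Lebesgue measure. -/
noncomputable def LipSimplex.vol
    {g : Bundle.ContMDiffRiemannianMetric I ∞ E (fun x : M => TangentSpace I x)}
    {m : ℕ} (α : LipSimplex g m) : ℝ≥0∞ :=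
  ∫⁻ x in simplex m, ENNReal.ofReal (jacobian g α.1 x)

/-- The mass `∑ |z_j| vol(α_j)` of a Lipschitz chain `∑ z_j α_j`. -/
noncomputable def mass
    {g : Bundle.ContMDiffRiemannianMetric I ∞ E (fun x : M => TangentSpace I x)}
    {m : ℕ} (a : Chain g m) : ℝ≥0∞ :=
  a.sum fun α z => (z.natAbs : ℝ≥0∞) * α.vol

/-- `fillingVolume g m` is the `(m+1)`-dimensional filling volume function `F^{m+1}` of the
Riemannian manifold `(M, g)`: the supremum over the `m`-cycles `a` with `mass a ≤ l` of the
infimum of the masses of the `(m+1)`-chains `b` with `∂b = a`. -/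
noncomputable def fillingVolume
    (g : Bundle.ContMDiffRiemannianMetric I ∞ E (fun x : M => TangentSpace I x))
    (m : ℕ) (l : ℝ) : ℝ≥0∞ :=
  ⨆ (a : Chain g m) (_ : boundary g m a = 0) (_ : mass a ≤ ENNReal.ofReal l),
    ⨅ (b : Chain g (m + 1)) (_ : boundary g (m + 1) b = a), mass b

/-- A Riemannian metric on a Lie group is left-invariant if all left translations are
isometries. -/
def IsLeftInvariant [Group M]
    (g : Bundle.ContMDiffRiemannianMetric I ∞ E (fun x : M => TangentSpace I x)) : Prop :=
  ∀ (a x : M) (u v : TangentSpace I x),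
    g.inner (a * x) (mfderiv I I (fun y => a * y) x u) (mfderiv I I (fun y => a * y) x v)
      = g.inner x u v

end Manifold

/-- The relation `f ≼ g` for functions on the positive reals (the values at `l ≤ 0` play no role):
there is `C > 0` with `f(l) ≤ C g(C l) + C l + C` for all `l > 0`. -/
def AsympLE (f g : ℝ → ℝ≥0∞) : Prop :=
  ∃ C : ℝ, 0 < C ∧ ∀ l : ℝ, 0 < l →
    f l ≤ ENNReal.ofReal C * g (C * l) + ENNReal.ofReal (C * l) + ENNReal.ofReal C

end Filling

/-! ### The quaternionic Heisenberg group -/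

/-- The `n`-th quaternionic Heisenberg group, in exponential coordinates: as a manifold it is its
Lie algebra, the real vector space with basis `h_m, i_m, j_m, k_m` (`m < n`), `I, J, K`.
For `x : QuatHeisenberg n`, the numbers `x.1 m 0, x.1 m 1, x.1 m 2, x.1 m 3` are the coordinates
of `x` along `h_m, i_m, j_m, k_m`, and `x.2 0, x.2 1, x.2 2` those along `I, J, K`. The vector
space structure and the Lie bracket are those of the Lie algebra, and the group law is
`x * y = x + y + (1/2) [x, y]` (Baker-Campbell-Hausdorff). -/
def QuatHeisenberg (n : ℕ) : Type := (Fin n → Fin 4 → ℝ) × (Fin 3 → ℝ)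

namespace QuatHeisenberg

variable {n : ℕ}

noncomputable instance : NormedAddCommGroup (QuatHeisenberg n) :=
  inferInstanceAs (NormedAddCommGroup ((Fin n → Fin 4 → ℝ) × (Fin 3 → ℝ)))

noncomputable instance : NormedSpace ℝ (QuatHeisenberg n) :=
  inferInstanceAs (NormedSpace ℝ ((Fin n → Fin 4 → ℝ) × (Fin 3 → ℝ)))

instance : FiniteDimensional ℝ (QuatHeisenberg n) :=
  inferInstanceAs (FiniteDimensional ℝ ((Fin n → Fin 4 → ℝ) × (Fin 3 → ℝ)))

/-- The Lie bracket of two vectors in the span of `h_m, i_m, j_m, k_m`, in the basis `I, J, K`: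
`[k,j] = I = [i,h]`, `[i,k] = J = [j,h]`, `[j,i] = K = [k,h]`. -/
def bracketCoord (p q : Fin 4 → ℝ) : Fin 3 → ℝ :=
  ![(p 3 * q 2 - p 2 * q 3) + (p 1 * q 0 - p 0 * q 1),
    (p 1 * q 3 - p 3 * q 1) + (p 2 * q 0 - p 0 * q 2),
    (p 2 * q 1 - p 1 * q 2) + (p 3 * q 0 - p 0 * q 3)]

instance : Bracket (QuatHeisenberg n) (QuatHeisenberg n) where
  bracket x y := (0, ∑ m, bracketCoord (x.1 m) (y.1 m))

noncomputable instance : Mul (QuatHeisenberg n) where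
  mul x y := x + y + (1 / 2 : ℝ) • ⁅x, y⁆

theorem mul_def (x y : QuatHeisenberg n) : x * y = x + y + (1 / 2 : ℝ) • ⁅x, y⁆ := rfl

theorem bracketCoord_add_left (p p' q : Fin 4 → ℝ) :
    bracketCoord (p + p') q = bracketCoord p q + bracketCoord p' q := by
  ext c; fin_cases c <;> simp [bracketCoord] <;> ring

theorem bracketCoord_smul_left (t : ℝ) (p q : Fin 4 → ℝ) :
    bracketCoord (t • p) q = t • bracketCoord p q := by
  ext c; fin_cases c <;> simp [bracketCoord] <;> ring

theorem bracketCoord_swap (p q : Fin 4 → ℝ) : bracketCoord q p = -bracketCoord p q := by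
  ext c; fin_cases c <;> simp [bracketCoord] <;> ring

theorem bracket_swap (x y : QuatHeisenberg n) : ⁅y, x⁆ = -⁅x, y⁆ := by
  refine Prod.ext (neg_zero (G := Fin n → Fin 4 → ℝ)).symm ?_
  change (∑ m, bracketCoord (y.1 m) (x.1 m)) = -∑ m, bracketCoord (x.1 m) (y.1 m)
  rw [← Finset.sum_neg_distrib]
  exact Finset.sum_congr rfl fun m _ => bracketCoord_swap _ _

theorem bracket_add_left (x y z : QuatHeisenberg n) : ⁅x + y, z⁆ = ⁅x, z⁆ + ⁅y, z⁆ := by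
  refine Prod.ext (add_zero (0 : Fin n → Fin 4 → ℝ)).symm ?_
  change (∑ m, bracketCoord (x.1 m + y.1 m) (z.1 m))
    = (∑ m, bracketCoord (x.1 m) (z.1 m)) + ∑ m, bracketCoord (y.1 m) (z.1 m)
  rw [← Finset.sum_add_distrib]
  exact Finset.sum_congr rfl fun m _ => bracketCoord_add_left _ _ _

theorem bracket_smul_left (t : ℝ) (x y : QuatHeisenberg n) : ⁅t • x, y⁆ = t • ⁅x, y⁆ := by
  refine Prod.ext (smul_zero (A := Fin n → Fin 4 → ℝ) t).symm ?_
  change (∑ m, bracketCoord (t • x.1 m) (y.1 m)) = t • ∑ m, bracketCoord (x.1 m) (y.1 m)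
  rw [Finset.smul_sum]
  exact Finset.sum_congr rfl fun m _ => bracketCoord_smul_left _ _ _

theorem bracket_add_right (x y z : QuatHeisenberg n) : ⁅x, y + z⁆ = ⁅x, y⁆ + ⁅x, z⁆ := by
  rw [bracket_swap, bracket_add_left, neg_add, ← bracket_swap, ← bracket_swap]

theorem bracket_smul_right (t : ℝ) (x y : QuatHeisenberg n) : ⁅x, t • y⁆ = t • ⁅x, y⁆ := by
  rw [bracket_swap, bracket_smul_left, ← smul_neg, ← bracket_swap]

theorem bracket_bracket_left (x y z : QuatHeisenberg n) : ⁅⁅x, y⁆, z⁆ = 0 := by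
  refine Prod.ext rfl ?_
  change (∑ m, bracketCoord ((0 : Fin n → Fin 4 → ℝ) m) (z.1 m)) = 0
  refine Finset.sum_eq_zero fun m _ => ?_
  ext c; fin_cases c <;> simp [bracketCoord]

theorem bracket_bracket_right (x y z : QuatHeisenberg n) : ⁅x, ⁅y, z⁆⁆ = 0 := by
  rw [bracket_swap, bracket_bracket_left, neg_zero]

theorem bracket_self (x : QuatHeisenberg n) : ⁅x, x⁆ = 0 := by
  have h := bracket_swap x x
  rw [eq_neg_iff_add_eq_zero, ← two_smul ℝ] at h
  simpa using h

noncomputable instance : LieRing (QuatHeisenberg n) where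
  add_lie := bracket_add_left
  lie_add := bracket_add_right
  lie_self := bracket_self
  leibniz_lie x y z := by simp [bracket_bracket_left, bracket_bracket_right]

noncomputable instance : LieAlgebra ℝ (QuatHeisenberg n) where
  lie_smul := bracket_smul_right

noncomputable instance : One (QuatHeisenberg n) := ⟨0⟩

noncomputable instance : Inv (QuatHeisenberg n) := ⟨fun x => -x⟩

theorem one_def : (1 : QuatHeisenberg n) = 0 := rfl

theorem inv_def (x : QuatHeisenberg n) : x⁻¹ = -x := rfl

noncomputable instance : Group (QuatHeisenberg n) :=
  Group.ofLeftAxioms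
    (fun x y z => by
      simp only [mul_def, add_lie, lie_add, lie_smul, smul_lie, bracket_bracket_left,
        bracket_bracket_right, smul_zero, add_zero, smul_add]
      abel)
    (fun x => by simp [mul_def, one_def])
    (fun x => by simp [mul_def, one_def, inv_def])

/-- The bracket as a continuous bilinear map. -/
noncomputable def bracketL : QuatHeisenberg n →L[ℝ] QuatHeisenberg n →L[ℝ] QuatHeisenberg n :=
  LinearMap.toContinuousLinearMap
    ((LinearMap.toContinuousLinearMap (𝕜 := ℝ) (E := QuatHeisenberg n)
      (F' := QuatHeisenberg n)).toLinearMap.comp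
      (LinearMap.mk₂ ℝ (fun x y : QuatHeisenberg n => ⁅x, y⁆) bracket_add_left bracket_smul_left
        bracket_add_right bracket_smul_right))

theorem bracketL_apply (x y : QuatHeisenberg n) : bracketL x y = ⁅x, y⁆ := rfl

instance : LieGroup 𝓘(ℝ, QuatHeisenberg n) ∞ (QuatHeisenberg n) where
  contMDiff_mul := by
    rw [← modelWithCornersSelf_prod]
    have h : ContDiff ℝ ∞ fun p : QuatHeisenberg n × QuatHeisenberg n =>
        p.1 + p.2 + (1 / 2 : ℝ) • bracketL p.1 p.2 := by
      fun_prop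
    have h' := h.contMDiff
    rw [← chartedSpaceSelf_prod] at h'
    exact h'
  contMDiff_inv := contDiff_neg.contMDiff

/-- The Lie algebra of the Lie group `QuatHeisenberg n` (the tangent space at `1`, with the bracket
of left-invariant vector fields) is the Lie algebra `QuatHeisenberg n`. -/
theorem groupLieAlgebra_bracket
    (v w : GroupLieAlgebra 𝓘(ℝ, QuatHeisenberg n) (QuatHeisenberg n)) :
    ⁅v, w⁆ = Bracket.bracket (L := QuatHeisenberg n) (M := QuatHeisenberg n) v w := by
  have key : ∀ u : QuatHeisenberg n,
      (mulInvariantVectorField (I := 𝓘(ℝ, QuatHeisenberg n)) (G := QuatHeisenberg n) u :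
        QuatHeisenberg n → QuatHeisenberg n) = fun x => u + (1 / 2 : ℝ) • bracketL x u := by
    intro u
    funext x
    have h : HasFDerivAt (fun y : QuatHeisenberg n => x * y)
        (ContinuousLinearMap.id ℝ _ + (1 / 2 : ℝ) • bracketL x) 1 :=
      ((hasFDerivAt_id _).const_add x).add
        ((bracketL x).hasFDerivAt.const_smul (1 / 2 : ℝ))
    exact congrArg (fun L => L u) h.hasMFDerivAt.mfderiv
  have hd : ∀ u : QuatHeisenberg n, fderiv ℝ
      (fun x : QuatHeisenberg n => u + (1 / 2 : ℝ) • bracketL x u) 1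
        = (1 / 2 : ℝ) • bracketL.flip u := fun u =>
    (((bracketL.flip u).hasFDerivAt.const_smul (1 / 2 : ℝ)).const_add u).fderiv
  have h1 : ∀ u : QuatHeisenberg n, u + (1 / 2 : ℝ) • bracketL 1 u = u := by
    intro u; simp [one_def]
  have h2 : ∀ (a b : QuatHeisenberg n) (V W : QuatHeisenberg n → QuatHeisenberg n),
      V = (fun x => a + (1 / 2 : ℝ) • bracketL x a) →
      W = (fun x => b + (1 / 2 : ℝ) • bracketL x b) →
      VectorField.lieBracketWithin ℝ V W Set.univ 1 = ⁅a, b⁆ := by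
    intro a b V W hV hW
    rw [VectorField.lieBracketWithin_univ, hV, hW, VectorField.lieBracket, hd, hd, h1, h1]
    change (1 / 2 : ℝ) • ⁅a, b⁆ - (1 / 2 : ℝ) • ⁅b, a⁆ = ⁅a, b⁆
    rw [bracket_swap a b]
    module
  rw [GroupLieAlgebra.bracket_def, ← VectorField.mlieBracketWithin_univ,
    VectorField.mlieBracketWithin_eq_lieBracketWithin]
  exact h2 v w _ _ (key v) (key w)

end QuatHeisenberg

namespace Filling

open MeasureTheory Set Filter Topology

/-! ### The simplex as a convex body -/

/-! The lower bound comes from a calibration. Put `p_m = i_m + √-1 j_m`, `q_m = h_m + √-1 k_m`, `z =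
I + √-1 J`, read as complex coordinates on the group. The `z`-component of the bracket is the
complex symplectic form `∑ (p_m ∧ q_m)`, so the left-invariant form `θ` extending `z` satisfies `df
= θ + ∑ p_m dq_m` for `f = z + (1/2) ∑ p_m q_m`. Hence `θ ∧ dq_1 ∧ ⋯ ∧ dq_n = df ∧ dq_1 ∧ ⋯ ∧ dq_n`
is both left-invariant and exact (`det_fderiv_calibCoord`). Being left-invariant it is bounded by a
constant times volume, and being exact it integrates over a chain `b` to the integral of `f dq_1 ∧ ⋯
∧ dq_n` over `∂b`. So that boundary integral, the period, bounds the mass of every filling from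
below (`exists_enorm_chainPeriod_boundary_le`).

It remains to find cycles of small mass and large period. The `h_m`, `i_m` and `I` span a real
Heisenberg algebra, in which the gradient graph of a function `φ` lifts to a horizontal (Legendrian)
simplex. Dilation by `t` multiplies its volume by `t ^ n` because it is horizontal, while on it `f =
t ^ 2 φ` and `q_m = t x_m`, so its period is `t ^ (n + 2) ∫ φ`. Subtracting the simplex for `φ = 0`
from the one for a bump which vanishes to first order on the boundary gives a cycle
(`exists_cycle`), and `t = l ^ (1/n)` gives the exponent `(n + 2) / n`.

The analytic burden is Stokes' theorem for merely Lipschitz simplices (`jacIntegral_eq_sum_faces`).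
Both sides are multilinear in the functions `f_j`, and continuous in each one under uniform
convergence with bounded Lipschitz constants, since integration by parts moves the derivative off a
small function. Linear combinations of real exponentials `exp ∘ ℓ` are dense in this sense, and for
exponentials the form is a constant form times one exponential, so the identity reduces to linear
algebra and the fundamental theorem of calculus. Finally, Lipschitz for the Riemannian distance
implies Lipschitz in coordinates (`exists_lipschitzOnWith_extend`). -/

theorem isClosed_simplex (m : ℕ) : IsClosed (simplex m) := by
  have h : simplex m = (⋂ i, {x : EuclideanSpace ℝ (Fin m) | 0 ≤ x i}) ∩ {x | ∑ i, x i ≤ 1} := by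
    ext x; simp [simplex]
  rw [h]
  exact (isClosed_iInter fun i => isClosed_le (by fun_prop) (by fun_prop)).inter
    (isClosed_le (by fun_prop) (by fun_prop))

theorem convex_simplex (m : ℕ) : Convex ℝ (simplex m) := by
  intro x hx y hy a b ha hb hab
  refine ⟨fun i => ?_, ?_⟩
  · simp only [PiLp.add_apply, PiLp.smul_apply, smul_eq_mul]
    have := hx.1 i
    have := hy.1 i
    positivity
  · simp only [PiLp.add_apply, PiLp.smul_apply, smul_eq_mul, Finset.sum_add_distrib,
      ← Finset.mul_sum]
    nlinarith [hx.2, hy.2]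

theorem le_one_of_mem_simplex {m : ℕ} {x : EuclideanSpace ℝ (Fin m)} (hx : x ∈ simplex m)
    (i : Fin m) : x i ≤ 1 :=
  (Finset.single_le_sum (f := fun i => x i) (fun j _ => hx.1 j) (Finset.mem_univ i)).trans hx.2

theorem norm_le_one_of_mem_simplex {m : ℕ} {x : EuclideanSpace ℝ (Fin m)} (hx : x ∈ simplex m) :
    ‖x‖ ≤ 1 := by
  rw [EuclideanSpace.norm_eq, Real.sqrt_le_one]
  refine (Finset.sum_le_sum fun i _ => ?_).trans hx.2
  rw [Real.norm_eq_abs, sq_abs]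
  nlinarith [hx.1 i, le_one_of_mem_simplex hx i]

theorem isCompact_simplex (m : ℕ) : IsCompact (simplex m) :=
  (isCompact_closedBall (0 : EuclideanSpace ℝ (Fin m)) 1).of_isClosed_subset (isClosed_simplex m)
    fun x hx => by simpa using norm_le_one_of_mem_simplex hx

theorem measurableSet_simplex (m : ℕ) : MeasurableSet (simplex m) :=
  (isClosed_simplex m).measurableSet

theorem volume_simplex_lt_top (m : ℕ) : volume (simplex m) < ⊤ :=
  (isCompact_simplex m).measure_lt_top

instance (m : ℕ) : IsFiniteMeasure (volume.restrict (simplex m)) :=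
  ⟨by simpa using volume_simplex_lt_top m⟩

/-- The frontier of a convex set is null. This is what makes `fderiv` usable on the closed simplex:
almost everywhere it depends only on the values there. -/
theorem ae_mem_interior_simplex (m : ℕ) :
    ∀ᵐ x ∂volume.restrict (simplex m), x ∈ interior (simplex m) := by
  have h := (convex_simplex m).addHaar_frontier (volume : Measure (EuclideanSpace ℝ (Fin m)))
  rw [ae_restrict_iff' (measurableSet_simplex m)]
  filter_upwards [measure_eq_zero_iff_ae_notMem.1 h] with x hx hxs
  by_contra hxi
  exact hx ⟨subset_closure hxs, hxi⟩

/-! ### Lipschitz functions on the simplex -/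

/-- A complex function on `ℝ^m` is Lipschitz on the simplex. -/
def LipOn {m : ℕ} (f : EuclideanSpace ℝ (Fin m) → ℂ) : Prop :=
  ∃ K : ℝ≥0, LipschitzOnWith K f (simplex m)

namespace LipOn

variable {m : ℕ} {f u v : EuclideanSpace ℝ (Fin m) → ℂ}

theorem continuousOn (hf : LipOn f) : ContinuousOn f (simplex m) :=
  let ⟨_, hK⟩ := hf
  hK.continuousOn

theorem aestronglyMeasurable (hf : LipOn f) :
    AEStronglyMeasurable f (volume.restrict (simplex m)) :=
  hf.continuousOn.aestronglyMeasurable (measurableSet_simplex m)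

theorem exists_bound (hf : LipOn f) : ∃ B, 0 ≤ B ∧ ∀ x ∈ simplex m, ‖f x‖ ≤ B := by
  obtain ⟨B, hB⟩ := (isCompact_simplex m).exists_bound_of_continuousOn hf.continuousOn
  exact ⟨B, (norm_nonneg _).trans (hB 0 (zero_mem_simplex m)), hB⟩

/-- Rademacher's theorem within the simplex, upgraded at interior points. -/
theorem ae_differentiableAt (hf : LipOn f) :
    ∀ᵐ x ∂volume.restrict (simplex m), DifferentiableAt ℝ f x := by
  obtain ⟨K, hK⟩ := hf
  filter_upwards [hK.ae_differentiableWithinAt (measurableSet_simplex m),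
    ae_mem_interior_simplex m] with x hx hxi
  exact hx.differentiableAt (mem_interior_iff_mem_nhds.1 hxi)

theorem add (hu : LipOn u) (hv : LipOn v) : LipOn (u + v) := by
  obtain ⟨K, hK⟩ := hu
  obtain ⟨L, hL⟩ := hv
  exact ⟨K + L, hK.add hL⟩

theorem const_smul (c : ℂ) (hu : LipOn u) : LipOn (c • u) := by
  obtain ⟨K, hK⟩ := hu
  exact ⟨‖c‖₊ * K, (lipschitzWith_smul c).comp_lipschitzOnWith hK⟩

theorem sub (hu : LipOn u) (hv : LipOn v) : LipOn (u - v) := by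
  obtain ⟨K, hK⟩ := hu
  obtain ⟨L, hL⟩ := hv
  exact ⟨K + L, hK.sub hL⟩

theorem comp_faceFun {f : EuclideanSpace ℝ (Fin (m + 1)) → ℂ} (hf : LipOn f) (i : Fin (m + 2)) :
    LipOn (f ∘ faceFun i) := by
  obtain ⟨K, hK⟩ := hf
  obtain ⟨L, hL⟩ := faceFun_lipschitz (m := m) i
  exact ⟨K * L, hK.comp hL.lipschitzOnWith fun x hx => faceFun_mem i hx⟩

end LipOn

theorem _root_.ContDiff.lipOn {m : ℕ} {f : EuclideanSpace ℝ (Fin m) → ℂ} (hf : ContDiff ℝ 1 f) :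
    LipOn f :=
  hf.locallyLipschitz.locallyLipschitzOn.exists_lipschitzOnWith_of_compact (isCompact_simplex m)

/-! ### Jacobian integrals -/

/-- The complex Jacobian determinant of `N` complex functions on `ℝ^N`. -/
noncomputable def jacMatrix {N : ℕ} (f : Fin N → EuclideanSpace ℝ (Fin N) → ℂ)
    (x : EuclideanSpace ℝ (Fin N)) : Matrix (Fin N) (Fin N) ℂ :=
  Matrix.of fun i j => fderiv ℝ (f j) x (EuclideanSpace.single i (1 : ℝ))

/-- The integral over the simplex of the form `f₀ df₁ ∧ ⋯ ∧ df_N`. -/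
noncomputable def jacIntegral {N : ℕ} (f₀ : EuclideanSpace ℝ (Fin N) → ℂ)
    (f : Fin N → EuclideanSpace ℝ (Fin N) → ℂ) : ℂ :=
  ∫ x in simplex N, f₀ x * (jacMatrix f x).det

variable {N : ℕ} {f₀ g₀ : EuclideanSpace ℝ (Fin N) → ℂ}
  {f g : Fin N → EuclideanSpace ℝ (Fin N) → ℂ}

theorem stronglyMeasurable_jacMatrix (f : Fin N → EuclideanSpace ℝ (Fin N) → ℂ) :
    StronglyMeasurable (jacMatrix f) :=
  Measurable.stronglyMeasurable (β := Fin N → Fin N → ℂ) <|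
    measurable_pi_lambda _ fun _ => measurable_pi_lambda _ fun j =>
      measurable_fderiv_apply_const ℝ (f j) _

/-- Each entry is bounded by a Lipschitz constant, so every continuous function of the Jacobian
matrix is essentially bounded. -/
theorem exists_isCompact_jacMatrix_mem (hf : ∀ j, LipOn (f j)) :
    ∃ K : Set (Matrix (Fin N) (Fin N) ℂ), IsCompact K ∧
      ∀ᵐ x ∂volume.restrict (simplex N), jacMatrix f x ∈ K := by
  choose L hL using hf
  refine ⟨Set.pi univ fun i => Set.pi univ fun j => Metric.closedBall 0 (L j),
    isCompact_univ_pi fun i => isCompact_univ_pi fun j => isCompact_closedBall _ _, ?_⟩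
  filter_upwards [ae_mem_interior_simplex N] with x hx i _ j _
  rw [mem_closedBall_zero_iff]
  refine (ContinuousLinearMap.le_opNorm _ _).trans ?_
  simpa using norm_fderiv_le_of_lipschitzOn ℝ (mem_interior_iff_mem_nhds.1 hx) (hL j)

/-- A general `Φ` is allowed because both the determinant and the entries of the adjugate are needed
later. -/
theorem integrable_mul_comp_jacMatrix {Φ : Matrix (Fin N) (Fin N) ℂ → ℂ} (hΦ : Continuous Φ)
    (h₀ : LipOn f₀) (hf : ∀ j, LipOn (f j)) :
    Integrable (fun x => f₀ x * Φ (jacMatrix f x)) (volume.restrict (simplex N)) := by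
  obtain ⟨K, hK, hfK⟩ := exists_isCompact_jacMatrix_mem hf
  obtain ⟨B, hB⟩ := hK.exists_bound_of_continuousOn hΦ.continuousOn
  obtain ⟨B₀, -, hB₀⟩ := h₀.exists_bound
  refine Integrable.of_bound
    (h₀.aestronglyMeasurable.mul (hΦ.comp_stronglyMeasurable (stronglyMeasurable_jacMatrix f)).aestronglyMeasurable)
    (B₀ * B) ?_
  filter_upwards [hfK, ae_restrict_mem (measurableSet_simplex N)] with x hx hxs
  rw [norm_mul]
  exact mul_le_mul (hB₀ x hxs) (hB _ hx) (norm_nonneg _) ((norm_nonneg _).trans (hB₀ x hxs))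

theorem integrable_jacIntegral (h₀ : LipOn f₀) (hf : ∀ j, LipOn (f j)) :
    Integrable (fun x => f₀ x * (jacMatrix f x).det) (volume.restrict (simplex N)) :=
  integrable_mul_comp_jacMatrix (Φ := Matrix.det) (by fun_prop) h₀ hf

/-- Values off the simplex are irrelevant; this disposes of the arbitrary values of `extend`. -/
theorem jacIntegral_congr (h₀ : EqOn f₀ g₀ (simplex N)) (h : ∀ j, EqOn (f j) (g j) (simplex N)) :
    jacIntegral f₀ f = jacIntegral g₀ g := by
  refine integral_congr_ae ?_
  filter_upwards [ae_mem_interior_simplex N] with x hx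
  have : jacMatrix f x = jacMatrix g x := by
    ext i j
    have hfg : f j =ᶠ[𝓝 x] g j :=
      Filter.eventuallyEq_of_mem (mem_interior_iff_mem_nhds.1 hx) (h j)
    simp only [jacMatrix, Matrix.of_apply, hfg.fderiv_eq]
  simp only [this, h₀ (interior_subset hx)]

theorem jacMatrix_update (j : Fin N) (u : EuclideanSpace ℝ (Fin N) → ℂ)
    (x : EuclideanSpace ℝ (Fin N)) :
    jacMatrix (Function.update f j u) x =
      (jacMatrix f x).updateCol j fun i => fderiv ℝ u x (EuclideanSpace.single i (1 : ℝ)) := by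
  ext i k
  rcases eq_or_ne k j with rfl | hk
  · simp [jacMatrix]
  · simp [jacMatrix, hk]

theorem lipOn_update (hf : ∀ j, LipOn (f j)) (j : Fin N) {u : EuclideanSpace ℝ (Fin N) → ℂ}
    (hu : LipOn u) (k : Fin N) : LipOn (Function.update f j u k) := by
  rcases eq_or_ne k j with rfl | hk
  · simpa using hu
  · simpa [hk] using hf k

theorem jacIntegral_update_add (h₀ : LipOn f₀) (hf : ∀ j, LipOn (f j)) (j : Fin N)
    {u v : EuclideanSpace ℝ (Fin N) → ℂ} (hu : LipOn u) (hv : LipOn v) :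
    jacIntegral f₀ (Function.update f j (u + v)) =
      jacIntegral f₀ (Function.update f j u) + jacIntegral f₀ (Function.update f j v) := by
  rw [jacIntegral, jacIntegral, jacIntegral,
    ← integral_add (integrable_jacIntegral h₀ (lipOn_update hf j hu))
      (integrable_jacIntegral h₀ (lipOn_update hf j hv))]
  refine integral_congr_ae ?_
  filter_upwards [hu.ae_differentiableAt, hv.ae_differentiableAt] with x hx hy
  rw [jacMatrix_update, jacMatrix_update, jacMatrix_update, ← mul_add,
    ← Matrix.det_updateCol_add, fderiv_add hx hy]
  rfl

theorem jacIntegral_update_smul (j : Fin N) (c : ℂ) {u : EuclideanSpace ℝ (Fin N) → ℂ}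
    (hu : LipOn u) :
    jacIntegral f₀ (Function.update f j (c • u)) =
      c * jacIntegral f₀ (Function.update f j u) := by
  rw [jacIntegral, jacIntegral, ← integral_const_mul]
  refine integral_congr_ae ?_
  filter_upwards [hu.ae_differentiableAt] with x hx
  rw [jacMatrix_update, jacMatrix_update, mul_left_comm, fderiv_const_smul hx]
  congr 1
  exact Matrix.det_updateCol_smul _ _ _ _

theorem jacIntegral_add_left (hf : ∀ j, LipOn (f j)) {u v : EuclideanSpace ℝ (Fin N) → ℂ}
    (hu : LipOn u) (hv : LipOn v) :
    jacIntegral (u + v) f = jacIntegral u f + jacIntegral v f := by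
  rw [jacIntegral, jacIntegral, jacIntegral,
    ← integral_add (integrable_jacIntegral hu hf) (integrable_jacIntegral hv hf)]
  simp only [Pi.add_apply, add_mul]

theorem jacIntegral_smul_left (c : ℂ) (u : EuclideanSpace ℝ (Fin N) → ℂ) :
    jacIntegral (c • u) f = c * jacIntegral u f := by
  rw [jacIntegral, jacIntegral, ← integral_const_mul]
  simp only [Pi.smul_apply, smul_eq_mul, mul_assoc]

/-- `jacIntegral` depends continuously on the first function, in the uniform norm. -/
theorem exists_forall_norm_jacIntegral_left_le (hf : ∀ j, LipOn (f j)) {δ : ℝ} (hδ : 0 < δ) :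
    ∃ ε > 0, ∀ w : EuclideanSpace ℝ (Fin N) → ℂ, LipOn w → (∀ x ∈ simplex N, ‖w x‖ ≤ ε) →
      ‖jacIntegral w f‖ ≤ δ := by
  have hone : LipOn (fun _ : EuclideanSpace ℝ (Fin N) => (1 : ℂ)) := contDiff_const.lipOn
  have hint := integrable_jacIntegral hone hf
  simp only [one_mul] at hint
  set B := ∫ x in simplex N, ‖(jacMatrix f x).det‖
  have hB : 0 ≤ B := integral_nonneg fun _ => norm_nonneg _
  refine ⟨δ / (B + 1), by positivity, fun w hw hwε => ?_⟩
  calc ‖jacIntegral w f‖ ≤ ∫ x in simplex N, ‖w x * (jacMatrix f x).det‖ :=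
        norm_integral_le_integral_norm _
    _ ≤ ∫ x in simplex N, δ / (B + 1) * ‖(jacMatrix f x).det‖ := by
        refine integral_mono_ae (integrable_jacIntegral hw hf).norm (hint.norm.const_mul _) ?_
        filter_upwards [ae_restrict_mem (measurableSet_simplex N)] with x hx
        rw [norm_mul]
        exact mul_le_mul_of_nonneg_right (hwε x hx) (norm_nonneg _)
    _ = δ * (B / (B + 1)) := by rw [integral_const_mul]; ring
    _ ≤ δ := by
        refine mul_le_of_le_one_right hδ.le ?_
        rw [div_le_one (by positivity)]
        linarith

end Filling

namespace Filling

open MeasureTheory Set Filter Topology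

/-! ### Weak continuity of Jacobian integrals -/

variable {N : ℕ}

/-- Approximate `v` in `L¹` by a smooth compactly supported `g`. Against `g`, integration by parts
moves the derivative off `w`, and uniform smallness of `w` suffices; against `v - g`, the Lipschitz
bound on `w` suffices. The order of choices, first `g` and then `ε`, makes `ε` independent of `w`.
-/
theorem exists_forall_abs_integral_fderiv_mul_le {v : EuclideanSpace ℝ (Fin N) → ℝ}
    (hv : Integrable v (volume.restrict (simplex N))) (e : EuclideanSpace ℝ (Fin N)) (L : ℝ≥0)
    {δ : ℝ} (hδ : 0 < δ) :
    ∃ ε > 0, ∀ w : EuclideanSpace ℝ (Fin N) → ℝ, LipschitzOnWith L w (simplex N) →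
      (∀ x ∈ simplex N, |w x| ≤ ε) → |∫ x in simplex N, fderiv ℝ w x e * v x| ≤ δ := by
  set V := (simplex N).indicator v
  have hV : Integrable V := (integrable_indicator_iff (measurableSet_simplex N)).2 hv
  set η : ℝ := δ / (2 * (L * ‖e‖ + 1))
  have hη : 0 < η := by positivity
  obtain ⟨g, hgc, hg, hgV⟩ :=
    (memLp_one_iff_integrable.2 hV).exist_eLpNorm_sub_le ENNReal.one_ne_top le_rfl hη
  have hgi : Integrable g := hg.continuous.integrable_of_hasCompactSupport hgc
  have hgV' : ∫ x, ‖V x - g x‖ ≤ η := by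
    change ∫ x, ‖(V - g) x‖ ≤ η
    rw [integral_norm_eq_lintegral_enorm (hV.sub hgi).aestronglyMeasurable]
    rw [eLpNorm_one_eq_lintegral_enorm] at hgV
    exact ENNReal.toReal_le_of_le_ofReal hη.le hgV
  obtain ⟨D, hD⟩ := hg.lipschitzWith_of_hasCompactSupport hgc (by simp)
  have hg' : Integrable fun x => lineDeriv ℝ g x (-e) := by
    have : (fun x => lineDeriv ℝ g x (-e)) = fun x => fderiv ℝ g x (-e) := by
      ext x
      exact (hg.differentiable (by simp) x).lineDeriv_eq_fderiv
    rw [this]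
    refine Continuous.integrable_of_hasCompactSupport ?_ ?_
    · exact (hg.continuous_fderiv (by simp)).clm_apply continuous_const
    · exact hgc.fderiv_apply ℝ _
  set G := ∫ x, ‖lineDeriv ℝ g x (-e)‖
  have hG : 0 ≤ G := integral_nonneg fun _ => norm_nonneg _
  set ε : ℝ := δ / (2 * (G + 1))
  have hε : 0 < ε := by positivity
  refine ⟨ε, hε, fun w hw hwε => ?_⟩
  obtain ⟨w₁, hw₁, hww₁⟩ := hw.extend_real
  -- Clamping a Lipschitz extension to `[-ε, ε]` makes the uniform bound global without changing `w`
  -- on the simplex or increasing the Lipschitz constant.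
  set w₂ : EuclideanSpace ℝ (Fin N) → ℝ := fun x => max (-ε) (min ε (w₁ x))
  have hw₂ : LipschitzWith L w₂ := (hw₁.const_min ε).const_max (-ε)
  have hw₂ε : ∀ x, ‖w₂ x‖ ≤ ε := fun x => by
    rw [Real.norm_eq_abs, abs_le]
    exact ⟨le_max_left _ _, max_le (by linarith) (min_le_left _ _)⟩
  have hww₂ : EqOn w w₂ (simplex N) := fun x hx => by
    have := abs_le.1 (hwε x hx)
    simp only [w₂, ← hww₁ hx, min_eq_right this.2, max_eq_right this.1]
  have hbd : ∀ x, ‖lineDeriv ℝ w₂ x e‖ ≤ L * ‖e‖ := fun x =>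
    norm_lineDeriv_le_of_lipschitz ℝ hw₂
  have hmeas : AEStronglyMeasurable (fun x => lineDeriv ℝ w₂ x e) volume :=
    aestronglyMeasurable_lineDeriv hw₂.continuous _
  have h1 : ∫ x in simplex N, fderiv ℝ w x e * v x = ∫ x, lineDeriv ℝ w₂ x e * V x := by
    rw [← integral_indicator (measurableSet_simplex N)]
    refine integral_congr_ae ?_
    filter_upwards [hw₂.ae_differentiableAt, (ae_restrict_iff' (measurableSet_simplex N)).1
      (ae_mem_interior_simplex N)] with x hx hxi
    by_cases hxs : x ∈ simplex N
    · have hfg : w =ᶠ[𝓝 x] w₂ :=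
        Filter.eventuallyEq_of_mem (mem_interior_iff_mem_nhds.1 (hxi hxs)) hww₂
      simp only [V, indicator_of_mem hxs, hx.lineDeriv_eq_fderiv, hfg.fderiv_eq]
    · simp only [V, indicator_of_notMem hxs, mul_zero]
  have hi1 : Integrable fun x => lineDeriv ℝ w₂ x e * g x :=
    hgi.bdd_mul hmeas (.of_forall hbd)
  have hi2 : Integrable fun x => lineDeriv ℝ w₂ x e * (V x - g x) :=
    (hV.sub hgi).bdd_mul hmeas (.of_forall hbd)
  have h2 : ∫ x, lineDeriv ℝ w₂ x e * V x =
      (∫ x, lineDeriv ℝ g x (-e) * w₂ x) + ∫ x, lineDeriv ℝ w₂ x e * (V x - g x) := by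
    rw [← hw₂.integral_lineDeriv_mul_eq hD hgc e, ← integral_add hi1 hi2]
    congr 1; ext x; ring
  have h3 : |∫ x, lineDeriv ℝ g x (-e) * w₂ x| ≤ δ / 2 := by
    calc |∫ x, lineDeriv ℝ g x (-e) * w₂ x| ≤ ∫ x, ‖lineDeriv ℝ g x (-e) * w₂ x‖ :=
          abs_integral_le_integral_abs
      _ ≤ ∫ x, ‖lineDeriv ℝ g x (-e)‖ * ε := by
          refine integral_mono ?_ (hg'.norm.mul_const _) fun x => ?_
          · exact (hg'.mul_bdd (c := ε) hw₂.continuous.aestronglyMeasurable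
              (.of_forall hw₂ε)).norm
          · simp only [norm_mul]
            exact mul_le_mul_of_nonneg_left (hw₂ε x) (norm_nonneg _)
      _ = δ / 2 * (G / (G + 1)) := by rw [integral_mul_const]; simp only [ε, G]; field_simp
      _ ≤ δ / 2 := by
          refine mul_le_of_le_one_right (by positivity) ?_
          rw [div_le_one (by positivity)]; linarith
  have h4 : |∫ x, lineDeriv ℝ w₂ x e * (V x - g x)| ≤ δ / 2 := by
    calc |∫ x, lineDeriv ℝ w₂ x e * (V x - g x)|
        ≤ ∫ x, ‖lineDeriv ℝ w₂ x e * (V x - g x)‖ := abs_integral_le_integral_abs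
      _ ≤ ∫ x, (L * ‖e‖) * ‖V x - g x‖ := by
          refine integral_mono hi2.norm ((hV.sub hgi).norm.const_mul _) fun x => ?_
          simp only [norm_mul]
          exact mul_le_mul_of_nonneg_right (hbd x) (norm_nonneg _)
      _ ≤ (L * ‖e‖) * η := by
          rw [integral_const_mul]
          exact mul_le_mul_of_nonneg_left hgV' (by positivity)
      _ = δ / 2 * ((L * ‖e‖) / (L * ‖e‖ + 1)) := by simp only [η]; field_simp
      _ ≤ δ / 2 := by
          refine mul_le_of_le_one_right (by positivity) ?_
          rw [div_le_one (by positivity)]; linarith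
  rw [h1, h2]
  exact (abs_add_le _ _).trans (by linarith)

theorem exists_forall_norm_integral_fderiv_mul_le {v : EuclideanSpace ℝ (Fin N) → ℂ}
    (hv : Integrable v (volume.restrict (simplex N))) (e : EuclideanSpace ℝ (Fin N)) (L : ℝ≥0)
    {δ : ℝ} (hδ : 0 < δ) :
    ∃ ε > 0, ∀ w : EuclideanSpace ℝ (Fin N) → ℂ, LipschitzOnWith L w (simplex N) →
      (∀ x ∈ simplex N, ‖w x‖ ≤ ε) → ‖∫ x in simplex N, fderiv ℝ w x e * v x‖ ≤ δ := by
  -- Splitting the product into real and imaginary parts produces four real integrals, whence `δ /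
  -- 4`.
  obtain ⟨ε₁, hε₁, h₁⟩ := exists_forall_abs_integral_fderiv_mul_le hv.re e L
    (show 0 < δ / 4 by positivity)
  obtain ⟨ε₂, hε₂, h₂⟩ := exists_forall_abs_integral_fderiv_mul_le hv.im e L
    (show 0 < δ / 4 by positivity)
  refine ⟨min ε₁ ε₂, lt_min hε₁ hε₂, fun w hw hwε => ?_⟩
  have hre : LipschitzOnWith L (fun x => (w x).re) (simplex N) := fun x hx y hy =>
    le_trans (by
      simp only [edist_dist, Complex.dist_eq, Real.dist_eq, ← Complex.sub_re]
      exact ENNReal.ofReal_le_ofReal (Complex.abs_re_le_norm _)) (hw hx hy)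
  have him : LipschitzOnWith L (fun x => (w x).im) (simplex N) := fun x hx y hy =>
    le_trans (by
      simp only [edist_dist, Complex.dist_eq, Real.dist_eq, ← Complex.sub_im]
      exact ENNReal.ofReal_le_ofReal (Complex.abs_im_le_norm _)) (hw hx hy)
  have hwre : ∀ x ∈ simplex N, |(w x).re| ≤ min ε₁ ε₂ := fun x hx =>
    (Complex.abs_re_le_norm _).trans (hwε x hx)
  have hwim : ∀ x ∈ simplex N, |(w x).im| ≤ min ε₁ ε₂ := fun x hx =>
    (Complex.abs_im_le_norm _).trans (hwε x hx)
  have hdiff := LipOn.ae_differentiableAt ⟨L, hw⟩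
  have hfd : ∀ x, DifferentiableAt ℝ w x →
      fderiv ℝ (fun x => (w x).re) x e = (fderiv ℝ w x e).re ∧
      fderiv ℝ (fun x => (w x).im) x e = (fderiv ℝ w x e).im := fun x hx =>
    ⟨congrArg (fun T => T e) (Complex.reCLM.hasFDerivAt.comp x hx.hasFDerivAt).fderiv,
      congrArg (fun T => T e) (Complex.imCLM.hasFDerivAt.comp x hx.hasFDerivAt).fderiv⟩
  have hbdd : ∀ᵐ x ∂volume.restrict (simplex N), ‖fderiv ℝ w x e‖ ≤ L * ‖e‖ := by
    filter_upwards [ae_mem_interior_simplex N] with x hx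
    exact (ContinuousLinearMap.le_opNorm _ _).trans (mul_le_mul_of_nonneg_right
      (norm_fderiv_le_of_lipschitzOn ℝ (mem_interior_iff_mem_nhds.1 hx) hw) (norm_nonneg _))
  have hmeas : Measurable fun x => fderiv ℝ w x e := measurable_fderiv_apply_const ℝ w e
  have hint : Integrable (fun x => fderiv ℝ w x e * v x) (volume.restrict (simplex N)) :=
    hv.bdd_mul hmeas.aestronglyMeasurable hbdd
  have hR : ∀ {p q : EuclideanSpace ℝ (Fin N) → ℝ}, Measurable p →
      (∀ x, |p x| ≤ ‖fderiv ℝ w x e‖) → Integrable q (volume.restrict (simplex N)) →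
      Integrable (fun x => p x * q x) (volume.restrict (simplex N)) := fun hp hpb hq =>
    hq.bdd_mul (c := L * ‖e‖) hp.aestronglyMeasurable
      (by filter_upwards [hbdd] with x hx using (hpb x).trans hx)
  have hvr : Integrable (fun x => (v x).re) (volume.restrict (simplex N)) := hv.re
  have hvi : Integrable (fun x => (v x).im) (volume.restrict (simplex N)) := hv.im
  have hmre : Measurable fun x => (fderiv ℝ w x e).re := Complex.measurable_re.comp hmeas
  have hmim : Measurable fun x => (fderiv ℝ w x e).im := Complex.measurable_im.comp hmeas
  have hbre : ∀ x, |(fderiv ℝ w x e).re| ≤ ‖fderiv ℝ w x e‖ := fun x => Complex.abs_re_le_norm _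
  have hbim : ∀ x, |(fderiv ℝ w x e).im| ≤ ‖fderiv ℝ w x e‖ := fun x => Complex.abs_im_le_norm _
  have key : ∀ {p q : EuclideanSpace ℝ (Fin N) → ℝ},
      (∀ x, DifferentiableAt ℝ w x → fderiv ℝ p x e = q x) → ∀ r : EuclideanSpace ℝ (Fin N) → ℝ,
      ∫ x in simplex N, q x * r x = ∫ x in simplex N, fderiv ℝ p x e * r x := fun h r => by
    refine integral_congr_ae ?_
    filter_upwards [hdiff] with x hx
    rw [h x hx]
  have e1 : (∫ x in simplex N, fderiv ℝ w x e * v x).re =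
      (∫ x in simplex N, fderiv ℝ (fun x => (w x).re) x e * (v x).re) -
        ∫ x in simplex N, fderiv ℝ (fun x => (w x).im) x e * (v x).im := by
    rw [← key fun x hx => (hfd x hx).1, ← key fun x hx => (hfd x hx).2,
      ← integral_sub (hR hmre hbre hvr) (hR hmim hbim hvi)]
    exact (integral_re hint).symm
  have e2 : (∫ x in simplex N, fderiv ℝ w x e * v x).im =
      (∫ x in simplex N, fderiv ℝ (fun x => (w x).re) x e * (v x).im) +
        ∫ x in simplex N, fderiv ℝ (fun x => (w x).im) x e * (v x).re := by
    rw [← key fun x hx => (hfd x hx).1, ← key fun x hx => (hfd x hx).2,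
      ← integral_add (hR hmre hbre hvi) (hR hmim hbim hvr)]
    exact (integral_im hint).symm
  refine (Complex.norm_le_abs_re_add_abs_im _).trans ?_
  rw [e1, e2]
  have a1 := h₁ _ hre fun x hx => (hwre x hx).trans (min_le_left _ _)
  have a2 := h₂ _ hre fun x hx => (hwre x hx).trans (min_le_right _ _)
  have a3 := h₁ _ him fun x hx => (hwim x hx).trans (min_le_left _ _)
  have a4 := h₂ _ him fun x hx => (hwim x hx).trans (min_le_right _ _)
  refine (add_le_add (abs_sub _ _) (abs_add_le _ _)).trans ?_
  simp only [RCLike.re_to_complex, RCLike.im_to_complex] at a1 a2 a3 a4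
  linarith

/-- `jacIntegral` depends continuously on each of the differentiated functions, with respect to
uniform convergence with bounded Lipschitz constants. -/
theorem exists_forall_norm_jacIntegral_update_le {f₀ : EuclideanSpace ℝ (Fin N) → ℂ}
    {f : Fin N → EuclideanSpace ℝ (Fin N) → ℂ} (h₀ : LipOn f₀) (hf : ∀ j, LipOn (f j))
    (j : Fin N) (L : ℝ≥0) {δ : ℝ} (hδ : 0 < δ) :
    ∃ ε > 0, ∀ w : EuclideanSpace ℝ (Fin N) → ℂ, LipschitzOnWith L w (simplex N) →
      (∀ x ∈ simplex N, ‖w x‖ ≤ ε) → ‖jacIntegral f₀ (Function.update f j w)‖ ≤ δ := by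
  have hN : (0 : ℝ) < N := by exact_mod_cast Fin.pos j
  have hadj : ∀ i, Integrable (fun x => f₀ x * (jacMatrix f x).adjugate j i)
      (volume.restrict (simplex N)) := fun i =>
    integrable_mul_comp_jacMatrix (Φ := fun A => A.adjugate j i)
      ((continuous_id.matrix_adjugate).matrix_elem j i) h₀ hf
  choose ε hε h using fun i : Fin N => exists_forall_norm_integral_fderiv_mul_le (hadj i)
    (EuclideanSpace.single i (1 : ℝ)) L (show 0 < δ / N by positivity)
  have hne : (Finset.univ : Finset (Fin N)).Nonempty := ⟨j, Finset.mem_univ j⟩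
  refine ⟨Finset.univ.inf' hne ε, (Finset.lt_inf'_iff hne).2 fun i _ => hε i,
    fun w hw hwε => ?_⟩
  have hbdd : ∀ i, ∀ᵐ x ∂volume.restrict (simplex N),
      ‖fderiv ℝ w x (EuclideanSpace.single i (1 : ℝ))‖ ≤ L := fun i => by
    filter_upwards [ae_mem_interior_simplex N] with x hx
    refine (ContinuousLinearMap.le_opNorm _ _).trans ?_
    simpa using norm_fderiv_le_of_lipschitzOn ℝ (mem_interior_iff_mem_nhds.1 hx) hw
  -- Cramer's rule along column `j`: the coefficients of the partial derivatives of `w` are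
  -- integrable functions that do not involve `w`.
  have hexp : jacIntegral f₀ (Function.update f j w) =
      ∑ i, ∫ x in simplex N, fderiv ℝ w x (EuclideanSpace.single i (1 : ℝ)) *
        (f₀ x * (jacMatrix f x).adjugate j i) := by
    rw [← integral_finsetSum _ fun i _ => (hadj i).bdd_mul
      (measurable_fderiv_apply_const ℝ w _).aestronglyMeasurable (hbdd i)]
    refine integral_congr_ae (.of_forall fun x => ?_)
    simp only
    rw [jacMatrix_update, ← Matrix.cramer_apply, Matrix.cramer_eq_adjugate_mulVec,
      Matrix.mulVec, dotProduct, Finset.mul_sum]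
    exact Finset.sum_congr rfl fun i _ => by ring
  rw [hexp]
  refine (norm_sum_le _ _).trans ((Finset.sum_le_sum fun i _ =>
    h i w hw fun x hx => (hwε x hx).trans (Finset.inf'_le _ (Finset.mem_univ i))).trans ?_)
  simp only [Finset.sum_const, Finset.card_univ, Fintype.card_fin, nsmul_eq_mul]
  exact (mul_div_cancel₀ δ hN.ne').le

end Filling

namespace Filling

open MeasureTheory Set Filter Topology

/-! ### Approximation by sums of real exponentials -/

variable {N : ℕ}

/-- The function `exp ∘ ℓ` for a linear functional `ℓ`. -/
noncomputable def expFun (ℓ : EuclideanSpace ℝ (Fin N) →L[ℝ] ℝ) (x : EuclideanSpace ℝ (Fin N)) :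
    ℂ :=
  (Real.exp (ℓ x) : ℂ)

theorem contDiff_expFun (ℓ : EuclideanSpace ℝ (Fin N) →L[ℝ] ℝ) : ContDiff ℝ 1 (expFun ℓ) :=
  Complex.ofRealCLM.contDiff.comp (Real.contDiff_exp.comp ℓ.contDiff)

/-- Stone–Weierstrass. Exponentials of linear functionals are closed under products, so the algebra
they generate is their linear span, and the coordinate functionals separate points. -/
theorem exists_finsupp_exp_near {K : Set (EuclideanSpace ℝ (Fin N))} (hK : IsCompact K)
    {ρ : EuclideanSpace ℝ (Fin N) → ℝ} (hρ : Continuous ρ) {η : ℝ} (hη : 0 < η) :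
    ∃ c : (EuclideanSpace ℝ (Fin N) →L[ℝ] ℝ) →₀ ℝ,
      ∀ x ∈ K, |(c.sum fun ℓ a => a * Real.exp (ℓ x)) - ρ x| < η := by
  let v : (EuclideanSpace ℝ (Fin N) →L[ℝ] ℝ) → C(EuclideanSpace ℝ (Fin N), ℝ) := fun ℓ =>
    ⟨fun x => Real.exp (ℓ x), by fun_prop⟩
  have hcl : ∀ x ∈ Submonoid.closure (range v), x ∈ range v := by
    intro x hx
    induction hx using Submonoid.closure_induction with
    | mem x hx => exact hx
    | one => exact ⟨0, by ext; simp [v]⟩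
    | mul x y _ _ hx hy =>
      obtain ⟨a, rfl⟩ := hx
      obtain ⟨b, rfl⟩ := hy
      exact ⟨a + b, by ext; simp [v, Real.exp_add]⟩
  have hsp := Algebra.adjoin_eq_span_of_subset (R := ℝ) (s := range v)
    fun x hx => Submodule.subset_span (hcl x hx)
  have hsep : (Algebra.adjoin ℝ (range v)).SeparatesPoints := by
    intro x y hxy
    obtain ⟨i, hi⟩ : ∃ i, x i ≠ y i := by
      by_contra! h
      exact hxy (PiLp.ext h)
    refine ⟨_, ⟨v (EuclideanSpace.proj i), Algebra.subset_adjoin ⟨_, rfl⟩, rfl⟩, ?_⟩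
    simpa [v] using hi
  obtain ⟨g, hgA, hg⟩ :=
    ContinuousMap.exists_mem_subalgebra_near_continuous_of_isCompact_of_separatesPoints
      hsep ⟨ρ, hρ⟩ hK hη
  have hg' : g ∈ Submodule.span ℝ (range v) := by
    rw [← hsp]
    exact hgA
  obtain ⟨c, rfl⟩ := Finsupp.mem_span_range_iff_exists_finsupp.1 hg'
  refine ⟨c, fun x hx => ?_⟩
  have := hg x hx
  simpa [Finsupp.sum, v, ContinuousMap.sum_apply] using this

/-- A Lipschitz function on the simplex extends to a compactly supported Lipschitz function. -/
theorem LipOn.exists_extension {f : EuclideanSpace ℝ (Fin N) → ℂ} (hf : LipOn f) :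
    ∃ (K : ℝ≥0) (F : EuclideanSpace ℝ (Fin N) → ℂ), LipschitzWith K F ∧
      EqOn f F (simplex N) ∧ ∀ x, F x ≠ 0 → ‖x‖ < 2 := by
  obtain ⟨B, hB, hfB⟩ := hf.exists_bound
  obtain ⟨K, hK⟩ := hf
  lift B to ℝ≥0 using hB
  classical
  -- The two pieces of `S` are at distance at least `1`, so dropping from values bounded by `B` to
  -- zero costs a Lipschitz constant of at most `B`.
  let S : Set (EuclideanSpace ℝ (Fin N)) := simplex N ∪ {x | 2 ≤ ‖x‖}
  let f₁ : EuclideanSpace ℝ (Fin N) → ℂ := fun x => if x ∈ simplex N then f x else 0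
  have hdisj : ∀ x ∈ simplex N, ∀ y ∉ simplex N, y ∈ S → 1 ≤ dist x y := by
    intro x hx y hy hyS
    have h2 : 2 ≤ ‖y‖ := hyS.resolve_left hy
    have h1 := norm_le_one_of_mem_simplex hx
    rw [dist_comm, dist_eq_norm]
    linarith [norm_sub_norm_le y x]
  have hf₁ : LipschitzOnWith (max K B) f₁ S := by
    refine LipschitzOnWith.of_dist_le_mul fun x hx y hy => ?_
    by_cases hxs : x ∈ simplex N <;> by_cases hys : y ∈ simplex N
    · simp only [f₁, hxs, hys, if_true]
      refine (hK.dist_le_mul x hxs y hys).trans (mul_le_mul_of_nonneg_right ?_ dist_nonneg)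
      exact_mod_cast le_max_left _ _
    · simp only [f₁, hxs, hys, if_true, if_false, dist_zero_right]
      have h1 := hdisj x hxs y hys hy
      have h2 : (B : ℝ) ≤ (max K B : ℝ≥0) := by exact_mod_cast le_max_right _ _
      nlinarith [hfB x hxs]
    · simp only [f₁, hxs, hys, if_true, if_false, dist_zero_left]
      have h1 := hdisj y hys x hxs hx
      rw [dist_comm] at h1
      have h2 : (B : ℝ) ≤ (max K B : ℝ≥0) := by exact_mod_cast le_max_right _ _
      nlinarith [hfB y hys]
    · simp only [f₁, hxs, hys, if_false, dist_self]
      positivity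
  obtain ⟨F, hF, hFe⟩ := hf₁.extend_finite_dimension
  refine ⟨_, F, hF, fun x hx => ?_, fun x hx => ?_⟩
  · rw [← hFe (Or.inl hx)]
    simp only [f₁, hx, if_true]
  · by_contra! h
    refine hx ?_
    rw [← hFe (Or.inr h)]
    have hxs : x ∉ simplex N := fun hxs => by linarith [norm_le_one_of_mem_simplex hxs]
    simp only [f₁, hxs, if_false]

/-- A Lipschitz function on the simplex is a uniform limit of sums of exponentials with bounded
Lipschitz constants. -/
theorem LipOn.exists_expSpan_near {f : EuclideanSpace ℝ (Fin N) → ℂ} (hf : LipOn f) :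
    ∃ L : ℝ≥0, ∀ ε > 0, ∃ u ∈ Submodule.span ℂ (range (expFun (N := N))),
      LipschitzOnWith L u (simplex N) ∧ ∀ x ∈ simplex N, ‖u x - f x‖ ≤ ε := by
  obtain ⟨K, F, hF, hfF, hFs⟩ := hf.exists_extension
  have hFc : HasCompactSupport F := by
    refine HasCompactSupport.intro (isCompact_closedBall (0 : EuclideanSpace ℝ (Fin N)) 2)
      fun x hx => ?_
    by_contra h
    exact hx (by simpa using (hFs x h).le)
  obtain ⟨M, hM⟩ := hFc.exists_bound_of_continuous hF.continuous
  have hM0 : 0 ≤ M := (norm_nonneg _).trans (hM 0)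
  refine ⟨K * 2, fun ε hε => ?_⟩
  -- Radius `3` holds every `x - y` with `x` in the simplex (norm at most `1`) and `y` in the
  -- support of `F` (norm less than `2`).
  set D : Set (EuclideanSpace ℝ (Fin N)) := Metric.closedBall 0 3
  have hD : IsCompact D := isCompact_closedBall _ _
  set V := volume.real D
  have hV : 0 ≤ V := measureReal_nonneg
  -- The first bound puts the support of the mollifier inside `D`; the second makes the
  -- mollification error `K * r` at most `ε / 2`.
  set r : ℝ := min 1 (ε / (2 * (K + 1)))
  have hr : 0 < r := by positivity
  let φ : ContDiffBump (0 : EuclideanSpace ℝ (Fin N)) := ⟨r / 2, r, by positivity, by linarith⟩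
  set ρ := φ.normed volume
  have hρc : Continuous ρ := φ.continuous_normed
  have hρ0 : ∀ x, 0 ≤ ρ x := fun x => φ.nonneg_normed x
  have hρ1 : ∫ x, ρ x = 1 := φ.integral_normed
  have hρi : Integrable ρ := φ.integrable_normed
  have hρs : ∀ x, ρ x ≠ 0 → ‖x‖ < r := fun x hx => by
    have : x ∈ Function.support ρ := hx
    rw [φ.support_normed_eq] at this
    simpa using this
  -- The first bound gives `∫ |P| ≤ 2` on `D`, hence the Lipschitz constant `K * 2` independent of
  -- `ε`; the second makes the error of replacing `ρ` by `P` at most `ε / 2`.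
  set η : ℝ := min (1 / (V + 1)) (ε / (2 * (M * V + 1)))
  have hη : 0 < η := by positivity
  obtain ⟨c, hc⟩ := exists_finsupp_exp_near hD hρc hη
  set P : EuclideanSpace ℝ (Fin N) → ℝ := fun x => c.sum fun ℓ a => a * Real.exp (ℓ x) with hP
  have hPc : Continuous P := by
    simp only [hP, Finsupp.sum]
    fun_prop
  -- Convolution with `P` in place of `ρ`. Although `P` is uncontrolled off `D`, over the simplex
  -- only its values on `D` enter.
  let u : EuclideanSpace ℝ (Fin N) → ℂ := fun x => ∫ y, F y * (P (x - y) : ℂ)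
  have hu : ∀ x ∈ simplex N, u x = ∫ y in D, F (x - y) * (P y : ℂ) := by
    intro x hx
    have h1 : u x = ∫ y, F (x - y) * (P y : ℂ) := by
      rw [← integral_sub_left_eq_self _ volume x]
      simp only [u, sub_sub_cancel]
    rw [h1, setIntegral_eq_integral_of_forall_compl_eq_zero]
    intro y hy
    have : F (x - y) = 0 := by
      by_contra h
      refine hy ?_
      have h1 := hFs _ h
      have h2 := norm_le_one_of_mem_simplex hx
      rw [mem_closedBall_zero_iff]
      have h3 := norm_sub_norm_le y x
      rw [norm_sub_rev] at h3
      linarith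
    rw [this, zero_mul]
  have hFP : ∀ x, IntegrableOn (fun y => F (x - y) * (P y : ℂ)) D := fun x =>
    ContinuousOn.integrableOn_compact hD (by
      have := hF.continuous
      fun_prop)
  have hPi : IntegrableOn (fun y => |P y|) D :=
    ContinuousOn.integrableOn_compact hD (by fun_prop)
  have hPρ : IntegrableOn (fun y => |P y - ρ y|) D :=
    ContinuousOn.integrableOn_compact hD (by fun_prop)
  have hPρη : ∫ y in D, |P y - ρ y| ≤ η * V := by
    calc ∫ y in D, |P y - ρ y| ≤ ∫ y in D, η :=
          setIntegral_mono_on hPρ (integrableOn_const hD.measure_lt_top.ne)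
            hD.measurableSet fun y hy => (hc y hy).le
      _ = η * V := by simp [V, mul_comm]
  have hρD : ∫ y in D, ρ y ≤ 1 := by
    rw [← hρ1]
    exact setIntegral_le_integral hρi (.of_forall hρ0)
  have hηV : η * V ≤ 1 := by
    calc η * V ≤ 1 / (V + 1) * V := mul_le_mul_of_nonneg_right (min_le_left _ _) hV
      _ = V / (V + 1) := by ring
      _ ≤ 1 := by rw [div_le_one (by positivity)]; linarith
  refine ⟨u, ?_, ?_, ?_⟩
  -- Since `exp (ℓ (x - y)) = exp (ℓ x) * exp (-ℓ y)`, the convolution is a finite combination of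
  -- exponentials in `x`.
  · have hexp : u = c.sum fun ℓ a =>
        ((a : ℂ) * ∫ y, F y * (Real.exp (-ℓ y) : ℂ)) • expFun ℓ := by
      ext x
      simp only [u, hP, Finsupp.sum, Finset.sum_apply, Pi.smul_apply, smul_eq_mul, expFun,
        Complex.ofReal_sum, Finset.mul_sum]
      rw [integral_finsetSum]
      · refine Finset.sum_congr rfl fun ℓ _ => ?_
        rw [mul_right_comm, ← integral_const_mul]
        congr 1; ext y
        rw [map_sub, sub_eq_add_neg, Real.exp_add]
        push_cast; ring
      · intro ℓ _
        refine Continuous.integrable_of_hasCompactSupport ?_ hFc.mul_right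
        have := hF.continuous
        fun_prop
    rw [hexp]
    exact Submodule.sum_mem _ fun ℓ _ => Submodule.smul_mem _ _ (Submodule.subset_span ⟨ℓ, rfl⟩)
  · refine LipschitzOnWith.of_dist_le_mul fun x hx y hy => ?_
    rw [dist_eq_norm, hu x hx, hu y hy, ← integral_sub (hFP x) (hFP y)]
    have hP2 : ∫ z in D, |P z| ≤ 2 := by
      calc ∫ z in D, |P z| ≤ ∫ z in D, (|P z - ρ z| + ρ z) :=
            integral_mono hPi (hPρ.add hρi.integrableOn) fun z => by
              have := abs_add_le (P z - ρ z) (ρ z)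
              rwa [sub_add_cancel, abs_of_nonneg (hρ0 z)] at this
        _ = (∫ z in D, |P z - ρ z|) + ∫ z in D, ρ z := integral_add hPρ hρi.integrableOn
        _ ≤ 2 := by linarith
    calc ‖∫ z in D, (F (x - z) * (P z : ℂ) - F (y - z) * (P z : ℂ))‖
        ≤ ∫ z in D, K * dist x y * |P z| := by
          refine norm_integral_le_of_norm_le (hPi.const_mul _) (.of_forall fun z => ?_)
          rw [← sub_mul, norm_mul, Complex.norm_real, Real.norm_eq_abs]
          refine mul_le_mul_of_nonneg_right ?_ (abs_nonneg _)
          have := hF.dist_le_mul (x - z) (y - z)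
          rwa [dist_sub_right, dist_eq_norm] at this
      _ = K * dist x y * ∫ z in D, |P z| := integral_const_mul _ _
      _ ≤ K * dist x y * 2 := mul_le_mul_of_nonneg_left hP2 (by positivity)
      _ = ((K * 2 : ℝ≥0) : ℝ) * dist x y := by push_cast; ring
  · intro x hx
    have hρx : ∫ y in D, F x * (ρ y : ℂ) = F x := by
      rw [integral_const_mul, integral_complex_ofReal,
        setIntegral_eq_integral_of_forall_compl_eq_zero, hρ1, Complex.ofReal_one, mul_one]
      intro y hy
      by_contra h
      refine hy ?_
      have h1 := hρs y h
      rw [mem_closedBall_zero_iff]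
      linarith [min_le_left (1 : ℝ) (ε / (2 * (K + 1)))]
    have hFρ : IntegrableOn (fun y => F x * (ρ y : ℂ)) D :=
      ContinuousOn.integrableOn_compact hD (by fun_prop)
    have hKr : K * r ≤ ε / 2 := by
      calc K * r ≤ K * (ε / (2 * (K + 1))) :=
            mul_le_mul_of_nonneg_left (min_le_right _ _) K.2
        _ = ε / 2 * (K / (K + 1)) := by field_simp
        _ ≤ ε / 2 := by
          refine mul_le_of_le_one_right (by positivity) ?_
          rw [div_le_one (by positivity)]; linarith
    have hMV : M * (η * V) ≤ ε / 2 := by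
      calc M * (η * V) = η * (M * V) := by ring
        _ ≤ ε / (2 * (M * V + 1)) * (M * V) :=
            mul_le_mul_of_nonneg_right (min_le_right _ _) (by positivity)
        _ = ε / 2 * (M * V / (M * V + 1)) := by field_simp
        _ ≤ ε / 2 := by
          refine mul_le_of_le_one_right (by positivity) ?_
          rw [div_le_one (by positivity)]; linarith
    rw [hfF hx, hu x hx]
    nth_rewrite 1 [← hρx]
    rw [← integral_sub (hFP x) hFρ]
    calc ‖∫ y in D, (F (x - y) * (P y : ℂ) - F x * (ρ y : ℂ))‖
        ≤ ∫ y in D, (M * |P y - ρ y| + K * r * ρ y) := by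
          refine norm_integral_le_of_norm_le
            ((hPρ.const_mul _).add (hρi.integrableOn.const_mul _)) (.of_forall fun y => ?_)
          have h1 : F (x - y) * (P y : ℂ) - F x * (ρ y : ℂ) =
              F (x - y) * ((P y - ρ y : ℝ) : ℂ) + (F (x - y) - F x) * (ρ y : ℂ) := by
            push_cast; ring
          rw [h1]
          refine (norm_add_le _ _).trans (add_le_add ?_ ?_)
          · rw [norm_mul, Complex.norm_real, Real.norm_eq_abs]
            exact mul_le_mul_of_nonneg_right (hM _) (abs_nonneg _)
          · rw [norm_mul, Complex.norm_real, Real.norm_eq_abs, abs_of_nonneg (hρ0 y)]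
            by_cases hy : ρ y = 0
            · simp [hy]
            · refine mul_le_mul_of_nonneg_right ?_ (hρ0 y)
              have h2 := hF.dist_le_mul (x - y) x
              rw [dist_eq_norm, dist_eq_norm, sub_sub_cancel_left, norm_neg] at h2
              exact h2.trans (mul_le_mul_of_nonneg_left (hρs y hy).le K.2)
      _ = M * (∫ y in D, |P y - ρ y|) + K * r * ∫ y in D, ρ y := by
          rw [integral_add (hPρ.const_mul _) (hρi.integrableOn.const_mul _),
            integral_const_mul, integral_const_mul]
      _ ≤ M * (η * V) + K * r * 1 :=
          add_le_add (mul_le_mul_of_nonneg_left hPρη hM0)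
            (mul_le_mul_of_nonneg_left hρD (by positivity))
      _ ≤ ε := by linarith

end Filling

namespace Filling

open MeasureTheory Set Filter Topology

/-! ### The divergence theorem on the simplex -/

variable {N : ℕ}

/-- Insertion of the `i`-th coordinate. -/
noncomputable def insCoord (i : Fin (N + 1)) (s : ℝ) (y : EuclideanSpace ℝ (Fin N)) :
    EuclideanSpace ℝ (Fin (N + 1)) :=
  WithLp.toLp 2 (i.insertNth s y.ofLp)

theorem continuous_insCoord (i : Fin (N + 1)) :
    Continuous fun p : ℝ × EuclideanSpace ℝ (Fin N) => insCoord i p.1 p.2 := by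
  refine (PiLp.continuous_toLp 2 _).comp (continuous_pi fun j => ?_)
  refine Fin.succAboveCases i ?_ (fun j => ?_) j
  · simpa using continuous_fst
  · simp only [Fin.insertNth_apply_succAbove]
    fun_prop

/-- The simplex is the region between the facet `x_i = 0` and the slanted facet, in the form needed
for Fubini. -/
theorem insCoord_mem_simplex_iff (i : Fin (N + 1)) (s : ℝ) (y : EuclideanSpace ℝ (Fin N)) :
    insCoord i s y ∈ simplex (N + 1) ↔ y ∈ simplex N ∧ s ∈ Icc 0 (1 - ∑ j, y j) := by
  simp only [simplex, insCoord, mem_ofPred_eq, mem_Icc]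
  rw [Fin.forall_iff_succAbove i, Fin.sum_univ_succAbove _ i]
  simp only [Fin.insertNth_apply_same, Fin.insertNth_apply_succAbove]
  constructor
  · rintro ⟨⟨hs, hy⟩, h⟩
    exact ⟨⟨hy, by linarith⟩, hs, by linarith⟩
  · rintro ⟨⟨hy, _⟩, hs, h⟩
    exact ⟨⟨hs, hy⟩, by linarith⟩

theorem faceFun_succ (i : Fin (N + 1)) (y : EuclideanSpace ℝ (Fin N)) :
    faceFun i.succ y = insCoord i 0 y := by
  ext j
  simp only [faceFun, insCoord]
  refine Fin.succAboveCases i ?_ (fun k => ?_) j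
  · simp
  · rw [← Fin.succ_succAbove_succ]
    simp [bary]

theorem faceFun_zero (y : EuclideanSpace ℝ (Fin N)) :
    faceFun 0 y = insCoord 0 (1 - ∑ j, y j) y := by
  ext j
  simp only [faceFun, insCoord]
  rw [← Fin.succAbove_zero_apply, Fin.insertNth_apply_succAbove, Fin.insertNth_zero]
  rfl

theorem setIntegral_simplex_succ (i : Fin (N + 1)) {G : EuclideanSpace ℝ (Fin (N + 1)) → ℝ}
    (hG : Continuous G) :
    ∫ x in simplex (N + 1), G x =
      ∫ y in simplex N, ∫ s in (0 : ℝ)..(1 - ∑ j, y j), G (insCoord i s y) := by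
  let T : EuclideanSpace ℝ (Fin (N + 1)) ≃ᵐ ℝ × EuclideanSpace ℝ (Fin N) :=
    ((MeasurableEquiv.toLp 2 (Fin (N + 1) → ℝ)).symm.trans
      (MeasurableEquiv.piFinSuccAbove (fun _ => ℝ) i)).trans
      ((MeasurableEquiv.refl ℝ).prodCongr (MeasurableEquiv.toLp 2 (Fin N → ℝ)))
  have hT : MeasurePreserving T :=
    ((volume_preserving_piFinSuccAbove (fun _ => ℝ) i).comp
      (EuclideanSpace.volume_preserving_symm_measurableEquiv_toLp _)).trans
      ((MeasurePreserving.id volume).prod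
        (EuclideanSpace.volume_preserving_symm_measurableEquiv_toLp (Fin N)).symm)
  have hTs : ∀ p, T.symm p = insCoord i p.1 p.2 := fun p => rfl
  have h1 : ∫ x in simplex (N + 1), G x =
      ∫ p : ℝ × EuclideanSpace ℝ (Fin N),
        (simplex (N + 1)).indicator G (insCoord i p.1 p.2) := by
    rw [← integral_indicator (measurableSet_simplex _),
      ← hT.symm.integral_comp T.symm.measurableEmbedding]
    simp only [hTs]
  have hint : Integrable fun p : ℝ × EuclideanSpace ℝ (Fin N) =>
      (simplex (N + 1)).indicator G (insCoord i p.1 p.2) := by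
    have := (hT.symm.integrable_comp_emb T.symm.measurableEmbedding).2
      ((hG.continuousOn.integrableOn_compact (isCompact_simplex (N + 1))).integrable_indicator
        (measurableSet_simplex _))
    exact this
  rw [h1, Measure.volume_eq_prod, integral_prod_symm _ hint,
    ← integral_indicator (measurableSet_simplex N)]
  congr 1
  ext y
  by_cases hy : y ∈ simplex N
  · rw [indicator_of_mem hy, intervalIntegral.integral_of_le (by linarith [hy.2]),
      ← integral_Icc_eq_integral_Ioc, ← integral_indicator measurableSet_Icc]
    congr 1
    ext s
    by_cases hs : s ∈ Icc 0 (1 - ∑ j, y j)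
    · rw [indicator_of_mem ((insCoord_mem_simplex_iff i s y).2 ⟨hy, hs⟩), indicator_of_mem hs]
    · rw [indicator_of_notMem fun h => hs ((insCoord_mem_simplex_iff i s y).1 h).2,
        indicator_of_notMem hs]
  · rw [indicator_of_notMem hy]
    refine integral_eq_zero_of_ae (.of_forall fun s => ?_)
    exact indicator_of_notMem (fun h => hy ((insCoord_mem_simplex_iff i s y).1 h).1) _

/-- The linear part of the affine symmetry of the simplex which exchanges the vertices `0` and
`e_i`. -/
noncomputable def reflectLin (i : Fin N) :
    EuclideanSpace ℝ (Fin N) →ₗ[ℝ] EuclideanSpace ℝ (Fin N) where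
  toFun y := WithLp.toLp 2 (Function.update y.ofLp i (-∑ j, y j))
  map_add' x y := by
    ext k
    rcases eq_or_ne k i with rfl | hk
    · simp [Finset.sum_add_distrib]; ring
    · simp [hk]
  map_smul' c y := by
    ext k
    rcases eq_or_ne k i with rfl | hk
    · simp [Finset.mul_sum]
    · simp [hk]

/-- The affine symmetry of the simplex which exchanges the vertices `0` and `e_i`. -/
noncomputable def reflect (i : Fin N) (y : EuclideanSpace ℝ (Fin N)) : EuclideanSpace ℝ (Fin N) :=
  EuclideanSpace.single i (1 : ℝ) + reflectLin i y

theorem reflect_apply (i k : Fin N) (y : EuclideanSpace ℝ (Fin N)) :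
    reflect i y k = if k = i then 1 - ∑ j, y j else y k := by
  rcases eq_or_ne k i with rfl | hk
  · simp [reflect, reflectLin, sub_eq_add_neg]
  · simp [reflect, reflectLin, hk]

theorem sum_reflect (i : Fin N) (y : EuclideanSpace ℝ (Fin N)) :
    ∑ k, reflect i y k = 1 - y i := by
  simp only [reflect_apply]
  rw [← Finset.add_sum_erase _ _ (Finset.mem_univ i), if_pos rfl,
    ← Finset.add_sum_erase _ (fun k => y k) (Finset.mem_univ i),
    Finset.sum_congr rfl fun k hk => if_neg (Finset.ne_of_mem_erase hk)]
  ring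

theorem reflect_reflect (i : Fin N) (y : EuclideanSpace ℝ (Fin N)) : reflect i (reflect i y) = y := by
  ext k
  rw [reflect_apply, sum_reflect, reflect_apply]
  rcases eq_or_ne k i with rfl | hk
  · simp
  · simp [hk]

theorem reflect_mem {i : Fin N} {y : EuclideanSpace ℝ (Fin N)} (hy : y ∈ simplex N) :
    reflect i y ∈ simplex N := by
  refine ⟨fun k => ?_, ?_⟩
  · rw [reflect_apply]
    split_ifs
    · linarith [hy.2]
    · exact hy.1 k
  · rw [sum_reflect]
    linarith [hy.1 i]

/-- The linear part is an involution, so its determinant is `±1`. -/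
theorem measurePreserving_reflect (i : Fin N) : MeasurePreserving (reflect i) := by
  have hinv : reflectLin i ∘ₗ reflectLin i = LinearMap.id := by
    ext1 y
    have h := reflect_reflect i y
    have h0 := reflect_reflect i 0
    simp only [reflect, map_add, map_zero, add_zero] at h h0
    rw [LinearMap.comp_apply, LinearMap.id_apply]
    rw [← add_assoc, h0, zero_add] at h
    exact h
  have hdet : LinearMap.det (reflectLin i) * LinearMap.det (reflectLin i) = 1 := by
    rw [← LinearMap.det_comp, hinv, LinearMap.det_id]
  have habs : |(LinearMap.det (reflectLin i))⁻¹| = 1 := by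
    rcases mul_self_eq_one_iff.1 hdet with h | h <;> simp [h]
  have hlin : MeasurePreserving (reflectLin i) := by
    refine ⟨(LinearMap.continuous_of_finiteDimensional _).measurable, ?_⟩
    rw [Measure.map_linearMap_addHaar_eq_smul_addHaar _ fun h => by simp [h] at hdet, habs]
    simp
  exact (measurePreserving_add_left volume _).comp hlin

theorem setIntegral_comp_reflect (i : Fin N) (G : EuclideanSpace ℝ (Fin N) → ℝ) :
    ∫ y in simplex N, G (reflect i y) = ∫ y in simplex N, G y := by
  have hemb : MeasurableEmbedding (reflect i) :=
    (MeasurableEquiv.mk ⟨reflect i, reflect i, reflect_reflect i, reflect_reflect i⟩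
      (measurePreserving_reflect i).measurable
      (measurePreserving_reflect i).measurable).measurableEmbedding
  rw [← (measurePreserving_reflect i).setIntegral_preimage_emb hemb G (simplex N)]
  congr 2
  ext y
  exact ⟨fun h => reflect_mem h, fun h => by simpa [reflect_reflect] using reflect_mem (i := i) h⟩

/-- Two ways of viewing the slanted facet as a graph, over neighbouring coordinate hyperplanes,
differ by a symmetry of the base simplex. -/
theorem insCoord_succ_eq (i : Fin N) (y : EuclideanSpace ℝ (Fin N)) :
    insCoord i.succ (1 - ∑ j, y j) y =
      insCoord i.castSucc (1 - ∑ j, reflect i y j) (reflect i y) := by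
  ext k
  rw [sum_reflect, sub_sub_cancel]
  simp only [insCoord]
  refine Fin.succAboveCases i.castSucc ?_ (fun k => ?_) k
  · rw [Fin.insertNth_apply_same, ← Fin.succAbove_succ_self, Fin.insertNth_apply_succAbove]
  · rw [Fin.insertNth_apply_succAbove, reflect_apply]
    rcases eq_or_ne k i with rfl | hk
    · rw [Fin.succAbove_castSucc_self, Fin.insertNth_apply_same, if_pos rfl]
    · rw [if_neg hk]
      have : i.castSucc.succAbove k = i.succ.succAbove k := by
        rcases lt_or_gt_of_ne hk with h | h
        · rw [Fin.succAbove_of_castSucc_lt _ _ (by simpa using h),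
            Fin.succAbove_of_castSucc_lt _ _ (Fin.castSucc_lt_succ_iff.2 h.le)]
        · rw [Fin.succAbove_of_le_castSucc _ _ (by simpa using h.le),
            Fin.succAbove_of_le_castSucc _ _ (Fin.succ_le_castSucc_iff.2 h)]
      rw [this, Fin.insertNth_apply_succAbove]

/-- Moving from one coordinate hyperplane to the next costs only a measure-preserving reflection, so
the integral over the slanted facet does not depend on the choice of `i`. -/
theorem setIntegral_insCoord_eq_faceFun_zero (i : Fin (N + 1))
    (G : EuclideanSpace ℝ (Fin (N + 1)) → ℝ) :
    ∫ y in simplex N, G (insCoord i (1 - ∑ j, y j) y) = ∫ y in simplex N, G (faceFun 0 y) := by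
  induction i using Fin.induction with
  | zero => simp only [faceFun_zero]
  | succ i ih =>
    rw [← ih]
    simp only [insCoord_succ_eq]
    exact setIntegral_comp_reflect i fun y => G (insCoord i.castSucc (1 - ∑ j, y j) y)

/-- The divergence theorem for `exp ∘ ℓ` times the constant field `e_i`: integrate first along
`e_i`, where the fundamental theorem of calculus leaves the slanted facet and the facet `x_i = 0`.
-/
theorem setIntegral_exp_simplex (ℓ : EuclideanSpace ℝ (Fin (N + 1)) →L[ℝ] ℝ) (i : Fin (N + 1)) :
    ℓ (EuclideanSpace.single i (1 : ℝ)) * ∫ x in simplex (N + 1), Real.exp (ℓ x) =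
      (∫ y in simplex N, Real.exp (ℓ (faceFun 0 y))) -
        ∫ y in simplex N, Real.exp (ℓ (faceFun i.succ y)) := by
  rw [← integral_const_mul, setIntegral_simplex_succ i (by fun_prop),
    ← setIntegral_insCoord_eq_faceFun_zero i fun x => Real.exp (ℓ x)]
  have hc : ∀ s : EuclideanSpace ℝ (Fin N) → ℝ, Continuous s →
      IntegrableOn (fun y => Real.exp (ℓ (insCoord i (s y) y))) (simplex N) := fun s hs =>
    ContinuousOn.integrableOn_compact (isCompact_simplex N) (Continuous.continuousOn <|
      Real.continuous_exp.comp (ℓ.continuous.comp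
        ((continuous_insCoord i).comp (hs.prodMk continuous_id))))
  simp only [faceFun_succ]
  rw [← integral_sub (hc _ (by fun_prop)) (hc _ (by fun_prop))]
  congr 1
  ext y
  have hins : ∀ s, insCoord i s y = s • EuclideanSpace.single i (1 : ℝ) + insCoord i 0 y := by
    intro s
    ext k
    simp only [insCoord, PiLp.add_apply, PiLp.smul_apply]
    refine Fin.succAboveCases i ?_ (fun k => ?_) k
    · simp
    · simp
  refine intervalIntegral.integral_eq_sub_of_hasDerivAt
    (f := fun s => Real.exp (ℓ (insCoord i s y))) (fun s _ => ?_) ?_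
  · have h : (fun s => Real.exp (ℓ (insCoord i s y))) = fun s =>
        Real.exp (s * ℓ (EuclideanSpace.single i (1 : ℝ)) + ℓ (insCoord i 0 y)) := by
      ext s
      rw [hins s, map_add, map_smul, smul_eq_mul]
    rw [h, hins s, map_add, map_smul, smul_eq_mul, mul_comm (ℓ _)]
    have := (((hasDerivAt_id s).mul_const (ℓ (EuclideanSpace.single i (1 : ℝ)))).add_const
      (ℓ (insCoord i 0 y))).exp
    simpa using this
  · refine Continuous.intervalIntegrable ?_ _ _
    refine continuous_const.mul (Real.continuous_exp.comp (ℓ.continuous.comp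
        ((continuous_insCoord i).comp (continuous_id.prodMk continuous_const))))

end Filling

namespace Filling

open MeasureTheory Set Filter Topology

/-! ### Stokes' theorem for Lipschitz functions on the simplex -/

variable {N : ℕ}

/-- The difference of the two sides of Stokes' theorem for the form `f₀ df₁ ∧ ⋯ ∧ df_N` on the
simplex of dimension `N + 1`. -/
noncomputable def stokesDefect (f : Fin (N + 1) → EuclideanSpace ℝ (Fin (N + 1)) → ℂ) : ℂ :=
  jacIntegral (fun _ => 1) f - ∑ i : Fin (N + 2), (-1) ^ (i : ℕ) *
    jacIntegral (f 0 ∘ faceFun i) fun j => f j.succ ∘ faceFun i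

theorem lipOn_one : LipOn fun _ : EuclideanSpace ℝ (Fin N) => (1 : ℂ) := contDiff_const.lipOn

theorem update_comp_faceFun_zero {f : Fin (N + 1) → EuclideanSpace ℝ (Fin (N + 1)) → ℂ}
    (u : EuclideanSpace ℝ (Fin (N + 1)) → ℂ) (i : Fin (N + 2)) :
    jacIntegral (Function.update f 0 u 0 ∘ faceFun i)
      (fun k => Function.update f 0 u k.succ ∘ faceFun i) =
    jacIntegral (u ∘ faceFun i) fun k => f k.succ ∘ faceFun i := by
  simp

theorem update_comp_faceFun_succ {f : Fin (N + 1) → EuclideanSpace ℝ (Fin (N + 1)) → ℂ}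
    (j : Fin N) (u : EuclideanSpace ℝ (Fin (N + 1)) → ℂ) (i : Fin (N + 2)) :
    jacIntegral (Function.update f j.succ u 0 ∘ faceFun i)
      (fun k => Function.update f j.succ u k.succ ∘ faceFun i) =
    jacIntegral (f 0 ∘ faceFun i)
      (Function.update (fun k => f k.succ ∘ faceFun i) j (u ∘ faceFun i)) := by
  rw [Function.update_of_ne (Fin.succ_ne_zero j).symm]
  congr 1
  ext k x
  rcases eq_or_ne k j with rfl | hk
  · simp
  · simp [hk]

variable {f : Fin (N + 1) → EuclideanSpace ℝ (Fin (N + 1)) → ℂ}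

theorem stokesDefect_update_add (hf : ∀ j, LipOn (f j)) (j : Fin (N + 1))
    {u v : EuclideanSpace ℝ (Fin (N + 1)) → ℂ} (hu : LipOn u) (hv : LipOn v) :
    stokesDefect (Function.update f j (u + v)) =
      stokesDefect (Function.update f j u) + stokesDefect (Function.update f j v) := by
  have hb : ∀ i : Fin (N + 2), jacIntegral (Function.update f j (u + v) 0 ∘ faceFun i)
        (fun k => Function.update f j (u + v) k.succ ∘ faceFun i) =
      jacIntegral (Function.update f j u 0 ∘ faceFun i)
        (fun k => Function.update f j u k.succ ∘ faceFun i) +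
      jacIntegral (Function.update f j v 0 ∘ faceFun i)
        (fun k => Function.update f j v k.succ ∘ faceFun i) := by
    intro i
    refine Fin.cases ?_ (fun j => ?_) j
    · simp only [update_comp_faceFun_zero]
      exact jacIntegral_add_left (fun k => (hf k.succ).comp_faceFun i) (hu.comp_faceFun i)
        (hv.comp_faceFun i)
    · simp only [update_comp_faceFun_succ]
      exact jacIntegral_update_add ((hf 0).comp_faceFun i) (fun k => (hf k.succ).comp_faceFun i) j
        (hu.comp_faceFun i) (hv.comp_faceFun i)
  simp only [stokesDefect, jacIntegral_update_add lipOn_one hf j hu hv, hb, mul_add,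
    Finset.sum_add_distrib]
  ring

theorem stokesDefect_update_smul (j : Fin (N + 1)) (c : ℂ)
    {u : EuclideanSpace ℝ (Fin (N + 1)) → ℂ} (hu : LipOn u) :
    stokesDefect (Function.update f j (c • u)) = c * stokesDefect (Function.update f j u) := by
  have hb : ∀ i : Fin (N + 2), jacIntegral (Function.update f j (c • u) 0 ∘ faceFun i)
        (fun k => Function.update f j (c • u) k.succ ∘ faceFun i) =
      c * jacIntegral (Function.update f j u 0 ∘ faceFun i)
        (fun k => Function.update f j u k.succ ∘ faceFun i) := by
    intro i
    refine Fin.cases ?_ (fun j => ?_) j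
    · simp only [update_comp_faceFun_zero]
      exact jacIntegral_smul_left c _
    · simp only [update_comp_faceFun_succ]
      exact jacIntegral_update_smul j c (hu.comp_faceFun i)
  simp only [stokesDefect, jacIntegral_update_smul j c hu, hb, mul_sub, Finset.mul_sum]
  congr 1
  exact Finset.sum_congr rfl fun i _ => by ring

/-- On the faces, slot `0` enters undifferentiated and the other slots differentiated, so both
continuity statements for `jacIntegral` are needed. -/
theorem exists_forall_norm_stokesDefect_update_le (hf : ∀ j, LipOn (f j)) (j : Fin (N + 1))
    (L : ℝ≥0) {δ : ℝ} (hδ : 0 < δ) :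
    ∃ ε > 0, ∀ w : EuclideanSpace ℝ (Fin (N + 1)) → ℂ, LipschitzOnWith L w (simplex (N + 1)) →
      (∀ x ∈ simplex (N + 1), ‖w x‖ ≤ ε) → ‖stokesDefect (Function.update f j w)‖ ≤ δ := by
  -- One interior term and `N + 2` faces.
  have hη : 0 < δ / (N + 3) := by positivity
  have hb : ∀ i : Fin (N + 2), ∃ ε > 0, ∀ w : EuclideanSpace ℝ (Fin (N + 1)) → ℂ,
      LipschitzOnWith L w (simplex (N + 1)) → (∀ x ∈ simplex (N + 1), ‖w x‖ ≤ ε) →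
      ‖jacIntegral (Function.update f j w 0 ∘ faceFun i)
        (fun k => Function.update f j w k.succ ∘ faceFun i)‖ ≤ δ / (N + 3) := by
    intro i
    refine Fin.cases ?_ (fun j => ?_) j
    · obtain ⟨ε, hε, h⟩ := exists_forall_norm_jacIntegral_left_le
        (fun k => (hf k.succ).comp_faceFun i) hη
      refine ⟨ε, hε, fun w hw hwε => ?_⟩
      rw [update_comp_faceFun_zero]
      exact h _ (LipOn.comp_faceFun ⟨L, hw⟩ i) fun x hx => hwε _ (faceFun_mem i hx)
    · obtain ⟨L', hL'⟩ := faceFun_lipschitz (m := N) i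
      obtain ⟨ε, hε, h⟩ := exists_forall_norm_jacIntegral_update_le ((hf 0).comp_faceFun i)
        (fun k => (hf k.succ).comp_faceFun i) j (L * L') hη
      refine ⟨ε, hε, fun w hw hwε => ?_⟩
      rw [update_comp_faceFun_succ]
      exact h _ (hw.comp hL'.lipschitzOnWith fun x hx => faceFun_mem i hx)
        fun x hx => hwε _ (faceFun_mem i hx)
  choose ε hε h using hb
  obtain ⟨ε₀, hε₀, h₀⟩ := exists_forall_norm_jacIntegral_update_le lipOn_one hf j L hη
  refine ⟨min ε₀ (Finset.univ.inf' Finset.univ_nonempty ε), lt_min hε₀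
    ((Finset.lt_inf'_iff _).2 fun i _ => hε i), fun w hw hwε => ?_⟩
  refine (norm_sub_le _ _).trans ?_
  refine (add_le_add (h₀ w hw fun x hx => (hwε x hx).trans (min_le_left _ _))
    ((norm_sum_le _ _).trans (Finset.sum_le_sum fun i _ => ?_))).trans
    (b := δ / (N + 3) + ∑ i : Fin (N + 2), δ / (N + 3)) ?_
  · rw [norm_mul, norm_pow, norm_neg, norm_one, one_pow, one_mul]
    exact h i w hw fun x hx =>
      (hwε x hx).trans ((min_le_right _ _).trans (Finset.inf'_le _ (Finset.mem_univ i)))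
  · simp only [Finset.sum_const, Finset.card_univ, Fintype.card_fin, nsmul_eq_mul]
    push_cast
    refine le_of_eq ?_
    field_simp
    ring

/-- Border `M` by a column of ones and expand along it, before and after subtracting row `0` from
the other rows. The differences `M k.succ - M 0` arise from the slanted face, whose linear part
sends `e_k` to `e_(k+1) - e_0`. -/
theorem det_cons_one {R : Type*} [CommRing R] (M : Matrix (Fin (N + 1)) (Fin N) R) :
    (Matrix.of fun k j => M k.succ j - M 0 j).det =
      ∑ i : Fin (N + 1), (-1) ^ (i : ℕ) * (M.submatrix i.succAbove id).det := by
  let A : Matrix (Fin (N + 1)) (Fin (N + 1)) R := Matrix.of fun i => Fin.cons 1 (M i)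
  let B : Matrix (Fin (N + 1)) (Fin (N + 1)) R := Matrix.of fun i =>
    Fin.cases (Fin.cons 1 (M 0)) (fun k => Fin.cons 0 (M k.succ - M 0)) i
  have hAB : A.det = B.det := by
    refine Matrix.det_eq_of_forall_row_eq_smul_add_const (Fin.cons 0 fun _ => 1) 0 rfl ?_
    intro i j
    refine Fin.cases ?_ (fun k => ?_) i <;> refine Fin.cases ?_ (fun l => ?_) j <;> simp [A, B]
  have hA : A.det = ∑ i : Fin (N + 1), (-1) ^ (i : ℕ) * (M.submatrix i.succAbove id).det := by
    rw [Matrix.det_succ_column_zero]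
    refine Finset.sum_congr rfl fun i _ => ?_
    have : A.submatrix i.succAbove Fin.succ = M.submatrix i.succAbove id := by ext; simp [A]
    rw [this]
    simp [A]
  have hB : B.det = (Matrix.of fun k j => M k.succ j - M 0 j).det := by
    rw [Matrix.det_succ_column_zero, Finset.sum_eq_single 0]
    · have : B.submatrix (Fin.succAbove 0) Fin.succ =
          Matrix.of fun k j => M k.succ j - M 0 j := by ext; simp [B]
      rw [this]
      simp [B]
    · intro i _ hi
      obtain ⟨k, rfl⟩ := Fin.exists_succ_eq.2 hi
      simp [B]
    · simp
  rw [← hB, ← hAB, hA]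

theorem fderiv_expFun (ℓ : EuclideanSpace ℝ (Fin N) →L[ℝ] ℝ) (x v : EuclideanSpace ℝ (Fin N)) :
    fderiv ℝ (expFun ℓ) x v = expFun ℓ x * (ℓ v : ℂ) := by
  have h := Complex.ofRealCLM.hasFDerivAt.comp x (ℓ.hasFDerivAt (x := x)).exp
  have := congrArg (fun T => T v) h.fderiv
  refine this.trans ?_
  simp [expFun]

/-- The linear parts of the face maps. -/
theorem exists_faceFun_eq (i : Fin (N + 2)) :
    ∃ A : EuclideanSpace ℝ (Fin N) →L[ℝ] EuclideanSpace ℝ (Fin (N + 1)),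
      (∀ x, faceFun i x = A x + faceFun i 0) ∧
      ∀ k, A (EuclideanSpace.single k (1 : ℝ)) = Fin.cases
        (EuclideanSpace.single k.succ (1 : ℝ) - EuclideanSpace.single 0 (1 : ℝ))
        (fun i => EuclideanSpace.single (i.succAbove k) (1 : ℝ)) i := by
  have hadd : ∀ (a b : Fin N → ℝ) (i : Fin (N + 1)) (s t : ℝ),
      (i.insertNth (s + t) (a + b) : Fin (N + 1) → ℝ) = i.insertNth s a + i.insertNth t b := by
    intro a b i s t
    ext j
    refine Fin.succAboveCases i ?_ (fun k => ?_) j <;> simp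
  have hsmul : ∀ (c : ℝ) (a : Fin N → ℝ) (i : Fin (N + 1)) (s : ℝ),
      (i.insertNth (c * s) (c • a) : Fin (N + 1) → ℝ) = c • i.insertNth s a := by
    intro c a i s
    ext j
    refine Fin.succAboveCases i ?_ (fun k => ?_) j <;> simp
  refine Fin.cases ?_ (fun i => ?_) i
  · let A : EuclideanSpace ℝ (Fin N) →ₗ[ℝ] EuclideanSpace ℝ (Fin (N + 1)) :=
      { toFun := fun y => insCoord 0 (-∑ j, y j) y
        map_add' := fun x y => by
          ext j
          simp [insCoord, Finset.sum_add_distrib, add_comm]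
        map_smul' := fun c y => by
          ext j
          have := congrFun (hsmul c y.ofLp 0 (-∑ j, y j)) j
          simpa [insCoord, Finset.mul_sum] using this }
    refine ⟨LinearMap.toContinuousLinearMap A, fun x => ?_, fun k => ?_⟩
    · ext j
      simp only [faceFun_zero, A, LinearMap.coe_toContinuousLinearMap', LinearMap.coe_mk,
        AddHom.coe_mk, insCoord, PiLp.add_apply]
      refine Fin.cases ?_ (fun j => ?_) j
      · simp; ring
      · simp
    · ext j
      simp only [A, LinearMap.coe_toContinuousLinearMap', LinearMap.coe_mk,
        AddHom.coe_mk, insCoord, Fin.cases_zero, PiLp.sub_apply]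
      refine Fin.cases ?_ (fun j => ?_) j
      · simp
      · simp [Pi.single_apply]
  · let A : EuclideanSpace ℝ (Fin N) →ₗ[ℝ] EuclideanSpace ℝ (Fin (N + 1)) :=
      { toFun := fun y => insCoord i 0 y
        map_add' := fun x y => by
          ext j
          have := congrFun (hadd x.ofLp y.ofLp i 0 0) j
          simpa [insCoord] using this
        map_smul' := fun c y => by
          ext j
          have := congrFun (hsmul c y.ofLp i 0) j
          simpa [insCoord] using this }
    refine ⟨LinearMap.toContinuousLinearMap A, fun x => ?_, fun k => ?_⟩
    · have : faceFun i.succ 0 = A 0 := faceFun_succ i 0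
      rw [this, map_zero, add_zero]
      exact faceFun_succ i x
    · ext j
      simp only [A, LinearMap.coe_toContinuousLinearMap', LinearMap.coe_mk,
        AddHom.coe_mk, insCoord, Fin.cases_succ]
      refine Fin.succAboveCases i ?_ (fun j => ?_) j
      · simp [(Fin.succAbove_ne i k).symm]
      · simp [Pi.single_apply]

theorem prod_expFun {ι : Type*} [Fintype ι] (ℓ : ι → EuclideanSpace ℝ (Fin N) →L[ℝ] ℝ)
    (x : EuclideanSpace ℝ (Fin N)) : ∏ j, expFun (ℓ j) x = expFun (∑ j, ℓ j) x := by
  simp only [expFun]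
  rw [← Complex.ofReal_prod, ← Real.exp_sum, sum_apply]

/-- All integrands are constants times `exp Λ` with `Λ = ∑ ℓ_j`. Expanding every determinant in the
same minors of `M`, the coefficient of each minor vanishes by the divergence theorem in one
coordinate direction. -/
theorem stokesDefect_expFun (ℓ : Fin (N + 1) → EuclideanSpace ℝ (Fin (N + 1)) →L[ℝ] ℝ) :
    stokesDefect (fun j => expFun (ℓ j)) = 0 := by
  set Λ := ∑ j, ℓ j
  let A : Matrix (Fin (N + 1)) (Fin (N + 1)) ℂ :=
    Matrix.of fun i j => (ℓ j (EuclideanSpace.single i (1 : ℝ)) : ℂ)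
  let M : Matrix (Fin (N + 1)) (Fin N) ℂ := A.submatrix id Fin.succ
  let X : Fin (N + 2) → ℝ := fun i => ∫ y in simplex N, Real.exp (Λ (faceFun i y))
  have hX : ∀ i, (X i : ℂ) = ∫ y in simplex N, expFun Λ (faceFun i y) := fun i =>
    (integral_complex_ofReal (f := fun y => Real.exp (Λ (faceFun i y)))).symm
  have hint : jacIntegral (fun _ => 1) (fun j => expFun (ℓ j)) =
      (∫ x in simplex (N + 1), Real.exp (Λ x) : ℝ) * A.det := by
    rw [← integral_complex_ofReal, ← integral_mul_const, jacIntegral]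
    congr 1
    ext x
    have : jacMatrix (fun j => expFun (ℓ j)) x = Matrix.of fun i j => expFun (ℓ j) x * A i j := by
      ext i j
      simp only [jacMatrix, Matrix.of_apply, fderiv_expFun, A]
    rw [this, Matrix.det_mul_row, prod_expFun, one_mul]
    rfl
  -- Adding all other columns to column `0` replaces its entries by `Λ e_i` without changing the
  -- determinant.
  have hA : A.det = ∑ i : Fin (N + 1), (-1) ^ (i : ℕ) *
      (Λ (EuclideanSpace.single i (1 : ℝ)) : ℂ) * (M.submatrix i.succAbove id).det := by
    have h := Matrix.det_updateCol_sum A 0 fun _ => 1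
    rw [one_smul] at h
    rw [← h, Matrix.det_succ_column_zero]
    refine Finset.sum_congr rfl fun i _ => ?_
    have h1 : (A.updateCol 0 fun k => ∑ j, (1 : ℂ) • A k j).submatrix i.succAbove Fin.succ =
        M.submatrix i.succAbove id := by
      ext k l
      simp [M]
    have h2 : (A.updateCol 0 fun k => ∑ j, (1 : ℂ) • A k j) i 0 =
        (Λ (EuclideanSpace.single i (1 : ℝ)) : ℂ) := by
      simp [A, Λ]
    rw [h1, h2]
  have hface : ∀ (i : Fin (N + 2)) (B : Matrix (Fin N) (Fin N) ℂ),
      (∀ T : EuclideanSpace ℝ (Fin N) →L[ℝ] EuclideanSpace ℝ (Fin (N + 1)),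
        (∀ k, T (EuclideanSpace.single k (1 : ℝ)) = Fin.cases
        (EuclideanSpace.single k.succ (1 : ℝ) - EuclideanSpace.single 0 (1 : ℝ))
        (fun i => EuclideanSpace.single (i.succAbove k) (1 : ℝ)) i) →
        ∀ k j, (ℓ j.succ (T (EuclideanSpace.single k (1 : ℝ))) : ℂ) = B k j) →
      jacIntegral (expFun (ℓ 0) ∘ faceFun i) (fun j => expFun (ℓ j.succ) ∘ faceFun i) =
        X i * B.det := by
    intro i B hB
    obtain ⟨T, hT, hTe⟩ := exists_faceFun_eq (N := N) i
    have hd : ∀ x, HasFDerivAt (faceFun i) T x := fun x => by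
      rw [show faceFun i = fun x => T x + faceFun i 0 from funext hT]
      exact T.hasFDerivAt.add_const _
    rw [hX, ← integral_mul_const, jacIntegral]
    congr 1
    ext x
    have : jacMatrix (fun j => expFun (ℓ j.succ) ∘ faceFun i) x =
        Matrix.of fun k j => expFun (ℓ j.succ) (faceFun i x) * B k j := by
      ext k j
      have hdiff : DifferentiableAt ℝ (expFun (ℓ j.succ)) (faceFun i x) :=
        (contDiff_expFun _).differentiable one_ne_zero _
      simp only [jacMatrix, Matrix.of_apply]
      rw [(hdiff.hasFDerivAt.comp x (hd x)).fderiv, ContinuousLinearMap.comp_apply, fderiv_expFun,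
        hB T hTe]
    rw [this, Matrix.det_mul_row, ← mul_assoc, Function.comp_apply,
      ← Fin.prod_univ_succ fun j => expFun (ℓ j) (faceFun i x), prod_expFun]
  have hface0 : jacIntegral (expFun (ℓ 0) ∘ faceFun 0) (fun j => expFun (ℓ j.succ) ∘ faceFun 0) =
      X 0 * ∑ i : Fin (N + 1), (-1) ^ (i : ℕ) * (M.submatrix i.succAbove id).det := by
    rw [← det_cons_one]
    refine hface 0 _ fun T hT k j => ?_
    rw [hT]
    simp [M, A]
  have hfaces : ∀ i : Fin (N + 1), jacIntegral (expFun (ℓ 0) ∘ faceFun i.succ)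
      (fun j => expFun (ℓ j.succ) ∘ faceFun i.succ) =
      X i.succ * (M.submatrix i.succAbove id).det := by
    intro i
    refine hface i.succ _ fun T hT k j => ?_
    rw [hT]
    simp [M, A]
  have hdiv : ∀ i : Fin (N + 1), (Λ (EuclideanSpace.single i (1 : ℝ)) : ℂ) *
      (∫ x in simplex (N + 1), Real.exp (Λ x) : ℝ) = X 0 - X i.succ := by
    intro i
    have := setIntegral_exp_simplex Λ i
    exact_mod_cast this
  rw [stokesDefect, Fin.sum_univ_succ (n := N + 1), hint, hA, hface0, Finset.mul_sum, Finset.mul_sum,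
    Finset.mul_sum, ← Finset.sum_add_distrib, ← Finset.sum_sub_distrib]
  refine Finset.sum_eq_zero fun i _ => ?_
  rw [hfaces, Fin.val_succ, Fin.val_zero, pow_zero, pow_succ]
  linear_combination (-1) ^ (i : ℕ) * (M.submatrix i.succAbove id).det * hdiv i

/-- By linearity in slot `j` the defect vanishes on the span of the exponentials, so `f j` may be
replaced by `f j - u` with `u` in the span. This difference is uniformly small with a fixed
Lipschitz constant, and continuity applies. -/
theorem stokesDefect_eq_zero_of_expSpan (hf : ∀ j, LipOn (f j)) (j : Fin (N + 1))
    (h : ∀ ℓ, stokesDefect (Function.update f j (expFun ℓ)) = 0) : stokesDefect f = 0 := by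
  have hspan : ∀ u ∈ Submodule.span ℂ (range (expFun (N := N + 1))),
      LipOn u ∧ stokesDefect (Function.update f j u) = 0 := by
    intro u hu
    induction hu using Submodule.span_induction with
    | mem u hu =>
      obtain ⟨ℓ, rfl⟩ := hu
      exact ⟨(contDiff_expFun ℓ).lipOn, h ℓ⟩
    | zero =>
      refine ⟨contDiff_const.lipOn, ?_⟩
      have := stokesDefect_update_smul (f := f) j 0 (lipOn_one (N := N + 1))
      rwa [zero_smul, zero_mul] at this
    | add u v _ _ hu hv =>
      refine ⟨hu.1.add hv.1, ?_⟩
      rw [stokesDefect_update_add hf j hu.1 hv.1, hu.2, hv.2, add_zero]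
    | smul c u _ hu =>
      refine ⟨hu.1.const_smul c, ?_⟩
      rw [stokesDefect_update_smul j c hu.1, hu.2, mul_zero]
  obtain ⟨L, hL⟩ := (hf j).exists_expSpan_near
  obtain ⟨K, hK⟩ := hf j
  rw [← norm_le_zero_iff]
  refine le_of_forall_pos_le_add fun δ hδ => ?_
  rw [zero_add]
  obtain ⟨ε, hε, hδε⟩ := exists_forall_norm_stokesDefect_update_le hf j (K + L) hδ
  obtain ⟨u, hu, huL, hun⟩ := hL ε hε
  have key : stokesDefect f = stokesDefect (Function.update f j (f j - u)) := by
    have := stokesDefect_update_add hf j ((hf j).sub (hspan u hu).1) (hspan u hu).1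
    rw [sub_add_cancel, Function.update_eq_self, (hspan u hu).2, add_zero] at this
    exact this
  rw [key]
  refine hδε _ (hK.sub huL) fun x hx => ?_
  rw [Pi.sub_apply, norm_sub_rev]
  exact hun x hx

/-- **Stokes' theorem** for the form `f₀ df₁ ∧ ⋯ ∧ df_N` on the simplex, for Lipschitz
functions `f_j`. -/
theorem jacIntegral_eq_sum_faces (hf : ∀ j, LipOn (f j)) :
    jacIntegral (fun _ => 1) f = ∑ i : Fin (N + 2), (-1) ^ (i : ℕ) *
      jacIntegral (f 0 ∘ faceFun i) fun j => f j.succ ∘ faceFun i := by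
  -- Here `s` is the set of slots that may fail to hold an exponential; the induction replaces them
  -- one at a time.
  suffices H : ∀ (s : Finset (Fin (N + 1)))
      (f : Fin (N + 1) → EuclideanSpace ℝ (Fin (N + 1)) → ℂ), (∀ j, LipOn (f j)) →
      (∀ j ∉ s, f j ∈ range (expFun (N := N + 1))) → stokesDefect f = 0 from
    sub_eq_zero.1 (H Finset.univ f hf fun j hj => absurd (Finset.mem_univ j) hj)
  intro s
  induction s using Finset.induction_on with
  | empty =>
    intro f _ h
    choose ℓ hℓ using fun j => h j (Finset.notMem_empty j)
    rw [← funext hℓ]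
    exact stokesDefect_expFun ℓ
  | insert j s hj ih =>
    intro f hf h
    refine stokesDefect_eq_zero_of_expSpan hf j fun ℓ => ih _
      (lipOn_update hf j (contDiff_expFun ℓ).lipOn) fun k hk => ?_
    rcases eq_or_ne k j with rfl | hkj
    · simp
    · simpa [hkj] using h k (by simp [hkj, hk])

end Filling

namespace Filling

open MeasureTheory Set Filter Topology

/-! ### Determinants of linear forms and Gram determinants -/

section Gram

open scoped MatrixOrder in
theorem _root_.Matrix.PosSemidef.exists_eq_transpose_mul_self {ι : Type*} [Fintype ι]
    [DecidableEq ι] {P : Matrix ι ι ℝ} (hP : P.PosSemidef) :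
    ∃ S : Matrix ι ι ℝ, P = S.transpose * S := by
  obtain ⟨S, hS⟩ := CStarAlgebra.nonneg_iff_eq_star_mul_self.mp hP.nonneg
  exact ⟨S, by rwa [Matrix.star_eq_conjTranspose,
    Matrix.conjTranspose_eq_transpose_of_trivial] at hS⟩

variable {V : Type*} [NormedAddCommGroup V] [NormedSpace ℝ V]
  {B : V →L[ℝ] V →L[ℝ] ℝ}

theorem exists_forall_mul_norm_sq_le [FiniteDimensional ℝ V] (hpos : ∀ v, v ≠ 0 → 0 < B v v) :
    ∃ c > 0, ∀ v, c * ‖v‖ ^ 2 ≤ B v v := by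
  rcases subsingleton_or_nontrivial V with hV | hV
  · exact ⟨1, one_pos, fun v => by simp [Subsingleton.elim v 0]⟩
  have hcont : Continuous fun v : V => B v v := by fun_prop
  obtain ⟨v₀, hv₀, hmin⟩ := (isCompact_sphere (0 : V) 1).exists_isMinOn
    (NormedSpace.sphere_nonempty.2 zero_le_one) hcont.continuousOn
  have hv₀' : v₀ ≠ 0 := by
    rintro rfl
    simp at hv₀
  refine ⟨B v₀ v₀, hpos _ hv₀', fun v => ?_⟩
  rcases eq_or_ne v 0 with rfl | hv
  · simp
  have hn : 0 < ‖v‖ := norm_pos_iff.2 hv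
  have h := hmin (show ‖v‖⁻¹ • v ∈ Metric.sphere (0 : V) 1 by
    rw [mem_sphere_zero_iff_norm, norm_smul, norm_inv, norm_norm, inv_mul_cancel₀ hn.ne'])
  simp only [mem_ofPred_eq, map_smul, _root_.smul_apply, smul_eq_mul] at h
  calc B v₀ v₀ * ‖v‖ ^ 2 ≤ (‖v‖⁻¹ * (‖v‖⁻¹ * B v v)) * ‖v‖ ^ 2 :=
        mul_le_mul_of_nonneg_right h (by positivity)
    _ = B v v := by field_simp

theorem posSemidef_gram (hsymm : ∀ v w, B v w = B w v) (hpos : ∀ v, v ≠ 0 → 0 < B v v)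
    {ι : Type*} [Fintype ι] [DecidableEq ι] (u : ι → V) :
    (Matrix.of fun i j => B (u i) (u j)).PosSemidef := by
  refine Matrix.PosSemidef.of_dotProduct_mulVec_nonneg ?_ fun x => ?_
  · ext i j
    simp [hsymm (u j) (u i)]
  · have h : star x ⬝ᵥ (Matrix.of fun i j => B (u i) (u j)).mulVec x =
        B (∑ i, x i • u i) (∑ i, x i • u i) := by
      simp only [dotProduct, Matrix.mulVec, Matrix.of_apply, map_sum, sum_apply, map_smul,
        _root_.smul_apply, smul_eq_mul, Finset.mul_sum, star_trivial]
      rw [Finset.sum_comm]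
      exact Finset.sum_congr rfl fun i _ => Finset.sum_congr rfl fun j _ => by ring
    rw [h]
    rcases eq_or_ne (∑ i, x i • u i) 0 with h0 | h0
    · simp [h0]
    · exact (hpos _ h0).le

/-- The determinant of linear forms on `N` vectors is bounded by the volume that these vectors
span. -/
theorem exists_forall_norm_det_le [FiniteDimensional ℝ V] (hsymm : ∀ v w, B v w = B w v)
    (hpos : ∀ v, v ≠ 0 → 0 < B v v) {N : ℕ} (ℓ : Fin N → V →L[ℝ] ℂ) :
    ∃ C > 0, ∀ u : Fin N → V, ‖(Matrix.of fun i j => ℓ j (u i)).det‖ ≤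
      C * Real.sqrt (Matrix.of fun i j => B (u i) (u j)).det := by
  obtain ⟨c, hc, hcB⟩ := exists_forall_mul_norm_sq_le hpos
  -- A common bound for the forms on vectors of `B`-length one.
  set R : ℝ := (∑ j, ‖ℓ j‖) * (Real.sqrt c)⁻¹
  have hR : ∀ v, B v v = 1 → ∀ j, ‖ℓ j v‖ ≤ R := by
    intro v hv j
    have h1 := hcB v
    rw [hv] at h1
    have h2 : ‖v‖ ≤ (Real.sqrt c)⁻¹ := by
      rw [← Real.sqrt_inv]
      refine Real.le_sqrt_of_sq_le ?_
      rw [inv_eq_one_div, le_div_iff₀ hc]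
      linarith
    refine (ContinuousLinearMap.le_opNorm _ _).trans (mul_le_mul
      (Finset.single_le_sum (f := fun j => ‖ℓ j‖) (fun _ _ => norm_nonneg _) (Finset.mem_univ j)) h2
      (norm_nonneg _) (Finset.sum_nonneg fun _ _ => norm_nonneg _))
  have hR0 : 0 ≤ R := by positivity
  -- `N! * R ^ N` bounds a determinant with entries at most `R`; adding `1` only secures positivity.
  refine ⟨(Nat.factorial N) • R ^ N + 1, by positivity, fun u => ?_⟩
  set P : Matrix (Fin N) (Fin N) ℝ := Matrix.of fun i j => B (u i) (u j)
  have hP : P.PosSemidef := posSemidef_gram hsymm hpos u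
  -- A degenerate Gram matrix makes the vectors linearly dependent, so the determinant of the forms
  -- vanishes too.
  by_cases hdet : P.det = 0
  · obtain ⟨x, hx, hPx⟩ := Matrix.exists_mulVec_eq_zero_iff.2 hdet
    have hw : ∑ i, x i • u i = 0 := by
      by_contra h0
      refine (hpos _ h0).ne' ?_
      have h : B (∑ i, x i • u i) (∑ i, x i • u i) = x ⬝ᵥ P.mulVec x := by
        simp only [dotProduct, Matrix.mulVec, P, Matrix.of_apply, map_sum, sum_apply, map_smul,
          _root_.smul_apply, smul_eq_mul, Finset.mul_sum]
        rw [Finset.sum_comm]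
        exact Finset.sum_congr rfl fun i _ => Finset.sum_congr rfl fun j _ => by ring
      rw [h, hPx, dotProduct_zero]
    have hM : (Matrix.of fun i j => ℓ j (u i)).det = 0 := by
      refine Matrix.exists_vecMul_eq_zero_iff.1 ⟨fun i => (x i : ℂ), fun h => hx ?_, ?_⟩
      · ext i
        exact Complex.ofReal_eq_zero.1 (congrFun h i)
      · ext j
        have := congrArg (ℓ j) hw
        simpa [Matrix.vecMul, dotProduct, map_sum, map_smul] using this
    rw [hM, norm_zero]
    positivity
  -- Writing `P = Sᵀ S` and changing basis by `S⁻¹` turns the `u i` into `B`-unit vectors `w k`. The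
  -- determinant then splits off `det S`, whose absolute value is the square root of `det P`.
  · obtain ⟨S, hS⟩ := hP.exists_eq_transpose_mul_self
    have hPS : P.det = S.det ^ 2 := by rw [hS, Matrix.det_mul, Matrix.det_transpose, sq]
    have hSdet : IsUnit S.det := isUnit_iff_ne_zero.2 fun h => hdet (by rw [hPS, h]; ring)
    let w : Fin N → V := fun k => ∑ i, S⁻¹ i k • u i
    have huw : ∀ i, u i = ∑ k, S k i • w k := by
      intro i
      simp only [w, Finset.smul_sum, smul_smul]
      rw [Finset.sum_comm]
      have h1 : ∀ j, ∑ k, (S k i * S⁻¹ j k) • u j = (if j = i then (1 : ℝ) else 0) • u j := by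
        intro j
        rw [← Finset.sum_smul, ← Matrix.one_apply, ← Matrix.nonsing_inv_mul S hSdet,
          Matrix.mul_apply]
        simp only [mul_comm]
      simp [h1]
    have hww : ∀ k, B (w k) (w k) = 1 := by
      intro k
      have h1 : B (w k) (w k) = (S⁻¹.transpose * P * S⁻¹) k k := by
        simp only [w, Matrix.mul_apply, P, Matrix.of_apply, map_sum, sum_apply, map_smul,
          _root_.smul_apply, smul_eq_mul, Finset.sum_mul, Finset.mul_sum, Matrix.transpose_apply]
        refine Finset.sum_congr rfl fun i _ => Finset.sum_congr rfl fun j _ => by ring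
      rw [h1, hS, ← Matrix.mul_assoc, ← Matrix.transpose_mul, Matrix.mul_assoc,
        Matrix.mul_nonsing_inv S hSdet, Matrix.transpose_one, Matrix.one_mul, Matrix.one_apply_eq]
    have hfac : (Matrix.of fun i j => ℓ j (u i)) =
        (S.transpose.map (algebraMap ℝ ℂ)) * Matrix.of fun i j => ℓ j (w i) := by
      ext i j
      simp only [Matrix.of_apply, Matrix.mul_apply, Matrix.map_apply, Matrix.transpose_apply]
      rw [huw i, map_sum]
      simp [map_smul]
    have hbound : ‖(Matrix.of fun i j => ℓ j (w i)).det‖ ≤ (Nat.factorial N) • R ^ N := by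
      have := Matrix.det_le (A := Matrix.of fun i j => ℓ j (w i)) (abv := NormedField.toAbsoluteValue ℂ)
        (x := R) fun i j => hR _ (hww i) j
      exact this.trans_eq (by simp)
    have hmap : (S.transpose.map (algebraMap ℝ ℂ)).det = (S.det : ℂ) := by
      have := (RingHom.map_det (algebraMap ℝ ℂ) S.transpose).symm
      rw [Matrix.det_transpose] at this
      exact this
    rw [hfac, Matrix.det_mul, norm_mul, hmap, hPS, Real.sqrt_sq_eq_abs, Complex.norm_real,
      Real.norm_eq_abs, mul_comm]
    exact mul_le_mul_of_nonneg_right (hbound.trans (by simp)) (abs_nonneg _)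

end Gram

end Filling

namespace Filling

open MeasureTheory Set Filter Topology

open QuatHeisenberg

/-! ### Left-invariant metrics on the quaternionic Heisenberg group -/

variable {n : ℕ}

/-- The Maurer–Cartan form: the differential at `x` of the left translation by `x⁻¹`. -/
noncomputable def maurerCartan (x : QuatHeisenberg n) : QuatHeisenberg n →L[ℝ] QuatHeisenberg n :=
  ContinuousLinearMap.id ℝ _ - (1 / 2 : ℝ) • bracketL x

theorem maurerCartan_apply (x v : QuatHeisenberg n) :
    maurerCartan x v = v - (1 / 2 : ℝ) • ⁅x, v⁆ := rfl

theorem continuous_maurerCartan : Continuous (maurerCartan (n := n)) := by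
  unfold maurerCartan
  fun_prop

theorem norm_bracket_le (x y : QuatHeisenberg n) :
    ‖⁅x, y⁆‖ ≤ ‖bracketL (n := n)‖ * ‖x‖ * ‖y‖ :=
  bracketL.le_opNorm₂ x y

/-- The horizontal part of an element. -/
noncomputable def horizontal : QuatHeisenberg n →L[ℝ] QuatHeisenberg n :=
  LinearMap.toContinuousLinearMap (E := QuatHeisenberg n) (F' := QuatHeisenberg n)
    { toFun := fun x => (x.1, 0)
      map_add' := fun x y => Prod.ext (Eq.refl (x.1 + y.1)) (add_zero (0 : Fin 3 → ℝ)).symm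
      map_smul' := fun c x => Prod.ext (Eq.refl (c • x.1)) (smul_zero (A := Fin 3 → ℝ) c).symm }

theorem norm_horizontal_le (x : QuatHeisenberg n) : ‖horizontal x‖ ≤ ‖x‖ := by
  change max ‖x.1‖ ‖(0 : Fin 3 → ℝ)‖ ≤ max ‖x.1‖ ‖x.2‖
  rw [norm_zero]
  exact max_le_max le_rfl (norm_nonneg _)

theorem horizontal_bracket (x y : QuatHeisenberg n) : horizontal ⁅x, y⁆ = 0 := rfl

theorem bracket_horizontal (x y : QuatHeisenberg n) : ⁅horizontal x, y⁆ = ⁅x, y⁆ := rfl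

section Metric

variable (g : Bundle.ContMDiffRiemannianMetric 𝓘(ℝ, QuatHeisenberg n) ∞ (QuatHeisenberg n)
  (fun x : QuatHeisenberg n => TangentSpace 𝓘(ℝ, QuatHeisenberg n) x))

/-- The metric at the point `x` as a bilinear form on the underlying vector space. -/
noncomputable def innerAt (x : QuatHeisenberg n) :
    QuatHeisenberg n →L[ℝ] QuatHeisenberg n →L[ℝ] ℝ :=
  g.inner x

theorem innerAt_symm (x v w : QuatHeisenberg n) : innerAt g x v w = innerAt g x w v :=
  g.symm x v w

theorem innerAt_pos (x v : QuatHeisenberg n) (hv : v ≠ 0) : 0 < innerAt g x v v :=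
  g.pos x v hv

theorem mfderiv_mul_left_eq (a x w : QuatHeisenberg n) :
    mfderiv 𝓘(ℝ, QuatHeisenberg n) 𝓘(ℝ, QuatHeisenberg n) (fun y => a⁻¹ * y) x w =
      maurerCartan a w := by
  have h : HasFDerivAt (fun y : QuatHeisenberg n => a⁻¹ * y)
      (ContinuousLinearMap.id ℝ _ + (1 / 2 : ℝ) • bracketL a⁻¹) x :=
    ((hasFDerivAt_id _).const_add a⁻¹).add ((bracketL a⁻¹).hasFDerivAt.const_smul (1 / 2 : ℝ))
  refine (congrArg (fun T => T w) h.hasMFDerivAt.mfderiv).trans ?_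
  change w + (1 / 2 : ℝ) • ⁅a⁻¹, w⁆ = w - (1 / 2 : ℝ) • ⁅a, w⁆
  rw [inv_def, neg_lie, smul_neg, sub_eq_add_neg]

variable {g}

/-- Left translation by `x⁻¹` takes `x` to the identity with differential `maurerCartan x`, so one
inner product governs all points. -/
theorem IsLeftInvariant.innerAt_eq (hg : IsLeftInvariant g) (x u v : QuatHeisenberg n) :
    innerAt g x u v = innerAt g 1 (maurerCartan x u) (maurerCartan x v) := by
  have h1 : ∀ y : QuatHeisenberg n, y = 1 → ∀ u' v' : QuatHeisenberg n,
      innerAt g y u' v' = innerAt g 1 u' v' := by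
    rintro y rfl _ _
    rfl
  refine (hg x⁻¹ x u v).symm.trans ((h1 (x⁻¹ * x) (inv_mul_cancel x) _ _).trans ?_)
  rw [mfderiv_mul_left_eq, mfderiv_mul_left_eq]

theorem enorm_tangent (x : QuatHeisenberg n) (v : TangentSpace 𝓘(ℝ, QuatHeisenberg n) x) :
    letI : Bundle.RiemannianBundle
      (fun x : QuatHeisenberg n => TangentSpace 𝓘(ℝ, QuatHeisenberg n) x) := ⟨g.toRiemannianMetric⟩
    ‖v‖ₑ = ENNReal.ofReal (Real.sqrt (innerAt g x v v)) := by
  let : Bundle.RiemannianBundle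
      (fun x : QuatHeisenberg n => TangentSpace 𝓘(ℝ, QuatHeisenberg n) x) := ⟨g.toRiemannianMetric⟩
  rw [← ofReal_norm, norm_eq_sqrt_real_inner]
  rfl

theorem exists_path_of_riemDist_lt {p q : QuatHeisenberg n} {r : ℝ≥0∞} (h : riemDist g p q < r) :
    ∃ γ : ℝ → QuatHeisenberg n, γ 0 = p ∧ γ 1 = q ∧ ContDiffOn ℝ 1 γ (Icc 0 1) ∧
      ∫⁻ t in Icc (0 : ℝ) 1, ENNReal.ofReal (Real.sqrt (innerAt g (γ t)
        (derivWithin γ (Icc 0 1) t) (derivWithin γ (Icc 0 1) t))) < r := by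
  let : Bundle.RiemannianBundle
      (fun x : QuatHeisenberg n => TangentSpace 𝓘(ℝ, QuatHeisenberg n) x) := ⟨g.toRiemannianMetric⟩
  obtain ⟨γ, h0, h1, hγ, hl⟩ := Manifold.exists_lt_of_riemannianEDist_lt h
  refine ⟨γ, h0, h1, contMDiffOn_iff_contDiffOn.1 hγ, ?_⟩
  rw [Manifold.pathELength_eq_lintegral_mfderivWithin_Icc] at hl
  refine lt_of_eq_of_lt (lintegral_congr fun t => ?_) hl
  refine ((enorm_tangent (g := g) (γ t) _).trans ?_).symm
  rw [mfderivWithin_eq_fderivWithin]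
  rfl

theorem riemDist_le_lintegral {γ : ℝ → QuatHeisenberg n} (hγ : ContDiff ℝ 1 γ) :
    riemDist g (γ 0) (γ 1) ≤ ∫⁻ t in Icc (0 : ℝ) 1,
      ENNReal.ofReal (Real.sqrt (innerAt g (γ t) (deriv γ t) (deriv γ t))) := by
  let : Bundle.RiemannianBundle
      (fun x : QuatHeisenberg n => TangentSpace 𝓘(ℝ, QuatHeisenberg n) x) := ⟨g.toRiemannianMetric⟩
  refine (Manifold.riemannianEDist_le_pathELength (a := 0) (b := 1) (γ := γ)
    (contMDiffOn_iff_contDiffOn.2 hγ.contDiffOn) rfl rfl zero_le_one).trans (le_of_eq ?_)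
  rw [Manifold.pathELength_eq_lintegral_mfderiv_Icc]
  refine lintegral_congr fun t => ?_
  refine (enorm_tangent (g := g) (γ t) _).trans ?_
  rw [mfderiv_eq_fderiv]
  rfl

theorem jacobian_eq {m : ℕ} (α : simplex m → QuatHeisenberg n) {x : EuclideanSpace ℝ (Fin m)}
    (hx : x ∈ interior (simplex m)) :
    jacobian g α x = Real.sqrt (Matrix.of fun i j => innerAt g (extend α x)
      (fderiv ℝ (extend α) x (EuclideanSpace.single i (1 : ℝ)))
      (fderiv ℝ (extend α) x (EuclideanSpace.single j (1 : ℝ)))).det := by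
  rw [← fderivWithin_of_mem_nhds (mem_interior_iff_mem_nhds.1 hx), jacobian,
    mfderivWithin_eq_fderivWithin]
  rfl

end Metric

end Filling

namespace Filling

open MeasureTheory Set Filter Topology

open QuatHeisenberg

/-! ### The Riemannian distance and Lipschitz maps -/

variable {n : ℕ}

theorem enorm_sub_le_lintegral_of_mem {V : Type*} [NormedAddCommGroup V] [NormedSpace ℝ V]
    {e : ℝ → V} (he : ContDiffOn ℝ 1 e (Icc 0 1)) {t : ℝ} (ht : t ∈ Icc (0 : ℝ) 1) :
    ‖e t - e 0‖ₑ ≤ ∫⁻ s in Icc (0 : ℝ) 1, ‖derivWithin e (Icc 0 1) s‖ₑ := by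
  have hsub : Icc 0 t ⊆ Icc (0 : ℝ) 1 := Icc_subset_Icc le_rfl ht.2
  refine (enorm_sub_le_lintegral_derivWithin_Icc_of_contDiffOn_Icc (he.mono hsub) ht.1).trans ?_
  refine le_trans (le_of_eq ?_) (lintegral_mono_set hsub)
  rw [← restrict_Ioo_eq_restrict_Icc]
  refine setLIntegral_congr_fun measurableSet_Ioo fun s hs => ?_
  have h1 : Icc 0 t ∈ 𝓝 s := Icc_mem_nhds hs.1 hs.2
  rw [derivWithin_of_mem_nhds h1, derivWithin_of_mem_nhds (mem_of_superset h1 hsub)]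

variable {g : Bundle.ContMDiffRiemannianMetric 𝓘(ℝ, QuatHeisenberg n) ∞ (QuatHeisenberg n)
  (fun x : QuatHeisenberg n => TangentSpace 𝓘(ℝ, QuatHeisenberg n) x)}

theorem inv_mul_eq (p q : QuatHeisenberg n) : p⁻¹ * q = -p + maurerCartan p q := by
  rw [mul_def, inv_def, maurerCartan_apply, neg_lie, smul_neg]
  abel

/-- For a path through `x` with left-invariant velocity `u`, this expresses the derivative of the
path translated by `p⁻¹` as `u` plus half a bracket; nilpotency of step two ends the series there.
-/
theorem maurerCartan_eq_add (p x v : QuatHeisenberg n) :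
    maurerCartan p v = maurerCartan x v + (1 / 2 : ℝ) • ⁅p⁻¹ * x, maurerCartan x v⁆ := by
  simp only [inv_mul_eq, maurerCartan_apply, lie_sub, lie_smul, add_lie, neg_lie, sub_lie, smul_lie,
    bracket_bracket_left, bracket_bracket_right, smul_zero, sub_zero, neg_zero, add_zero]
  module

theorem horizontal_maurerCartan (x v : QuatHeisenberg n) :
    horizontal (maurerCartan x v) = horizontal v := by
  rw [maurerCartan_apply, map_sub, map_smul, horizontal_bracket, smul_zero, sub_zero]

/-- Locally, the Riemannian distance bounds the left-invariant coordinate difference. -/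
theorem IsLeftInvariant.exists_norm_inv_mul_le (hg : IsLeftInvariant g) :
    ∃ K > 0, ∀ (p q : QuatHeisenberg n) (s : ℝ), 0 ≤ s → s < 1 →
      riemDist g p q ≤ ENNReal.ofReal s → ‖p⁻¹ * q‖ ≤ K * s := by
  obtain ⟨c, hc, hcB⟩ := exists_forall_mul_norm_sq_le (B := innerAt g 1) (innerAt_pos g 1)
  set κ : ℝ := (Real.sqrt c)⁻¹
  have hκ : 0 < κ := inv_pos.2 (Real.sqrt_pos.2 hc)
  have hκv : ∀ v, ‖v‖ ≤ κ * Real.sqrt (innerAt g 1 v v) := by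
    intro v
    rw [← div_eq_inv_mul, le_div_iff₀ (Real.sqrt_pos.2 hc)]
    refine Real.le_sqrt_of_sq_le ?_
    rw [mul_pow, Real.sq_sqrt hc.le, mul_comm]
    exact hcB v
  set β : ℝ := ‖bracketL (n := n)‖
  have hβ : 0 ≤ β := norm_nonneg (bracketL (n := n))
  refine ⟨(1 + 1 / 2 * β * κ) * κ, by positivity, fun p q s hs hs1 hpq => ?_⟩
  -- The distance is an infimum, so a path is available only for lengths `r > s`; let `r` decrease
  -- to `s`.
  suffices H : ∀ r, s < r → r < 1 → ‖p⁻¹ * q‖ ≤ (1 + 1 / 2 * β * κ) * κ * r by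
    have hlim : Tendsto (fun r => (1 + 1 / 2 * β * κ) * κ * r) (𝓝[>] s)
        (𝓝 ((1 + 1 / 2 * β * κ) * κ * s)) :=
      ((continuous_const.mul continuous_id).tendsto s).mono_left nhdsWithin_le_nhds
    refine ge_of_tendsto hlim ?_
    filter_upwards [Ioo_mem_nhdsGT hs1] with r hr using H r hr.1 hr.2
  intro r hsr hr1
  have hr0 : 0 < r := hs.trans_lt hsr
  obtain ⟨γ, h0, h1, hγ, hl⟩ := exists_path_of_riemDist_lt
    (hpq.trans_lt ((ENNReal.ofReal_lt_ofReal_iff hr0).2 hsr))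
  set v : ℝ → QuatHeisenberg n := derivWithin γ (Icc 0 1)
  set u : ℝ → QuatHeisenberg n := fun t => maurerCartan (γ t) (v t)
  have hu : ∫⁻ t in Icc (0 : ℝ) 1, ‖u t‖ₑ ≤ ENNReal.ofReal (κ * r) := by
    rw [ENNReal.ofReal_mul hκ.le]
    refine le_trans ?_ (mul_le_mul_right hl.le (ENNReal.ofReal κ))
    rw [← lintegral_const_mul' _ _ ENNReal.ofReal_ne_top]
    refine lintegral_mono fun t => ?_
    rw [← ENNReal.ofReal_mul hκ.le, ← ofReal_norm, hg.innerAt_eq]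
    exact ENNReal.ofReal_le_ofReal (hκv _)
  set e : ℝ → QuatHeisenberg n := fun t => p⁻¹ * γ t
  have he' : e = fun t => -p + maurerCartan p (γ t) := funext fun t => inv_mul_eq p (γ t)
  have hec : ContDiffOn ℝ 1 e (Icc 0 1) := by
    rw [he']
    exact contDiffOn_const.add ((maurerCartan p).contDiff.comp_contDiffOn hγ)
  have hγd : ∀ t ∈ Icc (0 : ℝ) 1, HasDerivWithinAt γ (v t) (Icc 0 1) t := fun t ht =>
    (hγ.differentiableOn one_ne_zero t ht).hasDerivWithinAt
  have hed : ∀ t ∈ Icc (0 : ℝ) 1, HasDerivWithinAt e (maurerCartan p (v t)) (Icc 0 1) t := by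
    intro t ht
    rw [he']
    exact ((maurerCartan p).hasFDerivAt.comp_hasDerivWithinAt t (hγd t ht)).const_add _
  have hud : UniqueDiffOn ℝ (Icc (0 : ℝ) 1) := uniqueDiffOn_Icc zero_lt_one
  have he0 : e 0 = 0 := by
    change p⁻¹ * γ 0 = 0
    rw [h0, inv_mul_cancel]
    rfl
  -- The horizontal part of the derivative has no bracket correction, so it is controlled by the
  -- length alone; `r < 1` is used to bound it by `κ`.
  have hhor : ∀ t ∈ Icc (0 : ℝ) 1, ‖horizontal (e t)‖ ≤ κ := by
    intro t ht
    have hd := enorm_sub_le_lintegral_of_mem (e := fun t => horizontal (e t))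
      (horizontal.contDiff.comp_contDiffOn hec) ht
    rw [he0, map_zero, sub_zero] at hd
    have hd2 : ‖horizontal (e t)‖ₑ ≤ ENNReal.ofReal (κ * r) := by
      refine hd.trans (le_trans (setLIntegral_mono' measurableSet_Icc fun s hs => ?_) hu)
      have hh : HasDerivWithinAt (fun t => horizontal (e t))
          (horizontal (maurerCartan p (v s))) (Icc 0 1) s :=
        horizontal.hasFDerivAt.comp_hasDerivWithinAt s (hed s hs)
      rw [hh.derivWithin (hud s hs), horizontal_maurerCartan, ← horizontal_maurerCartan (γ s), ← ofReal_norm, ← ofReal_norm]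
      exact ENNReal.ofReal_le_ofReal (norm_horizontal_le _)
    rw [← ofReal_norm, ENNReal.ofReal_le_ofReal_iff (by positivity)] at hd2
    nlinarith
  have hfin := enorm_sub_le_lintegral_of_mem hec (right_mem_Icc.2 zero_le_one)
  rw [he0, sub_zero] at hfin
  -- The bracket only sees the horizontal part of `e t`, already bounded by `κ`, so the correction
  -- costs the factor `1 + 1 / 2 * β * κ`.
  have hfin2 : ‖e 1‖ₑ ≤ ENNReal.ofReal ((1 + 1 / 2 * β * κ) * (κ * r)) := by
    rw [ENNReal.ofReal_mul (by positivity)]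
    refine hfin.trans (le_trans ?_ (mul_le_mul_right hu _))
    rw [← lintegral_const_mul' _ _ ENNReal.ofReal_ne_top]
    refine setLIntegral_mono' measurableSet_Icc fun t ht => ?_
    rw [(hed t ht).derivWithin (hud t ht), ← ofReal_norm, ← ofReal_norm,
      ← ENNReal.ofReal_mul (by positivity)]
    refine ENNReal.ofReal_le_ofReal ?_
    rw [maurerCartan_eq_add p (γ t), ← bracket_horizontal]
    refine (norm_add_le _ _).trans ?_
    rw [norm_smul, add_mul, one_mul]
    refine add_le_add le_rfl ?_
    have h2 := norm_bracket_le (horizontal (e t)) (u t)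
    have h3 : β * ‖horizontal (e t)‖ * ‖u t‖ ≤ β * κ * ‖u t‖ :=
      mul_le_mul_of_nonneg_right (mul_le_mul_of_nonneg_left (hhor t ht) hβ) (norm_nonneg _)
    rw [Real.norm_of_nonneg (by norm_num : (0 : ℝ) ≤ 1 / 2)]
    change 1 / 2 * ‖⁅horizontal (e t), u t⁆‖ ≤ 1 / 2 * β * κ * ‖u t‖
    linarith
  rw [← ofReal_norm, ENNReal.ofReal_le_ofReal_iff (by positivity)] at hfin2
  rw [← h1]
  exact hfin2.trans_eq (by ring)

theorem extend_of_mem {m : ℕ} {M : Type*} (α : simplex m → M) {x : EuclideanSpace ℝ (Fin m)}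
    (hx : x ∈ simplex m) : extend α x = α ⟨x, hx⟩ := by
  rw [extend, dif_pos hx]

/-- Expand `q = p * (p⁻¹ * q)`. The factor grows with `‖p‖`, so left-invariant and coordinate
differences are comparable only on bounded sets. -/
theorem norm_sub_le_of_inv_mul (p q : QuatHeisenberg n) :
    ‖q - p‖ ≤ (1 + 1 / 2 * ‖bracketL (n := n)‖ * ‖p‖) * ‖p⁻¹ * q‖ := by
  have h : q - p = p⁻¹ * q + (1 / 2 : ℝ) • ⁅p, p⁻¹ * q⁆ := by
    have h1 : p * (p⁻¹ * q) = q := mul_inv_cancel_left p q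
    rw [mul_def p (p⁻¹ * q)] at h1
    nth_rewrite 1 [← h1]
    abel
  rw [h]
  refine (norm_add_le _ _).trans ?_
  rw [norm_smul, Real.norm_of_nonneg (by norm_num : (0 : ℝ) ≤ 1 / 2), add_mul, one_mul]
  have := norm_bracket_le p (p⁻¹ * q)
  linarith

/-- A Lipschitz simplex is Lipschitz in coordinates. -/
theorem LipSimplex.exists_lipschitzOnWith_extend (hg : IsLeftInvariant g) {m : ℕ}
    (α : LipSimplex g m) : ∃ K : ℝ≥0, LipschitzOnWith K (extend α.1) (simplex m) := by
  obtain ⟨K, hK, hKd⟩ := hg.exists_norm_inv_mul_le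
  obtain ⟨L, hL⟩ := α.2
  set β : ℝ := ‖bracketL (n := n)‖
  have hβ : 0 ≤ β := norm_nonneg (bracketL (n := n))
  have hloc : ∀ x ∈ simplex m, ∀ y ∈ simplex m, L * dist x y < 1 →
      ‖(extend α.1 x)⁻¹ * extend α.1 y‖ ≤ K * (L * dist x y) := by
    intro x hx y hy hxy
    rw [extend_of_mem _ hx, extend_of_mem _ hy]
    refine hKd _ _ _ (by positivity) hxy ((hL ⟨x, hx⟩ ⟨y, hy⟩).trans (le_of_eq ?_))
    rw [ENNReal.ofReal_mul L.coe_nonneg, ENNReal.ofReal_coe_nnreal, ← edist_dist]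
    rfl
  have hsub : ∀ x ∈ simplex m, ∀ y ∈ simplex m, L * dist x y < 1 →
      ‖extend α.1 y - extend α.1 x‖ ≤
        (1 + 1 / 2 * β * ‖extend α.1 x‖) * (K * (L * dist x y)) := fun x hx y hy hxy =>
    (norm_sub_le_of_inv_mul _ _).trans
      (mul_le_mul_of_nonneg_left (hloc x hx y hy hxy) (by positivity))
  refine LocallyLipschitzOn.exists_lipschitzOnWith_of_compact (isCompact_simplex m) ?_
  intro x₀ hx₀
  set a := ‖extend α.1 x₀‖
  -- A bound for the simplex on a small ball about `x₀`, which makes the factor of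
  -- `norm_sub_le_of_inv_mul` uniform.
  set R : ℝ := a + (1 + 1 / 2 * β * a) * K
  have ha : 0 ≤ a := norm_nonneg _
  have hR : 0 ≤ R := by positivity
  -- Any two points of the ball are closer than `2 * η`, so `L * dist < 1` and the short-distance
  -- estimate applies to them.
  set η : ℝ := 1 / (2 * (L + 1))
  have hη : 0 < η := by positivity
  have hηL : L * (2 * η) < 1 := by
    have : L * (2 * η) = L / (L + 1) := by simp only [η]; field_simp
    rw [this, div_lt_one (by positivity)]
    linarith
  have hball : ∀ x ∈ Metric.ball x₀ η, ∀ y ∈ Metric.ball x₀ η, L * dist x y < 1 := by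
    intro x hx y hy
    refine lt_of_le_of_lt (mul_le_mul_of_nonneg_left ?_ L.coe_nonneg) hηL
    have := dist_triangle_right x y x₀
    rw [Metric.mem_ball] at hx hy
    linarith
  have hbd : ∀ x ∈ Metric.ball x₀ η ∩ simplex m, ‖extend α.1 x‖ ≤ R := by
    intro x hx
    have h1 := hball x₀ (Metric.mem_ball_self hη) x hx.1
    have h2 := hsub x₀ hx₀ x hx.2 h1
    have h3 : (1 + 1 / 2 * β * a) * (K * (L * dist x₀ x)) ≤ (1 + 1 / 2 * β * a) * K :=
      mul_le_mul_of_nonneg_left (mul_le_of_le_one_right hK.le h1.le) (by positivity)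
    have h4 := norm_add_le (extend α.1 x₀) (extend α.1 x - extend α.1 x₀)
    rw [add_sub_cancel] at h4
    exact h4.trans (add_le_add le_rfl (h2.trans h3))
  refine ⟨⟨(1 + 1 / 2 * β * R) * (K * L), by positivity⟩, Metric.ball x₀ η ∩ simplex m,
    inter_mem (nhdsWithin_le_nhds (Metric.ball_mem_nhds _ hη)) self_mem_nhdsWithin,
    LipschitzOnWith.of_dist_le_mul fun x hx y hy => ?_⟩
  rw [dist_comm, dist_eq_norm]
  refine (hsub x hx.2 y hy.2 (hball x hx.1 y hy.1)).trans ?_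
  change _ ≤ (1 + 1 / 2 * β * R) * (K * L) * dist x y
  rw [show (1 + 1 / 2 * β * R) * (K * L) * dist x y =
    (1 + 1 / 2 * β * R) * (K * (L * dist x y)) by ring]
  refine mul_le_mul_of_nonneg_right ?_ (by positivity)
  exact add_le_add le_rfl (mul_le_mul_of_nonneg_left (hbd x hx) (by positivity))

theorem LipSimplex.lipOn_comp_extend (hg : IsLeftInvariant g) {m : ℕ} (α : LipSimplex g m)
    {f : QuatHeisenberg n → ℂ} (hf : ContDiff ℝ 1 f) : LipOn fun x => f (extend α.1 x) := by
  obtain ⟨K, hK⟩ := α.exists_lipschitzOnWith_extend hg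
  obtain ⟨L, hL⟩ := hf.locallyLipschitz.locallyLipschitzOn.exists_lipschitzOnWith_of_compact
    ((isCompact_simplex m).image_of_continuousOn hK.continuousOn)
  exact ⟨L * K, hL.comp hK (mapsTo_image _ _)⟩

/-- Smooth maps are Lipschitz for the Riemannian distance. -/
theorem IsLeftInvariant.exists_riemDist_le (hg : IsLeftInvariant g) {m : ℕ}
    {A : EuclideanSpace ℝ (Fin m) → QuatHeisenberg n} (hA : ContDiff ℝ 1 A) :
    ∃ K : ℝ≥0, ∀ x y : simplex m, riemDist g (A x) (A y) ≤ K * edist x y := by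
  have hcont : Continuous fun z =>
      ‖innerAt g 1‖ * (‖maurerCartan (A z)‖ * ‖fderiv ℝ A z‖) ^ 2 := by
    have h1 := hA.continuous
    have h2 := hA.continuous_fderiv one_ne_zero
    have h3 := continuous_maurerCartan (n := n)
    fun_prop
  obtain ⟨C, hC⟩ := (isCompact_simplex m).exists_bound_of_continuousOn hcont.continuousOn
  refine ⟨(Real.sqrt C).toNNReal, fun x y => ?_⟩
  -- Images of segments, which stay in the convex simplex, give admissible paths; `C` bounds the
  -- squared speed per unit of Euclidean speed.
  let γ : ℝ → QuatHeisenberg n := fun t => A (x.1 + t • (y.1 - x.1))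
  have hγ : ContDiff ℝ 1 γ := hA.comp (by fun_prop)
  have h := riemDist_le_lintegral (g := g) hγ
  have h0 : γ 0 = A x := by simp [γ]
  have h1 : γ 1 = A y := by simp [γ]
  rw [h0, h1] at h
  refine h.trans ?_
  have hle : ∀ t ∈ Icc (0 : ℝ) 1,
      ENNReal.ofReal (Real.sqrt (innerAt g (γ t) (deriv γ t) (deriv γ t))) ≤
        ENNReal.ofReal (Real.sqrt C * dist x y) := by
    intro t ht
    have hz : x.1 + t • (y.1 - x.1) ∈ simplex m :=
      (convex_simplex m).add_smul_sub_mem x.2 y.2 ht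
    have hd : deriv γ t = fderiv ℝ A (x.1 + t • (y.1 - x.1)) (y.1 - x.1) := by
      have h1 : HasDerivAt (fun t : ℝ => x.1 + t • (y.1 - x.1)) (y.1 - x.1) t := by
        simpa using ((hasDerivAt_id t).smul_const (y.1 - x.1)).const_add x.1
      exact ((hA.differentiable one_ne_zero _).hasFDerivAt.comp_hasDerivAt t h1).deriv
    refine ENNReal.ofReal_le_ofReal ?_
    rw [← Real.sqrt_sq (dist_nonneg : 0 ≤ dist x y), ← Real.sqrt_mul' _ (sq_nonneg _)]
    refine Real.sqrt_le_sqrt ?_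
    have hCz := (le_abs_self _).trans (hC _ hz)
    rw [hg.innerAt_eq, hd]
    set z := x.1 + t • (y.1 - x.1)
    set w := y.1 - x.1
    have hw : ‖w‖ = dist x y := by rw [← dist_eq_norm, dist_comm]; rfl
    have hN : ‖maurerCartan (γ t) (fderiv ℝ A z w)‖ ≤
        ‖maurerCartan (A z)‖ * ‖fderiv ℝ A z‖ * ‖w‖ := by
      refine ((maurerCartan (γ t)).le_opNorm _).trans ?_
      rw [mul_assoc]
      exact mul_le_mul_of_nonneg_left (ContinuousLinearMap.le_opNorm _ _) (norm_nonneg _)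
    calc innerAt g 1 (maurerCartan (γ t) (fderiv ℝ A z w)) (maurerCartan (γ t) (fderiv ℝ A z w))
        ≤ ‖innerAt g 1‖ * ‖maurerCartan (γ t) (fderiv ℝ A z w)‖ *
            ‖maurerCartan (γ t) (fderiv ℝ A z w)‖ :=
          (le_abs_self _).trans ((innerAt g 1).le_opNorm₂ _ _)
      _ ≤ ‖innerAt g 1‖ * (‖maurerCartan (A z)‖ * ‖fderiv ℝ A z‖ * ‖w‖) *
            (‖maurerCartan (A z)‖ * ‖fderiv ℝ A z‖ * ‖w‖) := by gcongr
      _ = ‖innerAt g 1‖ * (‖maurerCartan (A z)‖ * ‖fderiv ℝ A z‖) ^ 2 * dist x y ^ 2 := by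
          rw [hw]; ring
      _ ≤ C * dist x y ^ 2 := mul_le_mul_of_nonneg_right hCz (sq_nonneg _)
  refine (setLIntegral_mono' measurableSet_Icc hle).trans (le_of_eq ?_)
  rw [lintegral_const, Measure.restrict_apply MeasurableSet.univ, univ_inter, Real.volume_Icc,
    sub_zero, ENNReal.ofReal_one, mul_one, ENNReal.ofReal_mul (Real.sqrt_nonneg _), ← edist_dist]
  rfl

end Filling

namespace Filling

open MeasureTheory Set Filter Topology

open QuatHeisenberg

/-! ### The calibrating form -/

variable {n : ℕ}

/-- The coordinate `I + √-1 J`. -/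
noncomputable def coordZ : QuatHeisenberg n →L[ℝ] ℂ :=
  LinearMap.toContinuousLinearMap (E := QuatHeisenberg n) (F' := ℂ)
    { toFun := fun x => ⟨x.2 0, x.2 1⟩
      map_add' := fun _ _ => rfl
      map_smul' := fun c x => by
        rw [RingHom.id_apply, Complex.real_smul, Complex.ext_iff, Complex.re_ofReal_mul,
          Complex.im_ofReal_mul]
        exact ⟨rfl, rfl⟩ }

/-- The coordinate `i_m + √-1 j_m`. -/
noncomputable def coordP (m : Fin n) : QuatHeisenberg n →L[ℝ] ℂ :=
  LinearMap.toContinuousLinearMap (E := QuatHeisenberg n) (F' := ℂ)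
    { toFun := fun x => ⟨x.1 m 1, x.1 m 2⟩
      map_add' := fun _ _ => rfl
      map_smul' := fun c x => by
        rw [RingHom.id_apply, Complex.real_smul, Complex.ext_iff, Complex.re_ofReal_mul,
          Complex.im_ofReal_mul]
        exact ⟨rfl, rfl⟩ }

/-- The coordinate `h_m + √-1 k_m`. -/
noncomputable def coordQ (m : Fin n) : QuatHeisenberg n →L[ℝ] ℂ :=
  LinearMap.toContinuousLinearMap (E := QuatHeisenberg n) (F' := ℂ)
    { toFun := fun x => ⟨x.1 m 0, x.1 m 3⟩
      map_add' := fun _ _ => rfl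
      map_smul' := fun c x => by
        rw [RingHom.id_apply, Complex.real_smul, Complex.ext_iff, Complex.re_ofReal_mul,
          Complex.im_ofReal_mul]
        exact ⟨rfl, rfl⟩ }

theorem coordZ_apply (x : QuatHeisenberg n) : coordZ x = ⟨x.2 0, x.2 1⟩ := rfl

theorem coordP_apply (m : Fin n) (x : QuatHeisenberg n) : coordP m x = ⟨x.1 m 1, x.1 m 2⟩ := rfl

theorem coordQ_apply (m : Fin n) (x : QuatHeisenberg n) : coordQ m x = ⟨x.1 m 0, x.1 m 3⟩ := rfl

/-- In the coordinates `p_m`, `q_m` two of the three bracket components combine into a complex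
bilinear symplectic form. Every term of it involves some `q_m`, which is why wedging with all the
`dq_m` yields a closed form. -/
theorem coordZ_bracket (x v : QuatHeisenberg n) :
    coordZ ⁅x, v⁆ = ∑ m, (coordP m x * coordQ m v - coordP m v * coordQ m x) := by
  have h : ∀ c, (⁅x, v⁆ : QuatHeisenberg n).2 c = ∑ m, bracketCoord (x.1 m) (v.1 m) c :=
    fun c => Finset.sum_apply c Finset.univ fun m => bracketCoord (x.1 m) (v.1 m)
  rw [coordZ_apply, h, h, Complex.ext_iff, Complex.re_sum, Complex.im_sum]
  simp only [coordP_apply, coordQ_apply, Complex.sub_re, Complex.sub_im, Complex.mul_re,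
    Complex.mul_im]
  constructor <;> refine Finset.sum_congr rfl fun m _ => ?_ <;> simp [bracketCoord] <;> ring

theorem coordQ_maurerCartan (m : Fin n) (x v : QuatHeisenberg n) :
    coordQ m (maurerCartan x v) = coordQ m v := by
  have h : coordQ m ⁅x, v⁆ = 0 := rfl
  rw [maurerCartan_apply, map_sub, map_smul, h, smul_zero, sub_zero]

/-- Coordinates whose differentials have a left-invariant exterior product. -/
noncomputable def calibCoord : Fin (n + 1) → QuatHeisenberg n → ℂ :=
  Fin.cons (fun x => coordZ x + (1 / 2 : ℂ) * ∑ m, coordP m x * coordQ m x) fun m x => coordQ m x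

theorem contDiff_calibCoord (j : Fin (n + 1)) : ContDiff ℝ 1 (calibCoord (n := n) j) := by
  refine Fin.cases ?_ (fun m => ?_) j
  · exact coordZ.contDiff.add (contDiff_const.mul
      (ContDiff.sum fun m _ => (coordP m).contDiff.mul (coordQ m).contDiff))
  · exact (coordQ m).contDiff

/-- The derivative of `(1/2) ∑ p_m q_m` cancels the `q dp` part of the bracket term and doubles the
`p dq` part, leaving only multiples of the `dq_m` beside the left-invariant form. -/
theorem fderiv_calibCoord_zero (x v : QuatHeisenberg n) :
    fderiv ℝ (calibCoord 0) x v =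
      coordZ (maurerCartan x v) + ∑ m, coordP m x * coordQ m (maurerCartan x v) := by
  have h : HasFDerivAt (calibCoord (n := n) 0)
      (coordZ + (1 / 2 : ℂ) • ∑ m, (coordP m x • coordQ m + coordQ m x • coordP m)) x :=
    coordZ.hasFDerivAt.add ((HasFDerivAt.fun_sum fun m _ =>
      (coordP m).hasFDerivAt.mul (coordQ m).hasFDerivAt).const_mul (1 / 2 : ℂ))
  rw [h.fderiv]
  simp only [coordQ_maurerCartan, _root_.add_apply, _root_.smul_apply, _root_.sum_apply,
    smul_eq_mul]
  rw [maurerCartan_apply, map_sub, map_smul, coordZ_bracket, Complex.real_smul,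
    Finset.sum_add_distrib, Finset.sum_sub_distrib]
  simp only [mul_comm (coordP _ v)]
  push_cast
  ring

theorem fderiv_calibCoord_succ (m : Fin n) (x v : QuatHeisenberg n) :
    fderiv ℝ (calibCoord m.succ) x v = coordQ m (maurerCartan x v) := by
  rw [coordQ_maurerCartan]
  exact congrArg (fun L => L v) (coordQ m).hasFDerivAt.fderiv

/-- Column `0` differs from its left-invariant counterpart by a combination, with coefficients `p_m
x`, of the other columns. -/
theorem det_fderiv_calibCoord (x : QuatHeisenberg n) (D : Fin (n + 1) → QuatHeisenberg n) :
    (Matrix.of fun i j => fderiv ℝ (calibCoord j) x (D i)).det =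
      (Matrix.of fun i j => (Fin.cons coordZ coordQ : Fin (n + 1) → QuatHeisenberg n →L[ℝ] ℂ) j
        (maurerCartan x (D i))).det := by
  set A : Matrix (Fin (n + 1)) (Fin (n + 1)) ℂ := Matrix.of fun i j =>
    (Fin.cons coordZ coordQ : Fin (n + 1) → QuatHeisenberg n →L[ℝ] ℂ) j (maurerCartan x (D i))
  have h := Matrix.det_updateCol_sum A 0 (Fin.cons 1 fun m => coordP m x)
  rw [Fin.cons_zero, one_smul] at h
  rw [← h]
  congr 1
  ext i j
  refine Fin.cases ?_ (fun m => ?_) j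
  · rw [Matrix.updateCol_self, Fin.sum_univ_succ, Matrix.of_apply, fderiv_calibCoord_zero]
    simp only [Fin.cons_zero, Fin.cons_succ, smul_eq_mul, one_mul]
    rfl
  · rw [Matrix.updateCol_ne (Fin.succ_ne_zero m), Matrix.of_apply, fderiv_calibCoord_succ]
    rfl

variable {g : Bundle.ContMDiffRiemannianMetric 𝓘(ℝ, QuatHeisenberg n) ∞ (QuatHeisenberg n)
  (fun x : QuatHeisenberg n => TangentSpace 𝓘(ℝ, QuatHeisenberg n) x)}

/-- By left invariance of both the form and the metric, the determinant estimate at the identity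
holds with the same constant everywhere. -/
theorem IsLeftInvariant.exists_enorm_jacIntegral_le (hg : IsLeftInvariant g) :
    ∃ C > 0, ∀ β : LipSimplex g (n + 1),
      ‖jacIntegral (fun _ => 1) fun j => calibCoord j ∘ extend β.1‖ₑ ≤
        ENNReal.ofReal C * β.vol := by
  obtain ⟨C, hC, h⟩ := exists_forall_norm_det_le (innerAt_symm g 1) (innerAt_pos g 1)
    (Fin.cons coordZ coordQ : Fin (n + 1) → QuatHeisenberg n →L[ℝ] ℂ)
  refine ⟨C, hC, fun β => ?_⟩
  obtain ⟨K, hK⟩ := β.exists_lipschitzOnWith_extend hg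
  rw [LipSimplex.vol, ← lintegral_const_mul' _ _ ENNReal.ofReal_ne_top]
  refine (enorm_integral_le_lintegral_enorm _).trans (lintegral_mono_ae ?_)
  filter_upwards [hK.ae_differentiableWithinAt (measurableSet_simplex _),
    ae_mem_interior_simplex (n + 1)] with x hx hxi
  have hd := (hx.differentiableAt (mem_interior_iff_mem_nhds.1 hxi)).hasFDerivAt
  rw [one_mul, ← ofReal_norm, ← ENNReal.ofReal_mul hC.le, jacobian_eq _ hxi]
  refine ENNReal.ofReal_le_ofReal ?_
  simp only [hg.innerAt_eq (extend β.1 x)]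
  refine le_trans (le_of_eq ?_) (h _)
  rw [← det_fderiv_calibCoord]
  congr 2
  ext i j
  have hj := ((contDiff_calibCoord (n := n) j).differentiable one_ne_zero
    (extend β.1 x)).hasFDerivAt.comp x hd
  exact congrArg (fun L => L (EuclideanSpace.single i (1 : ℝ))) hj.fderiv

/-- The integral of a primitive of the calibrating form over a Lipschitz simplex. -/
noncomputable def LipSimplex.period (α : LipSimplex g n) : ℂ :=
  jacIntegral (calibCoord 0 ∘ extend α.1) fun m => calibCoord m.succ ∘ extend α.1

/-- The integral of a primitive of the calibrating form over a Lipschitz chain. -/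
noncomputable def chainPeriod (g : Bundle.ContMDiffRiemannianMetric 𝓘(ℝ, QuatHeisenberg n) ∞
    (QuatHeisenberg n) (fun x : QuatHeisenberg n => TangentSpace 𝓘(ℝ, QuatHeisenberg n) x)) :
    Chain g n →+ ℂ :=
  Finsupp.liftAddHom fun α : LipSimplex g n => zmultiplesHom ℂ α.period

theorem chainPeriod_single (α : LipSimplex g n) (z : ℤ) :
    chainPeriod g (Finsupp.single α z) = z • α.period := by
  rw [chainPeriod, Finsupp.liftAddHom_apply_single]
  rfl

theorem LipSimplex.extend_face {m : ℕ} (β : LipSimplex g (m + 1)) (i : Fin (m + 2)) :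
    EqOn (extend (β.face i).1) (extend β.1 ∘ faceFun i) (simplex m) := by
  intro x hx
  rw [extend_of_mem _ hx, Function.comp_apply, extend_of_mem _ (faceFun_mem i hx)]
  rfl

/-- Stokes' theorem for the primitive `f dq_1 ∧ ⋯ ∧ dq_n` with `f = calibCoord 0`. -/
theorem IsLeftInvariant.chainPeriod_boundary_single (hg : IsLeftInvariant g)
    (β : LipSimplex g (n + 1)) (z : ℤ) :
    chainPeriod g (boundary g (n + 1) (Finsupp.single β z)) =
      z • jacIntegral (fun _ => 1) fun j => calibCoord j ∘ extend β.1 := by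
  have h1 : boundary g (n + 1) (Finsupp.single β z) =
      z • ∑ i : Fin (n + 2), Finsupp.single (β.face i) ((-1 : ℤ) ^ (i : ℕ)) := by
    rw [boundary, Finsupp.liftAddHom_apply_single]
    rfl
  rw [h1, map_zsmul, map_sum, jacIntegral_eq_sum_faces (f := fun j => calibCoord j ∘ extend β.1) fun j =>
    β.lipOn_comp_extend hg (contDiff_calibCoord j)]
  congr 1
  refine Finset.sum_congr rfl fun i _ => ?_
  rw [chainPeriod_single, zsmul_eq_mul]
  push_cast
  congr 1
  exact jacIntegral_congr (fun x hx => congrArg (calibCoord 0) (β.extend_face i hx))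
    fun m x hx => congrArg (calibCoord m.succ) (β.extend_face i hx)

/-- The calibrating form bounds masses from below. -/
theorem IsLeftInvariant.exists_enorm_chainPeriod_boundary_le (hg : IsLeftInvariant g) :
    ∃ C > 0, ∀ b : Chain g (n + 1),
      ‖chainPeriod g (boundary g (n + 1) b)‖ₑ ≤ ENNReal.ofReal C * mass b := by
  obtain ⟨C, hC, h⟩ := hg.exists_enorm_jacIntegral_le
  refine ⟨C, hC, fun b => ?_⟩
  have hb : chainPeriod g (boundary g (n + 1) b) = b.sum fun β z =>
      z • jacIntegral (fun _ => 1) fun j => calibCoord j ∘ extend β.1 := by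
    conv_lhs => rw [← b.sum_single, Finsupp.sum, map_sum, map_sum]
    exact Finset.sum_congr rfl fun β _ => hg.chainPeriod_boundary_single β (b β)
  rw [hb, mass, Finsupp.sum, Finsupp.sum, Finset.mul_sum]
  refine (enorm_sum_le _ _).trans (Finset.sum_le_sum fun β _ => ?_)
  rw [zsmul_eq_mul, enorm_mul, mul_left_comm]
  refine mul_le_mul' (le_of_eq ?_) (h β)
  rw [← ofReal_norm, Complex.norm_intCast, ← Int.cast_abs, Int.abs_eq_natAbs, Int.cast_natCast,
    ENNReal.ofReal_natCast]

end Filling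

namespace Filling

open MeasureTheory Set Filter Topology

open QuatHeisenberg

/-! ### Legendrian graphs -/

variable {n : ℕ} {φ : EuclideanSpace ℝ (Fin n) → ℝ}

/-- The element of the Lie algebra with the given coordinates along the `h_m`, the `i_m`
and `I`. -/
noncomputable def ofCoord (a b : Fin n → ℝ) (c : ℝ) : QuatHeisenberg n :=
  (fun m => ![a m, b m, 0, 0], ![c, 0, 0])

theorem smul_ofCoord (t : ℝ) (a b : Fin n → ℝ) (c : ℝ) :
    t • ofCoord a b c = ofCoord (t • a) (t • b) (t * c) := by
  refine Prod.ext (funext fun m => funext fun k => ?_) (funext fun k => ?_)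
  · change t * _ = _
    fin_cases k <;> simp [ofCoord]
  · change t * _ = _
    fin_cases k <;> simp [ofCoord]

/-- The `h_m`, `i_m` and `I` span a real Heisenberg subalgebra, so no `J` or `K` component appears.
-/
theorem maurerCartan_ofCoord (a b : Fin n → ℝ) (c : ℝ) (a' b' : Fin n → ℝ) (c' : ℝ) :
    maurerCartan (ofCoord a b c) (ofCoord a' b' c') =
      ofCoord a' b' (c' - 1 / 2 * ∑ m, (b m * a' m - a m * b' m)) := by
  have h : ∀ k, (⁅ofCoord a b c, ofCoord a' b' c'⁆ : QuatHeisenberg n).2 k =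
      ∑ m, bracketCoord ![a m, b m, 0, 0] ![a' m, b' m, 0, 0] k :=
    fun k => Finset.sum_apply k Finset.univ fun m =>
      bracketCoord ![a m, b m, 0, 0] ![a' m, b' m, 0, 0]
  rw [maurerCartan_apply]
  refine Prod.ext (funext fun m => funext fun k => ?_) (funext fun k => ?_)
  · change _ - 1 / 2 * (0 : ℝ) = _
    rw [mul_zero, sub_zero]
    rfl
  · change _ - 1 / 2 * (⁅ofCoord a b c, ofCoord a' b' c'⁆ : QuatHeisenberg n).2 k = _
    rw [h]
    fin_cases k <;> simp [ofCoord, bracketCoord]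

theorem contDiff_ofCoord {W : Type*} [NormedAddCommGroup W] [NormedSpace ℝ W] {k : WithTop ℕ∞}
    {a b : W → Fin n → ℝ} {c : W → ℝ} (ha : ContDiff ℝ k a) (hb : ContDiff ℝ k b)
    (hc : ContDiff ℝ k c) : ContDiff ℝ k fun x => ofCoord (a x) (b x) (c x) := by
  refine ContDiff.prodMk (E := W) (F := Fin n → Fin 4 → ℝ) (G := Fin 3 → ℝ)
    (contDiff_pi.2 fun m => contDiff_pi.2 fun i => ?_) (contDiff_pi.2 fun i => ?_)
  · fin_cases i
    exacts [contDiff_pi.1 ha m, contDiff_pi.1 hb m, contDiff_const, contDiff_const]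
  · fin_cases i
    exacts [hc, contDiff_const, contDiff_const]

theorem hasDerivAt_ofCoord {a b : ℝ → Fin n → ℝ} {c : ℝ → ℝ} {a' b' : Fin n → ℝ} {c' s : ℝ}
    (ha : ∀ m, HasDerivAt (fun s => a s m) (a' m) s)
    (hb : ∀ m, HasDerivAt (fun s => b s m) (b' m) s) (hc : HasDerivAt c c' s) :
    HasDerivAt (fun s => ofCoord (a s) (b s) (c s)) (ofCoord a' b' c') s := by
  refine HasDerivAt.prodMk (F := Fin n → Fin 4 → ℝ) (G := Fin 3 → ℝ)
    (hasDerivAt_pi.2 fun m => hasDerivAt_pi.2 fun i => ?_) (hasDerivAt_pi.2 fun i => ?_)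
  · fin_cases i
    exacts [ha m, hb m, hasDerivAt_const _ _, hasDerivAt_const _ _]
  · fin_cases i
    exacts [hc, hasDerivAt_const _ _, hasDerivAt_const _ _]

/-- The partial derivatives of a function on `ℝⁿ`. -/
noncomputable def partials (φ : EuclideanSpace ℝ (Fin n) → ℝ) (x : EuclideanSpace ℝ (Fin n))
    (m : Fin n) : ℝ :=
  fderiv ℝ φ x (EuclideanSpace.single m (1 : ℝ))

theorem contDiff_partials (hφ : ContDiff ℝ 2 φ) : ContDiff ℝ 1 (partials φ) :=
  contDiff_pi.2 fun _ =>
    (hφ.fderiv_right (m := 1) (by norm_num)).clm_apply contDiff_const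

theorem fderiv_eq_sum_partials (x v : EuclideanSpace ℝ (Fin n)) :
    fderiv ℝ φ x v = ∑ m, v m * partials φ x m := by
  conv_lhs => rw [← (EuclideanSpace.basisFun (Fin n) ℝ).sum_repr v, map_sum]
  refine Finset.sum_congr rfl fun m _ => ?_
  simp [partials]

/-- The horizontal lift of the graph of the gradient of `φ`, dilated by `t`. -/
noncomputable def legendrian (φ : EuclideanSpace ℝ (Fin n) → ℝ) (t : ℝ)
    (x : EuclideanSpace ℝ (Fin n)) : QuatHeisenberg n :=
  ofCoord (t • x.ofLp) (t • partials φ x) (t ^ 2 * (φ x - 1 / 2 * ∑ m, x m * partials φ x m))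

theorem contDiff_legendrian (hφ : ContDiff ℝ 2 φ) (t : ℝ) : ContDiff ℝ 1 (legendrian φ t) := by
  have h1 := contDiff_partials hφ
  have h2 : ContDiff ℝ 1 φ := hφ.of_le (by norm_num)
  have h3 := contDiff_pi.1 h1
  have h4 : ContDiff ℝ 1 fun x : EuclideanSpace ℝ (Fin n) => x.ofLp :=
    contDiff_pi.2 fun m => by fun_prop
  refine contDiff_ofCoord (h4.const_smul t) (h1.const_smul t) ?_
  fun_prop

/-- The left-invariant coordinates of the derivative of a Legendrian graph. -/
noncomputable def legendrianDeriv (φ : EuclideanSpace ℝ (Fin n) → ℝ)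
    (x v : EuclideanSpace ℝ (Fin n)) : QuatHeisenberg n :=
  ofCoord v.ofLp (fderiv ℝ (partials φ) x v) 0

/-- The `I`-component is a multiple of `dφ - ∑ ∂_m φ dx_m = 0`. The tangent is therefore horizontal
and scales by `t`, although the `I`-coordinate itself scales by `t ^ 2`. -/
theorem maurerCartan_fderiv_legendrian (hφ : ContDiff ℝ 2 φ) (t : ℝ)
    (x v : EuclideanSpace ℝ (Fin n)) :
    maurerCartan (legendrian φ t x) (fderiv ℝ (legendrian φ t) x v) =
      t • legendrianDeriv φ x v := by
  have hline : HasDerivAt (fun s : ℝ => x + s • v) v 0 := by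
    simpa using ((hasDerivAt_id (0 : ℝ)).smul_const v).const_add x
  have hx0 : x + (0 : ℝ) • v = x := by rw [zero_smul, add_zero]
  have hx : ∀ m, HasDerivAt (fun s : ℝ => (x + s • v) m) (v m) 0 := fun m =>
    (EuclideanSpace.proj (𝕜 := ℝ) m).hasFDerivAt.comp_hasDerivAt 0 hline
  have hg : HasDerivAt (fun s : ℝ => partials φ (x + s • v)) (fderiv ℝ (partials φ) x v) 0 := by
    have h := ((contDiff_partials hφ).differentiable one_ne_zero (x + (0 : ℝ) • v)).hasFDerivAt
    have := h.comp_hasDerivAt 0 hline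
    rwa [hx0] at this
  have hφ' : HasDerivAt (fun s : ℝ => φ (x + s • v)) (fderiv ℝ φ x v) 0 := by
    have h := (hφ.differentiable two_ne_zero (x + (0 : ℝ) • v)).hasFDerivAt
    have := h.comp_hasDerivAt 0 hline
    rwa [hx0] at this
  set w := fderiv ℝ (partials φ) x v
  have hg' := hasDerivAt_pi.1 hg
  have hA := ((contDiff_legendrian hφ t).differentiable one_ne_zero
    (x + (0 : ℝ) • v)).hasFDerivAt.comp_hasDerivAt 0 hline
  have hB : HasDerivAt (fun s : ℝ => legendrian φ t (x + s • v)) (ofCoord (t • v.ofLp) (t • w)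
      (t ^ 2 * (fderiv ℝ φ x v - 1 / 2 * ∑ m, (v m * partials φ x m + x m * w m)))) 0 := by
    refine hasDerivAt_ofCoord (fun m => (hx m).const_mul t) (fun m => (hg' m).const_mul t)
      ((hφ'.sub (HasDerivAt.const_mul _ (HasDerivAt.fun_sum fun m _ => ?_))).const_mul _)
    have := (hx m).mul (hg' m)
    rwa [hx0] at this
  have hAB := hA.unique hB
  rw [hx0] at hAB
  rw [hAB, legendrian, maurerCartan_ofCoord, legendrianDeriv, smul_ofCoord]
  congr 1
  rw [fderiv_eq_sum_partials, mul_zero]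
  simp only [Pi.smul_apply, smul_eq_mul, mul_sub, Finset.mul_sum, ← Finset.sum_sub_distrib]
  refine Finset.sum_eq_zero fun m _ => ?_
  ring

/-- The quadratic correction in `calibCoord 0` cancels the term `-(1/2) ∑ x_m ∂_m φ` of the lift. -/
theorem calibCoord_zero_legendrian (t : ℝ) (x : EuclideanSpace ℝ (Fin n)) :
    calibCoord 0 (legendrian φ t x) = ((t ^ 2 * φ x : ℝ) : ℂ) := by
  have h : calibCoord 0 (legendrian φ t x) =
      (⟨t ^ 2 * (φ x - 1 / 2 * ∑ m, x m * partials φ x m), 0⟩ : ℂ) +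
        1 / 2 * ∑ m, (⟨t * partials φ x m, 0⟩ : ℂ) * ⟨t * x m, 0⟩ := rfl
  have h' : ∀ r : ℝ, (⟨r, 0⟩ : ℂ) = (r : ℂ) := fun r => rfl
  rw [h]
  simp only [h']
  push_cast
  rw [mul_sub, Finset.mul_sum, Finset.mul_sum, Finset.mul_sum, sub_add, ← Finset.sum_sub_distrib,
    Finset.sum_eq_zero fun m _ => by ring, sub_zero]

theorem calibCoord_succ_legendrian (t : ℝ) (x : EuclideanSpace ℝ (Fin n)) (m : Fin n) :
    calibCoord m.succ (legendrian φ t x) = ((t * x m : ℝ) : ℂ) := rfl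

variable {g : Bundle.ContMDiffRiemannianMetric 𝓘(ℝ, QuatHeisenberg n) ∞ (QuatHeisenberg n)
  (fun x : QuatHeisenberg n => TangentSpace 𝓘(ℝ, QuatHeisenberg n) x)}

/-- The Legendrian graph of the gradient of `φ` over the standard simplex. -/
noncomputable def legendrianSimplex (hg : IsLeftInvariant g) (hφ : ContDiff ℝ 2 φ) (t : ℝ) :
    LipSimplex g n :=
  ⟨fun x => legendrian φ t x, hg.exists_riemDist_le (contDiff_legendrian hφ t)⟩

theorem extend_legendrianSimplex (hg : IsLeftInvariant g) (hφ : ContDiff ℝ 2 φ) (t : ℝ) :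
    EqOn (extend (legendrianSimplex hg hφ t).1) (legendrian φ t) (simplex n) :=
  fun _ hx => extend_of_mem _ hx

/-- The factor `t ^ 2` comes from `calibCoord 0`, the factor `t ^ n` from the Jacobian `t • 1` of
the other coordinates. -/
theorem period_legendrianSimplex (hg : IsLeftInvariant g) (hφ : ContDiff ℝ 2 φ) (t : ℝ) :
    (legendrianSimplex hg hφ t).period = ((t ^ (n + 2) * ∫ x in simplex n, φ x : ℝ) : ℂ) := by
  have h : (legendrianSimplex hg hφ t).period = jacIntegral
      (fun x => ((t ^ 2 * φ x : ℝ) : ℂ)) fun (m : Fin n) x => ((t * x m : ℝ) : ℂ) := by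
    refine jacIntegral_congr (fun x hx => ?_) fun m x hx => ?_
    · rw [Function.comp_apply, extend_legendrianSimplex hg hφ t hx, calibCoord_zero_legendrian]
    · rw [Function.comp_apply, extend_legendrianSimplex hg hφ t hx, calibCoord_succ_legendrian]
  have hjac : ∀ x, jacMatrix (fun (m : Fin n) (x : EuclideanSpace ℝ (Fin n)) =>
      ((t * x m : ℝ) : ℂ)) x = (t : ℂ) • 1 := by
    intro x
    ext i j
    have hd : HasFDerivAt (fun x : EuclideanSpace ℝ (Fin n) => ((t * x j : ℝ) : ℂ))
        (Complex.ofRealCLM.comp (t • EuclideanSpace.proj (𝕜 := ℝ) j)) x :=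
      Complex.ofRealCLM.hasFDerivAt.comp x
        ((EuclideanSpace.proj (𝕜 := ℝ) j).hasFDerivAt.const_mul t)
    rw [jacMatrix, Matrix.of_apply, hd.fderiv]
    rcases eq_or_ne j i with rfl | hij
    · simp
    · simp [hij, hij.symm]
  rw [h, jacIntegral, ← integral_const_mul, ← integral_complex_ofReal]
  refine integral_congr_ae (Eventually.of_forall fun x => ?_)
  simp only [hjac, Matrix.det_smul, Matrix.det_one, Fintype.card_fin]
  push_cast
  ring

/-- The Gram matrix is `t ^ 2` times one independent of `t`, so the Jacobian scales by `t ^ n`;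
compactness bounds the rest. -/
theorem exists_vol_legendrianSimplex_le (hg : IsLeftInvariant g) (hφ : ContDiff ℝ 2 φ) :
    ∃ M : ℝ, 0 ≤ M ∧ ∀ t, 0 ≤ t → (legendrianSimplex hg hφ t).vol ≤ ENNReal.ofReal (M * t ^ n) := by
  set G : EuclideanSpace ℝ (Fin n) → Matrix (Fin n) (Fin n) ℝ := fun x => Matrix.of fun i j =>
    innerAt g 1 (legendrianDeriv φ x (EuclideanSpace.single i (1 : ℝ)))
      (legendrianDeriv φ x (EuclideanSpace.single j (1 : ℝ)))
  have hcd : ∀ i : Fin n, Continuous fun x =>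
      legendrianDeriv φ x (EuclideanSpace.single i (1 : ℝ)) := fun i =>
    (contDiff_ofCoord (k := 0) contDiff_const (contDiff_zero.2
      (((contDiff_partials hφ).continuous_fderiv one_ne_zero).clm_apply continuous_const))
      contDiff_const).continuous
  have hG : Continuous fun x => Real.sqrt (G x).det := by
    refine Real.continuous_sqrt.comp (Continuous.matrix_det
      (continuous_matrix fun i j => ?_))
    have h1 := hcd i
    have h2 := hcd j
    exact ((innerAt g 1).continuous.comp h1).clm_apply h2
  obtain ⟨M, hM⟩ := (isCompact_simplex n).exists_bound_of_continuousOn hG.continuousOn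
  have hM0 : 0 ≤ M := (norm_nonneg _).trans (hM 0 (zero_mem_simplex n))
  refine ⟨M * (volume (simplex n)).toReal, by positivity, fun t ht => ?_⟩
  have hjac : ∀ x ∈ interior (simplex n),
      jacobian g (legendrianSimplex hg hφ t).1 x ≤ M * t ^ n := by
    intro x hx
    have hE := extend_legendrianSimplex hg hφ t
    rw [jacobian_eq _ hx, (Filter.eventuallyEq_of_mem (mem_interior_iff_mem_nhds.1 hx)
      hE).fderiv_eq, hE (interior_subset hx)]
    have hm : (Matrix.of fun i j => innerAt g (legendrian φ t x)
        (fderiv ℝ (legendrian φ t) x (EuclideanSpace.single i (1 : ℝ)))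
        (fderiv ℝ (legendrian φ t) x (EuclideanSpace.single j (1 : ℝ)))) = (t ^ 2) • G x := by
      ext i j
      rw [Matrix.of_apply, hg.innerAt_eq, maurerCartan_fderiv_legendrian hφ,
        maurerCartan_fderiv_legendrian hφ, map_smul, map_smul, _root_.smul_apply, Matrix.smul_apply,
        smul_eq_mul, smul_eq_mul, smul_eq_mul]
      change t * (t * G x i j) = t ^ 2 * G x i j
      ring
    rw [hm, Matrix.det_smul, Fintype.card_fin, ← pow_mul, mul_comm 2 n, pow_mul,
      Real.sqrt_mul (by positivity), Real.sqrt_sq (by positivity), mul_comm]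
    exact mul_le_mul_of_nonneg_right ((le_abs_self _).trans (hM x (interior_subset hx)))
      (by positivity)
  have h : (legendrianSimplex hg hφ t).vol ≤
      ∫⁻ x in simplex n, ENNReal.ofReal (M * t ^ n) := by
    refine lintegral_mono_ae ?_
    filter_upwards [ae_mem_interior_simplex n] with x hx
    exact ENNReal.ofReal_le_ofReal (hjac x hx)
  refine h.trans_eq ?_
  rw [setLIntegral_const, mul_right_comm, ENNReal.ofReal_mul (mul_nonneg hM0 (pow_nonneg ht n)),
    ENNReal.ofReal_toReal (volume_simplex_lt_top n).ne]

end Filling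

namespace Filling

open MeasureTheory Set Filter Topology

open QuatHeisenberg

/-! ### Legendrian cycles -/

/-- The square of the product of the barycentric coordinates. -/
noncomputable def bump (n : ℕ) (x : EuclideanSpace ℝ (Fin n)) : ℝ :=
  ((1 - ∑ i, x i) * ∏ i, x i) ^ 2

theorem contDiff_baryProd (n : ℕ) : ContDiff ℝ 2 fun x : EuclideanSpace ℝ (Fin n) =>
    (1 - ∑ i, x i) * ∏ i, x i := by
  refine ContDiff.mul (by fun_prop) (contDiff_prod fun i _ => by fun_prop)

theorem contDiff_bump (n : ℕ) : ContDiff ℝ 2 (bump n) :=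
  (contDiff_baryProd n).pow 2

theorem integral_bump_pos (n : ℕ) : 0 < ∫ x in simplex n, bump n x := by
  have hc := (contDiff_bump n).continuous
  rw [setIntegral_pos_iff_support_of_nonneg_ae (f := bump n)
    (Eventually.of_forall fun x => sq_nonneg _)
    (hc.continuousOn.integrableOn_compact (isCompact_simplex n))]
  let U : Set (EuclideanSpace ℝ (Fin n)) := (⋂ i, {x | 0 < x i}) ∩ {x | ∑ i, x i < 1}
  have hU : IsOpen U := (isOpen_iInter_of_finite fun i => isOpen_lt (by fun_prop) (by fun_prop)).inter
    (isOpen_lt (by fun_prop) (by fun_prop))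
  have hsub : U ⊆ Function.support (bump n) ∩ simplex n := by
    intro x hx
    have h1 : ∀ i, 0 < x i := mem_iInter.1 hx.1
    have h2 : ∑ i, x i < 1 := hx.2
    exact ⟨(pow_pos (mul_pos (sub_pos.2 h2) (Finset.prod_pos fun i _ => h1 i)) 2).ne',
      fun i => (h1 i).le, h2.le⟩
  refine (hU.measure_pos volume ⟨WithLp.toLp 2 fun _ => 1 / ((n : ℝ) + 1), ?_, ?_⟩).trans_le
    (measure_mono hsub)
  · simp only [mem_iInter, mem_ofPred_eq]
    intro i; positivity
  · simp only [mem_ofPred_eq, Finset.sum_const, Finset.card_univ, Fintype.card_fin, nsmul_eq_mul]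
    rw [mul_one_div, div_lt_one (by positivity)]
    linarith

theorem baryProd_faceFun {n : ℕ} (i : Fin (n + 2)) (x : EuclideanSpace ℝ (Fin n)) :
    (1 - ∑ j, faceFun i x j) * ∏ j, faceFun i x j = 0 := by
  refine Fin.cases ?_ (fun i => ?_) i
  · have : ∑ j, faceFun 0 x j = 1 := by
      rw [faceFun_zero, insCoord, Fin.sum_univ_succAbove _ 0]
      simp
    rw [this, sub_self, zero_mul]
  · refine mul_eq_zero_of_right _ (Finset.prod_eq_zero (Finset.mem_univ i) ?_)
    rw [faceFun_succ, insCoord]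
    simp

theorem legendrian_eq_of_eq_zero {n : ℕ} {φ : EuclideanSpace ℝ (Fin n) → ℝ}
    {x : EuclideanSpace ℝ (Fin n)} (h : φ x = 0) (h' : fderiv ℝ φ x = 0) (t : ℝ) :
    legendrian φ t x = legendrian (fun _ => 0) t x := by
  have h1 : partials φ x = partials (fun _ => 0) x := by
    funext m
    rw [partials, partials, h', fderiv_const_apply]
  rw [legendrian, legendrian, h1, h]

/-- The lift involves `φ` and its gradient. The product of barycentric coordinates vanishes on every
face, and squaring it makes the gradient vanish there too. -/
theorem legendrian_bump_faceFun {n : ℕ} (i : Fin (n + 2)) (x : EuclideanSpace ℝ (Fin n)) (t : ℝ) :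
    legendrian (bump (n + 1)) t (faceFun i x) = legendrian (fun _ => 0) t (faceFun i x) := by
  have h0 := baryProd_faceFun i x
  refine legendrian_eq_of_eq_zero ?_ ?_ t
  · rw [bump, h0, zero_pow two_ne_zero]
  · have h := (((contDiff_baryProd (n + 1)).differentiable two_ne_zero
      (faceFun i x)).hasFDerivAt.pow 2).fderiv
    refine h.trans ?_
    simp [h0]

section Mass

variable {E : Type*} [NormedAddCommGroup E] [NormedSpace ℝ E] {H : Type*} [TopologicalSpace H]
  {I : ModelWithCorners ℝ E H} {M : Type*} [TopologicalSpace M] [ChartedSpace H M]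
  [IsManifold I ∞ M] {g : Bundle.ContMDiffRiemannianMetric I ∞ E (fun x : M => TangentSpace I x)}

theorem mass_single_sub_single_le {m : ℕ} (α β : LipSimplex g m) :
    mass (Finsupp.single α 1 - Finsupp.single β 1) ≤ α.vol + β.vol := by
  classical
  rcases eq_or_ne α β with rfl | h
  · rw [sub_self, mass, Finsupp.sum_zero_index]
    exact zero_le
  · have hs : (Finsupp.single α (1 : ℤ) - Finsupp.single β 1).support ⊆ {α, β} := by
      intro γ hγ
      rw [Finset.mem_insert, Finset.mem_singleton]
      by_contra! hne
      rw [Finsupp.mem_support_iff, Finsupp.sub_apply, Finsupp.single_eq_of_ne hne.1,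
        Finsupp.single_eq_of_ne hne.2] at hγ
      exact hγ (sub_zero _)
    rw [mass, Finsupp.sum_of_support_subset _ hs _ (by simp), Finset.sum_pair h]
    simp [h, h.symm]

theorem boundary_single_sub_single {m : ℕ} {α β : LipSimplex g (m + 1)}
    (h : ∀ i, α.face i = β.face i) :
    boundary g (m + 1) (Finsupp.single α 1 - Finsupp.single β 1) = 0 := by
  rw [map_sub, boundary, Finsupp.liftAddHom_apply_single, Finsupp.liftAddHom_apply_single]
  simp only [h, sub_self]

end Mass

end Filling

namespace Filling

open MeasureTheory Set Filter Topology

open QuatHeisenberg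

/-! ### The filling volume function -/

variable {n : ℕ} {g : Bundle.ContMDiffRiemannianMetric 𝓘(ℝ, QuatHeisenberg n) ∞ (QuatHeisenberg n)
  (fun x : QuatHeisenberg n => TangentSpace 𝓘(ℝ, QuatHeisenberg n) x)}

/-- Cycles of mass `t ^ n` on which the primitive of the calibrating form is of size
`t ^ (n + 2)`. -/
theorem IsLeftInvariant.exists_cycle (hg : IsLeftInvariant g) (hn : 1 ≤ n) :
    ∃ M c : ℝ, 0 ≤ M ∧ 0 < c ∧ ∀ t, 0 ≤ t → ∃ a : Chain g n, boundary g n a = 0 ∧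
      mass a ≤ ENNReal.ofReal (M * t ^ n) ∧ chainPeriod g a = ((t ^ (n + 2) * c : ℝ) : ℂ) := by
  have h0 : ContDiff ℝ 2 fun _ : EuclideanSpace ℝ (Fin n) => (0 : ℝ) := contDiff_const
  obtain ⟨M₁, hM₁, hα⟩ := exists_vol_legendrianSimplex_le hg (contDiff_bump n)
  obtain ⟨M₂, hM₂, hβ⟩ := exists_vol_legendrianSimplex_le hg h0
  refine ⟨M₁ + M₂, _, add_nonneg hM₁ hM₂, integral_bump_pos n, fun t ht =>
    ⟨Finsupp.single (legendrianSimplex hg (contDiff_bump n) t) 1 -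
      Finsupp.single (legendrianSimplex hg h0 t) 1, ?_, ?_, ?_⟩⟩
  -- Writing `n = k + 1` exposes the alternating face sum in `boundary`; all faces of the two
  -- simplices coincide.
  · obtain ⟨k, rfl⟩ := Nat.exists_eq_add_of_le' hn
    exact boundary_single_sub_single fun i =>
      Subtype.ext (funext fun x => legendrian_bump_faceFun i x.1 t)
  · rw [add_mul, ENNReal.ofReal_add (by positivity) (by positivity)]
    exact (mass_single_sub_single_le _ _).trans (add_le_add (hα t ht) (hβ t ht))
  · rw [map_sub, chainPeriod_single, chainPeriod_single, one_smul, one_smul,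
      period_legendrianSimplex, period_legendrianSimplex, integral_zero, mul_zero,
      Complex.ofReal_zero, sub_zero]

theorem IsLeftInvariant.asympLE_fillingVolume (hg : IsLeftInvariant g) (hn : 1 ≤ n) :
    AsympLE (fun l : ℝ => ENNReal.ofReal (l ^ (((n : ℝ) + 2) / (n : ℝ)))) (fillingVolume g n) := by
  obtain ⟨M, c, hM, hc, hcyc⟩ := hg.exists_cycle hn
  obtain ⟨K, hK, hcal⟩ := hg.exists_enorm_chainPeriod_boundary_le
  -- `M` makes the cycle admissible, of mass at most `C * l`; `c⁻¹ * K` converts the period into a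
  -- lower bound for the mass of a filling.
  set C : ℝ := max M (c⁻¹ * K)
  have hC : 0 < C := lt_max_of_lt_right (by positivity)
  refine ⟨C, hC, fun l hl => ?_⟩
  rw [add_assoc]
  -- The linear and constant terms of the asymptotic relation are not needed.
  refine le_trans ?_ le_self_add
  beta_reduce
  set t : ℝ := l ^ (n : ℝ)⁻¹
  have ht : 0 ≤ t := Real.rpow_nonneg hl.le _
  have htn : t ^ n = l := Real.rpow_inv_natCast_pow hl.le (Nat.one_le_iff_ne_zero.1 hn)
  have htn2 : t ^ (n + 2) = l ^ (((n : ℝ) + 2) / (n : ℝ)) := by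
    rw [← Real.rpow_natCast, ← Real.rpow_mul hl.le, div_eq_inv_mul]
    push_cast
    rfl
  obtain ⟨a, ha, hmass, hper⟩ := hcyc t ht
  rw [htn] at hmass
  rw [← htn2, mul_comm, ← ENNReal.div_le_iff_le_mul (Or.inl (ENNReal.ofReal_pos.2 hC).ne')
    (Or.inl ENNReal.ofReal_ne_top)]
  refine le_trans ?_ (le_iSup_of_le a (le_iSup_of_le ha (le_iSup_of_le (hmass.trans
    (ENNReal.ofReal_le_ofReal (mul_le_mul_of_nonneg_right (le_max_left _ _) hl.le))) le_rfl)))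
  refine le_iInf fun b => le_iInf fun hb => ?_
  rw [ENNReal.div_le_iff_le_mul (Or.inl (ENNReal.ofReal_pos.2 hC).ne')
    (Or.inl ENNReal.ofReal_ne_top)]
  have h := hcal b
  rw [hb, hper, ← ofReal_norm, Complex.norm_real, Real.norm_of_nonneg (by positivity),
    ENNReal.ofReal_mul (by positivity)] at h
  calc ENNReal.ofReal (t ^ (n + 2))
      = ENNReal.ofReal c⁻¹ * (ENNReal.ofReal (t ^ (n + 2)) * ENNReal.ofReal c) := by
        rw [mul_left_comm, ← ENNReal.ofReal_mul (by positivity), inv_mul_cancel₀ hc.ne',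
          ENNReal.ofReal_one, mul_one]
    _ ≤ ENNReal.ofReal c⁻¹ * (ENNReal.ofReal K * mass b) := mul_le_mul_right h _
    _ = ENNReal.ofReal (c⁻¹ * K) * mass b := by
        rw [ENNReal.ofReal_mul (by positivity), mul_assoc]
    _ ≤ mass b * ENNReal.ofReal C := by
        rw [mul_comm]
        exact mul_le_mul_right (ENNReal.ofReal_le_ofReal (le_max_right _ _)) _

end Filling

theorem mainTheorem2 (n : ℕ) (hn : 1 ≤ n)
    (g : Bundle.ContMDiffRiemannianMetric 𝓘(ℝ, QuatHeisenberg n) ∞ (QuatHeisenberg n)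
      (fun x : QuatHeisenberg n => TangentSpace 𝓘(ℝ, QuatHeisenberg n) x))
    (hg : Filling.IsLeftInvariant g) :
    Filling.AsympLE (fun l : ℝ => ENNReal.ofReal (l ^ (((n : ℝ) + 2) / (n : ℝ))))
      (Filling.fillingVolume g n) := by
  exact hg.asympLE_fillingVolume hn
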